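/- All graphs are finite and simple. A \emph{rooted forest} is a disjoint union of rooted trees; the \emph{depth} of a node is the number of vertices on the path from the root of its tree to it, and the \emph{height} of a forest is the maximum depth of its nodes ($0$ for the empty forest). A \emph{treedepth decomposition} of a graph $G$ is a pair $(F,\psi)$ of a finite rooted forest $F$ and an injective map $\psi\colon V(G)\to V(F)$ such that for every edge $uv$ of $G$ one of $\psi(u),\psi(v)$ is an ancestor of the other in $F$. The \emph{treedepth} $\mathrm{td}(G)$ is the minimum height of a treedepth decomposition of $G$. \textbf{Theorem.} There is a single algorithm (a program for a unit-cost word RAM) that takes as input a graph $G$ on the vertices $0,\dots,n-1$, given by adjacency lists in any order, and an integer $t\ge 0$, and decides whether $\mathrm{td}(G)\le t$, in time and space $2^{2^{O(t)}}\cdot n$; if $\mathrm{td}(G)\le t$, it also outputs, within the same bounds, a treedepth decomposition $(F,\psi)$ of $G$ of height at most $t$ (with $V(F)=V(G)$ and $\psi=\mathrm{id}$, as an array of parents). Precisely, there is a constant $c$, independent of $G$, $n$ and $t$, such that, with $B=2^{2^{c\cdot\max(t,1)}}\cdot\max(n,1)$, the program halts after at most $B$ steps, it uses only the first $B$ cells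 of each of its finitely many work arrays, and all numbers that it handles are at most $B$ plus the length of the input. The input is read-only with random access and does not count as work space. -/

import Mathlib

/-! ### Rooted forests, treedepth decompositions, treedepth -/

/-- A rooted forest on the node set `α`, given by its parent function (`none` at the roots).
Well-foundedness says that climbing from a node to its parent always ends, at a root. -/
structure RootedForest (α : Type*) where
  parent : α → Option α
  wf : WellFounded fun p v : α => parent v = some p

namespace RootedForest

variable {α : Type*} (F : RootedForest α)

/-- `p` is the parent of `v`. -/
def IsParent (p v : α) : Prop := F.parent v = some p

/-- `u` is a (proper) ancestor of `v`. -/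
def IsAncestor (u v : α) : Prop := Relation.TransGen F.IsParent u v

/-- The number of vertices on the path from the root to `v`, that is `v` and its ancestors;
a root has depth one. -/
noncomputable def depth (v : α) : ℕ := {u | u = v ∨ F.IsAncestor u v}.ncard

/-- The maximum depth of a node (zero for the empty forest). -/
noncomputable def height [Fintype α] : ℕ := Finset.univ.sup F.depth

end RootedForest

/-- `(F, ψ)` is a treedepth decomposition of `G`. -/
def IsTreedepthDecomposition {V α : Type*} (G : SimpleGraph V) (F : RootedForest α)
    (ψ : V → α) : Prop :=
  Function.Injective ψ ∧
    ∀ u v, G.Adj u v → F.IsAncestor (ψ u) (ψ v) ∨ F.IsAncestor (ψ v) (ψ u)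

/-- The minimum height of a treedepth decomposition of `G`. Every finite forest is a copy of
one whose set of nodes is some `Fin m`. -/
noncomputable def treedepth {V : Type*} [Fintype V] (G : SimpleGraph V) : ℕ :=
  sInf {h | ∃ (m : ℕ) (F : RootedForest (Fin m)) (ψ : V → Fin m),
    IsTreedepthDecomposition G F ψ ∧ F.height = h}

/-! ### Random access machines

A word RAM with unit costs. It has a read-only input, which is a list of numbers with random
access, finitely many registers, and a random access work memory that is organized in finitely
many arrays (a program mentions only finitely many registers and arrays). The parameters are
* `inp`, the input,
* `S`, the number of cells in each array of the work memory,
* `W`, the largest number that fits in a word.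
A computation that leaves the input or the memory, or whose numbers do not fit in a word, gets
stuck. Control flow is structured. -/

namespace RAM

structure State where
  reg : ℕ → ℕ
  mem : ℕ → ℕ → ℕ

/-- All registers and all memory cells hold `0`. -/
def State.init : State := ⟨fun _ => 0, fun _ _ => 0⟩

/-- Put `v` into register `x`, if it fits in a word. -/
def State.setReg (W : ℕ) (s : State) (x v : ℕ) : Option State :=
  if v ≤ W then some { s with reg := Function.update s.reg x v } else none

/-- Put `v` into cell `i` of array `a`. -/
def State.setMem (s : State) (a i v : ℕ) : State :=
  { s with mem := Function.update s.mem a (Function.update (s.mem a) i v) }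

/-- Elementary instructions; `x`, `y`, `z` are names of registers, `a` is the name of an array. -/
inductive Instr where
  /-- `x := k` -/
  | const (x k : ℕ)
  /-- `x := y + z` -/
  | add (x y z : ℕ)
  /-- `x := max (y - z) 0` -/
  | sub (x y z : ℕ)
  /-- `x := y * z` -/
  | mul (x y z : ℕ)
  /-- `x := ⌊y / z⌋`, and `x := 0` if `z` holds `0` -/
  | div (x y z : ℕ)
  /-- `x := input[y]` -/
  | read (x y : ℕ)
  /-- `x := a[y]` -/
  | load (x a y : ℕ)
  /-- `a[x] := y` -/
  | store (a x y : ℕ)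

/-- The effect of an instruction; `none` if the computation gets stuck. -/
def Instr.step (inp : List ℕ) (S W : ℕ) (s : State) : Instr → Option State
  | const x k => s.setReg W x k
  | add x y z => s.setReg W x (s.reg y + s.reg z)
  | sub x y z => s.setReg W x (s.reg y - s.reg z)
  | mul x y z => s.setReg W x (s.reg y * s.reg z)
  | div x y z => s.setReg W x (s.reg y / s.reg z)
  | read x y => (inp[s.reg y]?).bind (s.setReg W x)
  | load x a y => if s.reg y < S then s.setReg W x (s.mem a (s.reg y)) else none
  | store a x y => if s.reg x < S then some (s.setMem a (s.reg x) (s.reg y)) else none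

inductive Prog where
  | skip
  | instr (i : Instr)
  | seq (P Q : Prog)
  /-- run `P` if register `x` is not `0`, else run `Q` -/
  | ifNZ (x : ℕ) (P Q : Prog)
  /-- run `P` as long as register `x` is not `0` -/
  | whileNZ (x : ℕ) (P : Prog)

/-- `Exec inp S W P s k s'`: on the machine with input `inp`, arrays of `S` cells and words for
the numbers `0, …, W`, the program `P` started in the state `s` halts in the state `s'` after
exactly `k` steps, and never gets stuck. Each elementary instruction and each test of a register
is one step. -/
inductive Exec (inp : List ℕ) (S W : ℕ) : Prog → State → ℕ → State → Prop where
  | skip (s : State) : Exec inp S W .skip s 0 s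
  | instr (i : Instr) (s s' : State) (h : i.step inp S W s = some s') :
      Exec inp S W (.instr i) s 1 s'
  | seq (P Q : Prog) (s s' s'' : State) (k l : ℕ)
      (hP : Exec inp S W P s k s') (hQ : Exec inp S W Q s' l s'') :
      Exec inp S W (.seq P Q) s (k + l) s''
  | ifTrue (x : ℕ) (P Q : Prog) (s s' : State) (k : ℕ) (hx : s.reg x ≠ 0)
      (hP : Exec inp S W P s k s') : Exec inp S W (.ifNZ x P Q) s (k + 1) s'
  | ifFalse (x : ℕ) (P Q : Prog) (s s' : State) (k : ℕ) (hx : s.reg x = 0)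
      (hQ : Exec inp S W Q s k s') : Exec inp S W (.ifNZ x P Q) s (k + 1) s'
  | whileTrue (x : ℕ) (P : Prog) (s s' s'' : State) (k l : ℕ) (hx : s.reg x ≠ 0)
      (hP : Exec inp S W P s k s') (hrest : Exec inp S W (.whileNZ x P) s' l s'') :
      Exec inp S W (.whileNZ x P) s (k + l + 1) s''
  | whileFalse (x : ℕ) (P : Prog) (s : State) (hx : s.reg x = 0) :
      Exec inp S W (.whileNZ x P) s 1 s

end RAM

/-! ### Input and output of the algorithm -/

/-- `adj v` lists the neighbours of `v` in `G`, each of them once, in any order. -/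
def IsAdjacencyList {n : ℕ} (G : SimpleGraph (Fin n)) (adj : Fin n → List (Fin n)) : Prop :=
  ∀ v, (adj v).Nodup ∧ ∀ u, u ∈ adj v ↔ G.Adj v u

/-- The input for the graph with adjacency lists `adj` and the integer `t`: the numbers `n` and
`t`, then `n + 1` positions `p 0, …, p n`, then all adjacency lists one after the other. The list
of the vertex `v` is at the positions `p v, …, p (v + 1) - 1` of the input. -/
def encodeInput {n : ℕ} (t : ℕ) (adj : Fin n → List (Fin n)) : List ℕ :=
  [n, t] ++
  (List.range (n + 1)).map (fun i => n + 3 + (((List.ofFn adj).take i).map List.length).sum) ++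
  (List.ofFn adj).flatten.map Fin.val

/-- Array `0` of the memory holds the forest `F` on `Fin n`: its cell `v` holds `0` if `v` is a
root, and `p + 1` if `p` is the parent of `v`. -/
def HoldsForest {n : ℕ} (s : RAM.State) (F : RootedForest (Fin n)) : Prop :=
  ∀ v : Fin n, s.mem 0 v = (F.parent v).elim 0 fun p => (p : ℕ) + 1

/-! The algorithm tries roots, and every failure has a small reason. Suppose that a component C of
an induced subgraph is to be decomposed with height k + 1. Delete a vertex c of C and solve the
components of the rest for height k. If all of them succeed, c on top of their decompositions solves
C. Otherwise one of them yields a set H of at most b vertices that avoids c and induces treedepth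
more than k. Every possible root of C lies in H, so at most b further roots have to be tried. If
each x in H fails as well, it fails with a set H_x of at most b vertices that avoids x and induces
treedepth more than k. Join H and all H_x, and add paths to the leader of C to make the union
connected. The result has treedepth more than k + 1: a connected graph of treedepth at most k + 1
has a vertex r whose removal leaves treedepth at most k (`TdLe.exists_erase`), but removing r leaves
H intact if r is outside of H, and H_r otherwise. Paths have fewer than 2^t vertices
(`TdLe.length_lt`), so the new set has at most 2^t (b + b^2) vertices. This recurrence is
`markBound`; it starts with single vertices for k = 0 and is doubly exponential in t. The argument
is carried by `RoundInv.next` and `Solved.of_rounds`.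

The time is linear in n because all components on a level are treated in parallel: in each round
every component tries its own root, and the graph without these roots is passed down as a whole. The
number of passes depends on t only (`duration`). Components, leaders and the paths to them come from
propagating minimal labels along the edges for at least 2^t rounds (`Propagating.final`). A graph of
treedepth at most t has at most 2tn ordered adjacent pairs (`TdLe.card_adj_le`), so inputs with more
are rejected at once.

Label propagation is guaranteed to finish only if the treedepth of the whole graph is at most t, so
the search is proved correct under this promise (`search_spec`). Afterwards the array of parents is
checked (`check_spec`). A positive answer is therefore certified, and a negative answer is right
because the promise would have led to a decomposition (`main_spec`).

Since the promise may fail, the running time must not depend on it. The program is written in a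
language of for-loops with total expressions, whose cost is a function of the parameters;
`Cmd.prog_runs` transfers values and cost to the machine. The recursion becomes one loop around
`step`, with a row of each array for each level (`returned_of_enter`). -/

namespace RAM

/-! ### Runs with a bound on the number of steps -/

/-- The program `P`, started in the state `s`, halts after at most `b` steps in a state with the
property `Q`. -/
def Runs (inp : List ℕ) (S W : ℕ) (P : Prog) (s : State) (b : ℕ) (Q : State → Prop) : Prop :=
  ∃ k s₁, Exec inp S W P s k s₁ ∧ k ≤ b ∧ Q s₁

/-- The state `s` with `v` in register `x`. -/
def State.put (s : State) (x v : ℕ) : State := { s with reg := Function.update s.reg x v }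

@[simp] lemma State.put_mem (s : State) (x v : ℕ) : (s.put x v).mem = s.mem := rfl

@[simp] lemma State.put_reg_self (s : State) (x v : ℕ) : (s.put x v).reg x = v := by
  simp [State.put]

lemma State.put_reg (s : State) (x v y : ℕ) :
    (s.put x v).reg y = if y = x then v else s.reg y := by
  simp [State.put, Function.update_apply]

@[simp] lemma State.put_reg_of_ne (s : State) (x v y : ℕ) (h : y ≠ x) :
    (s.put x v).reg y = s.reg y := by
  simp [State.put_reg, h]

section Rules

variable {inp : List ℕ} {S W : ℕ} {P P' : Prog} {s : State} {b b' : ℕ} {Q Q' : State → Prop}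

lemma Runs.mono (h : Runs inp S W P s b Q) (hb : b ≤ b') (hQ : ∀ s', Q s' → Q' s') :
    Runs inp S W P s b' Q' := by
  obtain ⟨k, s', h1, h2, h3⟩ := h
  exact ⟨k, s', h1, h2.trans hb, hQ _ h3⟩

lemma Runs.skip (h : Q s) : Runs inp S W .skip s 0 Q := ⟨0, s, .skip s, le_rfl, h⟩

lemma Runs.seq (h : Runs inp S W P s b fun s' => Runs inp S W P' s' b' Q) :
    Runs inp S W (.seq P P') s (b + b') Q := by
  obtain ⟨k, s', h1, h2, l, s'', h3, h4, h5⟩ := h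
  exact ⟨k + l, s'', .seq _ _ _ _ _ _ _ h1 h3, by omega, h5⟩

/-- The bounds of both branches are added; a maximum would be sharper, but only the order of
magnitude matters. -/
lemma Runs.ifNZ {x : ℕ} (h : s.reg x ≠ 0 → Runs inp S W P s b Q)
    (h' : s.reg x = 0 → Runs inp S W P' s b' Q) :
    Runs inp S W (.ifNZ x P P') s (b + b' + 1) Q := by
  by_cases hx : s.reg x = 0
  · obtain ⟨k, s', h1, h2, h3⟩ := h' hx
    exact ⟨k + 1, s', .ifFalse _ _ _ _ _ _ hx h1, by omega, h3⟩
  · obtain ⟨k, s', h1, h2, h3⟩ := h hx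
    exact ⟨k + 1, s', .ifTrue _ _ _ _ _ _ hx h1, by omega, h3⟩

/-- A loop with invariant `I`, where `I j` holds when `j` rounds are left. -/
lemma Runs.whileNZ {x : ℕ} (I : ℕ → State → Prop)
    (hI : ∀ j s, I j s → (s.reg x = 0 ↔ j = 0))
    (hP : ∀ j s, I (j + 1) s → Runs inp S W P s b (I j)) (j : ℕ) (hs : I j s) :
    Runs inp S W (.whileNZ x P) s (j * (b + 1) + 1) (I 0) := by
  induction j generalizing s with
  | zero => exact ⟨1, s, .whileFalse _ _ _ ((hI 0 s hs).2 rfl), by omega, hs⟩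
  | succ j ih =>
    obtain ⟨k, s', h1, h2, h3⟩ := hP j s hs
    obtain ⟨l, s'', h4, h5, h6⟩ := ih h3
    refine ⟨k + l + 1, s'', .whileTrue _ _ _ _ _ _ _ ?_ h1 h4, ?_, h6⟩
    · intro h0
      have := (hI _ _ hs).1 h0
      omega
    · rw [Nat.succ_mul]; omega

/-- Every instruction except `store` writes one register, so the rules for these instructions are
instances of this one. -/
lemma Runs.put {i : Instr} {x v : ℕ} (hi : i.step inp S W s = s.setReg W x v) (hv : v ≤ W)
    (h : Q (s.put x v)) : Runs inp S W (.instr i) s 1 Q :=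
  ⟨1, s.put x v, .instr _ _ _ (by rw [hi]; simp [State.setReg, hv, State.put]), le_rfl, h⟩

lemma Runs.const {x k : ℕ} (hv : k ≤ W) (h : Q (s.put x k)) :
    Runs inp S W (.instr (.const x k)) s 1 Q := Runs.put rfl hv h

lemma Runs.add {x y z : ℕ} (hv : s.reg y + s.reg z ≤ W) (h : Q (s.put x (s.reg y + s.reg z))) :
    Runs inp S W (.instr (.add x y z)) s 1 Q := Runs.put rfl hv h

lemma Runs.sub {x y z : ℕ} (hv : s.reg y - s.reg z ≤ W) (h : Q (s.put x (s.reg y - s.reg z))) :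
    Runs inp S W (.instr (.sub x y z)) s 1 Q := Runs.put rfl hv h

lemma Runs.mul {x y z : ℕ} (hv : s.reg y * s.reg z ≤ W) (h : Q (s.put x (s.reg y * s.reg z))) :
    Runs inp S W (.instr (.mul x y z)) s 1 Q := Runs.put rfl hv h

lemma Runs.read {x y v : ℕ} (hy : inp[s.reg y]? = some v) (hv : v ≤ W) (h : Q (s.put x v)) :
    Runs inp S W (.instr (.read x y)) s 1 Q :=
  Runs.put (by simp [Instr.step, hy]) hv h

lemma Runs.load {x a y : ℕ} (hy : s.reg y < S) (hv : s.mem a (s.reg y) ≤ W)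
    (h : Q (s.put x (s.mem a (s.reg y)))) :
    Runs inp S W (.instr (.load x a y)) s 1 Q :=
  Runs.put (by simp [Instr.step, hy]) hv h

lemma Runs.store {a x y : ℕ} (hx : s.reg x < S) (h : Q (s.setMem a (s.reg x) (s.reg y))) :
    Runs inp S W (.instr (.store a x y)) s 1 Q :=
  ⟨1, _, .instr _ _ _ (by simp [Instr.step, hx]), le_rfl, h⟩

end Rules

/-! ### A language with bounded loops

Programs of this language work on two-dimensional arrays. They never get stuck, and the number of
steps that they make depends on their parameters only. -/

/-- The contents of the arrays: `M a r c` is the entry in row `r` and column `c` of array `a`. -/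
abbrev Mem := ℕ → ℕ → ℕ → ℕ

/-- Expressions. -/
inductive Exp where
  | zero
  | one
  /-- the `i`-th parameter -/
  | param (i : ℕ)
  /-- the variable of the `j`-th enclosing loop, counted from the outside -/
  | var (j : ℕ)
  /-- the entry of array `a` in row `r` and column `c` -/
  | get (a : ℕ) (r c : Exp)
  /-- an entry of the input -/
  | inp (e : Exp)
  | add (e f : Exp)
  | sub (e f : Exp)
  /-- `e` if `c` is not `0`, else `f` -/
  | ite (c e f : Exp)

/-- Commands. -/
inductive Cmd where
  | set (a : ℕ) (r c e : Exp)
  | seq (A B : Cmd)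
  | ite (e : Exp) (A B : Cmd)
  /-- run `A` as often as the `p`-th parameter says -/
  | loop (p : ℕ) (A : Cmd)
  | skip

/-- The read-only data: the input and the parameters. -/
structure Ctx where
  inp : List ℕ
  par : ℕ → ℕ

namespace Ctx

/-- The largest number that is represented. -/
abbrev lim (K : Ctx) : ℕ := K.par 0
/-- The number of rows of the arrays. -/
abbrev rows (K : Ctx) : ℕ := K.par 1
/-- The number of columns of the arrays. -/
abbrev wd (K : Ctx) : ℕ := K.par 2

/-- The data fit on a machine with arrays of `S` cells and words up to `W`. -/
structure Fits (K : Ctx) (S W : ℕ) : Prop where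
  one_le : 1 ≤ K.lim
  par_le : ∀ i, K.par i ≤ K.lim
  cells_le : K.rows * K.wd ≤ K.lim
  lim_le : K.lim ≤ S
  two_lim_le : 2 * K.lim ≤ W
  length_eq : K.par 3 = K.inp.length
  inp_le : ∀ x ∈ K.inp, x ≤ K.lim

/-- All entries are representable, and they are `0` outside of the arrays. -/
structure Bounded (K : Ctx) (M : Mem) : Prop where
  le : ∀ a r c, M a r c ≤ K.lim
  zero : ∀ a r c, ¬(r < K.rows ∧ c < K.wd) → M a r c = 0

end Ctx

/-! ### Expressions: values and machine code -/

namespace Exp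

/-- The value of an expression. A sum that is too large counts as `0`. -/
def eval (K : Ctx) (ρ : ℕ → ℕ) (M : Mem) : Exp → ℕ
  | zero => 0
  | one => 1
  | param i => K.par i
  | var j => ρ j
  | get a r c => M a (eval K ρ M r) (eval K ρ M c)
  | inp e => K.inp.getD (eval K ρ M e) 0
  | add e f => if eval K ρ M e + eval K ρ M f ≤ K.lim then eval K ρ M e + eval K ρ M f else 0
  | sub e f => eval K ρ M e - eval K ρ M f
  | ite c e f => if eval K ρ M c = 0 then eval K ρ M f else eval K ρ M e

/-- The expression uses only the first `δ` variables. -/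
def Closed (δ : ℕ) : Exp → Prop
  | zero => True
  | one => True
  | param _ => True
  | var j => j < δ
  | get _ r c => Closed δ r ∧ Closed δ c
  | inp e => Closed δ e
  | add e f => Closed δ e ∧ Closed δ f
  | sub e f => Closed δ e ∧ Closed δ f
  | ite c e f => Closed δ c ∧ Closed δ e ∧ Closed δ f

/-- Compute the address of the cell in row `k` and column `k + 1`, and run `P` if it exists,
else `Q`. -/
def guard (k : ℕ) (P Q : Prog) : Prog :=
  .seq (.instr (.sub (3 * (k + 3) + 2) 3 (3 * k + 2)))
  (.ifNZ (3 * (k + 3) + 2)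
    (.seq (.instr (.sub (3 * (k + 3) + 2) 6 (3 * (k + 1) + 2)))
    (.ifNZ (3 * (k + 3) + 2)
      (.seq (.instr (.mul (3 * k + 2) (3 * k + 2) 6))
      (.seq (.instr (.add (3 * k + 2) (3 * k + 2) (3 * (k + 1) + 2)))
      P)) Q)) Q)

/-- Compute the expression in the scratch register number `k`. The parameter `i` is in register
`3 * i`, the variable `j` in register `3 * j + 1`, and the scratch register number `k` is
`3 * k + 2`. -/
def prog : Exp → ℕ → Prog
  | zero, k => .instr (.const (3 * k + 2) 0)
  | one, k => .instr (.const (3 * k + 2) 1)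
  | param i, k => .seq (.instr (.const (3 * k + 2) 0))
      (.instr (.add (3 * k + 2) (3 * k + 2) (3 * i)))
  | var j, k => .seq (.instr (.const (3 * k + 2) 0))
      (.instr (.add (3 * k + 2) (3 * k + 2) (3 * j + 1)))
  | get a r c, k => .seq (prog r k) (.seq (prog c (k + 1))
      (guard k (.instr (.load (3 * k + 2) a (3 * k + 2))) (.instr (.const (3 * k + 2) 0))))
  | inp e, k => .seq (prog e k) (.seq (.instr (.sub (3 * (k + 1) + 2) 9 (3 * k + 2)))
      (.ifNZ (3 * (k + 1) + 2) (.instr (.read (3 * k + 2) (3 * k + 2)))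
        (.instr (.const (3 * k + 2) 0))))
  | add e f, k => .seq (prog e k) (.seq (prog f (k + 1))
      (.seq (.instr (.add (3 * k + 2) (3 * k + 2) (3 * (k + 1) + 2)))
      (.seq (.instr (.sub (3 * (k + 1) + 2) (3 * k + 2) 0))
        (.ifNZ (3 * (k + 1) + 2) (.instr (.const (3 * k + 2) 0)) .skip))))
  | sub e f, k => .seq (prog e k) (.seq (prog f (k + 1))
      (.instr (.sub (3 * k + 2) (3 * k + 2) (3 * (k + 1) + 2))))
  | ite c e f, k => .seq (prog c k) (.ifNZ (3 * k + 2) (prog e k) (prog f k))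

/-- A bound on the number of steps. -/
def cost : Exp → ℕ
  | zero => 1
  | one => 1
  | param _ => 2
  | var _ => 2
  | get _ r c => cost r + cost c + 10
  | inp e => cost e + 10
  | add e f => cost e + cost f + 10
  | sub e f => cost e + cost f + 10
  | ite c e f => cost c + cost e + cost f + 10

end Exp

/-- The machine state `s` represents the memory `M` and the values `ρ` of the first `δ`
variables. -/
structure Represents (K : Ctx) (δ : ℕ) (ρ : ℕ → ℕ) (M : Mem) (s : State) : Prop where
  par : ∀ i, s.reg (3 * i) = K.par i
  var : ∀ j < δ, s.reg (3 * j + 1) = ρ j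
  var_le : ∀ j < δ, ρ j ≤ K.lim
  mem : ∀ a r c, r < K.rows → c < K.wd → s.mem a (r * K.wd + c) = M a r c
  bounded : K.Bounded M

/-- The states differ at most in the scratch registers from number `k` on. -/
structure SameBelow (k : ℕ) (s s' : State) : Prop where
  mem : s'.mem = s.mem
  reg : ∀ r, (r % 3 ≠ 2 ∨ r < 3 * k + 2) → s'.reg r = s.reg r

lemma SameBelow.refl (k : ℕ) (s : State) : SameBelow k s s := ⟨rfl, fun _ _ => rfl⟩

lemma SameBelow.trans {k k' : ℕ} {s s' s'' : State} (h : SameBelow k s s')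
    (h' : SameBelow k' s' s'') (hk : k ≤ k') : SameBelow k s s'' :=
  ⟨h'.mem.trans h.mem, fun r hr => (h'.reg r (by omega)).trans (h.reg r hr)⟩

lemma SameBelow.put {k j v : ℕ} {s s' : State} (h : SameBelow k s s') (hj : k ≤ j) :
    SameBelow k s (s'.put (3 * j + 2) v) :=
  ⟨h.mem, fun r hr => by rw [State.put_reg_of_ne _ _ _ _ (by omega)]; exact h.reg r hr⟩

/-- Parameters and variables live in the registers congruent to 0 and 1 modulo 3, scratch values in
those congruent to 2, so scratch work cannot damage the representation. -/
lemma Represents.sameBelow {K : Ctx} {δ : ℕ} {ρ : ℕ → ℕ} {M : Mem} {s s' : State} {k : ℕ}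
    (h : Represents K δ ρ M s) (h' : SameBelow k s s') : Represents K δ ρ M s' where
  par i := by rw [h'.reg _ (by omega), h.par]
  var j hj := by rw [h'.reg _ (by omega), h.var j hj]
  var_le := h.var_le
  mem a r c hr hc := by rw [h'.mem, h.mem a r c hr hc]
  bounded := h.bounded

/-! ### Correctness of compiled expressions -/

section Compile

variable {K : Ctx} {S W : ℕ} {δ : ℕ} {ρ : ℕ → ℕ} {M : Mem}

/-- Sums beyond the limit count as `0`, and no other operation can exceed the limit; hence all
intermediate values fit in words. -/
lemma Exp.eval_le (hK : K.Fits S W) (hρ : ∀ j < δ, ρ j ≤ K.lim) (hM : K.Bounded M) (e : Exp)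
    (he : e.Closed δ) : e.eval K ρ M ≤ K.lim := by
  induction e with
  | zero => simp [eval]
  | one => exact hK.one_le
  | param i => exact hK.par_le i
  | var j => exact hρ j he
  | get a r c => exact hM.le _ _ _
  | inp e =>
    simp only [eval, List.getD_eq_getElem?_getD]
    cases h : K.inp[e.eval K ρ M]? with
    | none => simp
    | some x => exact hK.inp_le x (List.mem_of_getElem? h)
  | add e f => simp only [eval]; split_ifs <;> omega
  | sub e f ihe ihf => exact (Nat.sub_le _ _).trans (ihe he.1)
  | ite c e f ihc ihe ihf =>
    simp only [eval]
    split_ifs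
    exacts [ihf he.2.2, ihe he.2.1]

/-- The two range checks are truncated subtractions from registers `3` and `6`, which hold the
numbers of rows and columns. They use scratch register `k + 3`, since `k` and `k + 1` hold the row
and the column and an assignment keeps the value to be stored in `k + 2`. -/
lemma Exp.guard_runs (hK : K.Fits S W) {s : State} (hs : Represents K δ ρ M s) (k : ℕ)
    {P P' : Prog} {b : ℕ} {Q : State → Prop}
    (h : s.reg (3 * k + 2) < K.rows → s.reg (3 * (k + 1) + 2) < K.wd → ∀ s',
      s'.reg (3 * k + 2) = s.reg (3 * k + 2) * K.wd + s.reg (3 * (k + 1) + 2) →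
      (∀ r, r ≠ 3 * k + 2 → r ≠ 3 * (k + 3) + 2 → s'.reg r = s.reg r) →
      s'.mem = s.mem → Runs K.inp S W P s' b Q)
    (h' : ¬(s.reg (3 * k + 2) < K.rows ∧ s.reg (3 * (k + 1) + 2) < K.wd) → ∀ s',
      (∀ r, r ≠ 3 * (k + 3) + 2 → s'.reg r = s.reg r) →
      s'.mem = s.mem → Runs K.inp S W P' s' 1 Q) :
    Runs K.inp S W (guard k P P') s (b + 8) Q := by
  have hlim := hK.two_lim_le
  have hrows := hK.par_le 1
  have hwd := hK.par_le 2
  have e3 : s.reg 3 = K.rows := hs.par 1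
  have e6 : s.reg 6 = K.wd := hs.par 2
  unfold guard
  refine Runs.mono (b := 1 + ((1 + ((1 + (1 + b)) + 1 + 1)) + 1 + 1)) ?_ (by omega)
    (fun _ h => h)
  refine Runs.seq (Runs.sub (by rw [e3]; unfold Ctx.rows Ctx.lim at *; omega) ?_)
  refine Runs.ifNZ (fun h0 => ?_) (fun h0 => ?_)
  · rw [State.put_reg_self, e3] at h0
    refine Runs.seq (Runs.sub ?_ ?_)
    · rw [State.put_reg_of_ne _ _ _ _ (by omega), e6]
      unfold Ctx.wd Ctx.lim at *; omega
    refine Runs.ifNZ (fun h1 => ?_) (fun h1 => ?_)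
    · rw [State.put_reg_self, State.put_reg_of_ne _ _ _ _ (by omega),
        State.put_reg_of_ne _ _ _ _ (by omega), e6] at h1
      have hr : s.reg (3 * k + 2) < K.rows := by omega
      have hc : s.reg (3 * (k + 1) + 2) < K.wd := by omega
      have hcell : s.reg (3 * k + 2) * K.wd + s.reg (3 * (k + 1) + 2) < K.rows * K.wd := by
        calc _ < s.reg (3 * k + 2) * K.wd + K.wd := by omega
          _ = (s.reg (3 * k + 2) + 1) * K.wd := by ring
          _ ≤ _ := Nat.mul_le_mul_right _ hr
      have hcl := hK.cells_le
      have h6 : 6 ≠ 3 * (k + 3) + 2 := by omega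
      refine Runs.seq (Runs.mul ?_ (Runs.seq (Runs.add ?_ (h hr hc _ ?_ ?_ ?_))))
      · simp [h6, e6]; omega
      · simp [h6, e6]; omega
      · simp [h6, e6]
      · intro r h1 h2
        simp [h1, h2]
      · rfl
    · rw [State.put_reg_self, State.put_reg_of_ne _ _ _ _ (by omega),
        State.put_reg_of_ne _ _ _ _ (by omega), e6] at h1
      refine h' (by omega) _ ?_ rfl
      intro r h2
      simp [h2]
  · rw [State.put_reg_self, e3] at h0
    refine h' (by omega) _ ?_ rfl
    intro r h2
    simp [h2]

/-- Scratch registers act as a stack: the code for number `k` leaves everything below `k` alone, so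
a first operand survives the evaluation of the second one in `k + 1`. -/
lemma Exp.prog_runs (hK : K.Fits S W) (e : Exp) (he : e.Closed δ) (k : ℕ) (s : State)
    (hs : Represents K δ ρ M s) :
    Runs K.inp S W (e.prog k) s e.cost fun s' =>
      SameBelow k s s' ∧ s'.reg (3 * k + 2) = e.eval K ρ M := by
  have hlim := hK.two_lim_le
  induction e generalizing k s with
  | zero => exact Runs.const (Nat.zero_le _) ⟨(SameBelow.refl k s).put le_rfl, by simp [eval]⟩
  | one =>
    have := hK.one_le
    exact Runs.const (by omega) ⟨(SameBelow.refl k s).put le_rfl, by simp [eval]⟩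
  | param i =>
    have := hK.par_le i
    have hne : 3 * i ≠ 3 * k + 2 := by omega
    refine Runs.seq (Runs.const (Nat.zero_le _) (Runs.add ?_ ⟨?_, ?_⟩))
    · simp [hne, hs.par]; omega
    · exact ((SameBelow.refl k s).put le_rfl).put le_rfl
    · simp [hne, hs.par, eval]
  | var j =>
    have := hs.var_le j he
    have hne : 3 * j ≠ 3 * k + 1 := by omega
    refine Runs.seq (Runs.const (Nat.zero_le _) (Runs.add ?_ ⟨?_, ?_⟩))
    · simp [hne, hs.var j he]; omega
    · exact ((SameBelow.refl k s).put le_rfl).put le_rfl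
    · simp [hne, hs.var j he, eval]
  | get a r c ihr ihc =>
    refine Runs.mono (b := r.cost + (c.cost + (1 + 8))) ?_ (by simp only [cost]; omega)
      (fun _ h => h)
    refine Runs.seq ((ihr he.1 k s hs).mono le_rfl ?_)
    rintro s₁ ⟨h1, e1⟩
    have hs1 := hs.sameBelow h1
    refine Runs.seq ((ihc he.2 (k + 1) s₁ hs1).mono le_rfl ?_)
    rintro s₂ ⟨h2, e2⟩
    have hs2 := hs1.sameBelow h2
    -- The row in scratch register `k` has survived the computation of the column.
    rw [← h2.reg _ (by omega)] at e1
    refine Exp.guard_runs hK hs2 k ?_ ?_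
    · intro hr hc s₃ h3 h3' h3m
      have hcell : s₂.reg (3 * k + 2) * K.wd + s₂.reg (3 * (k + 1) + 2) < K.rows * K.wd := by
        calc _ < s₂.reg (3 * k + 2) * K.wd + K.wd := by omega
          _ = (s₂.reg (3 * k + 2) + 1) * K.wd := by ring
          _ ≤ _ := Nat.mul_le_mul_right _ hr
      have hcl := hK.cells_le
      have hcs := hK.lim_le
      have hval : s₃.mem a (s₃.reg (3 * k + 2)) = M a (r.eval K ρ M) (c.eval K ρ M) := by
        rw [h3, h3m, hs2.mem a _ _ hr hc, e1, e2]
      have hle := hs.bounded.le a (r.eval K ρ M) (c.eval K ρ M)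
      refine Runs.load (by omega) (by omega) ⟨⟨?_, ?_⟩, ?_⟩
      · simp [h3m, h2.mem, h1.mem]
      · intro q hq
        rw [State.put_reg_of_ne _ _ _ _ (by omega), h3' q (by omega) (by omega),
          h2.reg q (by omega), h1.reg q hq]
      · simp [hval, eval]
    · intro hrc s₃ h3 h3m
      refine Runs.const (by omega) ⟨⟨?_, ?_⟩, ?_⟩
      · simp [h3m, h2.mem, h1.mem]
      · intro q hq
        rw [State.put_reg_of_ne _ _ _ _ (by omega), h3 q (by omega),
          h2.reg q (by omega), h1.reg q hq]
      · rw [e1, e2] at hrc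
        simp [eval, hs.bounded.zero a _ _ hrc]
  | inp e ih =>
    refine Runs.mono (b := e.cost + (1 + (1 + 1 + 1))) ?_ (by simp only [cost]; omega)
      (fun _ h => h)
    refine Runs.seq ((ih he k s hs).mono le_rfl ?_)
    rintro s₁ ⟨h1, e1⟩
    have hs1 := hs.sameBelow h1
    have e9 : s₁.reg 9 = K.inp.length := (hs1.par 3).trans hK.length_eq
    have hl := hK.par_le 3
    have hl' := hK.length_eq
    have hne : 3 * k + 2 ≠ 3 * (k + 1) + 2 := by omega
    refine Runs.seq (Runs.sub (by rw [e9]; unfold Ctx.lim at *; omega) ?_)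
    refine Runs.ifNZ (fun h0 => ?_) (fun h0 => ?_)
    · rw [State.put_reg_self, e9, e1] at h0
      have hlt : e.eval K ρ M < K.inp.length := by omega
      have hx := hK.inp_le _ (List.getElem_mem hlt)
      refine Runs.read (v := K.inp[e.eval K ρ M]) ?_ (by omega) ⟨?_, ?_⟩
      · rw [State.put_reg_of_ne _ _ _ _ hne, e1, List.getElem?_eq_getElem hlt]
      · exact (h1.put (by omega)).put le_rfl
      · simp [eval, List.getElem?_eq_getElem hlt]
    · rw [State.put_reg_self, e9, e1] at h0
      refine Runs.const (by omega) ⟨(h1.put (by omega)).put le_rfl, ?_⟩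
      simp [eval, List.getElem?_eq_none (show K.inp.length ≤ e.eval K ρ M by omega)]
  | add e f ihe ihf =>
    refine Runs.mono (b := e.cost + (f.cost + (1 + (1 + (1 + 0 + 1))))) ?_
      (by simp only [cost]; omega) (fun _ h => h)
    refine Runs.seq ((ihe he.1 k s hs).mono le_rfl ?_)
    rintro s₁ ⟨h1, e1⟩
    have hs1 := hs.sameBelow h1
    refine Runs.seq ((ihf he.2 (k + 1) s₁ hs1).mono le_rfl ?_)
    rintro s₂ ⟨h2, e2⟩
    have hs2 := hs1.sameBelow h2
    rw [← h2.reg _ (by omega)] at e1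
    have he1 := Exp.eval_le hK hs.var_le hs.bounded e he.1
    have he2 := Exp.eval_le hK hs.var_le hs.bounded f he.2
    have e0 : s₂.reg 0 = K.lim := hs2.par 0
    have h12 := h1.trans h2 (by omega)
    have hne : 3 * k + 2 ≠ 3 * (k + 1) + 2 := by omega
    -- The sum is formed before it is compared with the limit; this is why words must hold `2 *
    -- K.lim`.
    refine Runs.seq (Runs.add (by omega)
      (Runs.seq (Runs.sub ?_ (Runs.ifNZ (b := 1) (b' := 0) ?_ ?_))))
    · simp; omega
    · intro h0
      rw [State.put_reg_self, State.put_reg_self, State.put_reg_of_ne _ _ _ _ (by omega), e0, e1,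
        e2] at h0
      refine Runs.const (by omega) ⟨((h12.put le_rfl).put (by omega)).put le_rfl, ?_⟩
      simp only [State.put_reg_self, eval]
      rw [if_neg (by omega)]
    · intro h0
      rw [State.put_reg_self, State.put_reg_self, State.put_reg_of_ne _ _ _ _ (by omega), e0, e1,
        e2] at h0
      refine Runs.skip ⟨(h12.put le_rfl).put (by omega), ?_⟩
      rw [State.put_reg_of_ne _ _ _ _ hne, State.put_reg_self, e1, e2]
      simp only [eval]
      rw [if_pos (by omega)]
  | sub e f ihe ihf =>
    refine Runs.mono (b := e.cost + (f.cost + 1)) ?_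
      (by simp only [cost]; omega) (fun _ h => h)
    refine Runs.seq ((ihe he.1 k s hs).mono le_rfl ?_)
    rintro s₁ ⟨h1, e1⟩
    have hs1 := hs.sameBelow h1
    refine Runs.seq ((ihf he.2 (k + 1) s₁ hs1).mono le_rfl ?_)
    rintro s₂ ⟨h2, e2⟩
    rw [← h2.reg _ (by omega)] at e1
    have he1 := Exp.eval_le hK hs.var_le hs.bounded e he.1
    refine Runs.sub (by omega) ⟨(h1.trans h2 (by omega)).put le_rfl, ?_⟩
    simp [e1, e2, eval]
  | ite c e f ihc ihe ihf =>
    refine Runs.mono (b := c.cost + (e.cost + f.cost + 1)) ?_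
      (by simp only [cost]; omega) (fun _ h => h)
    refine Runs.seq ((ihc he.1 k s hs).mono le_rfl ?_)
    rintro s₁ ⟨h1, e1⟩
    have hs1 := hs.sameBelow h1
    refine Runs.ifNZ (fun h0 => ?_) (fun h0 => ?_)
    · refine (ihe he.2.1 k s₁ hs1).mono le_rfl ?_
      rintro s₂ ⟨h2, e2⟩
      exact ⟨h1.trans h2 le_rfl, by rw [e2]; simp [eval, ← e1, h0]⟩
    · refine (ihf he.2.2 k s₁ hs1).mono le_rfl ?_
      rintro s₂ ⟨h2, e2⟩
      exact ⟨h1.trans h2 le_rfl, by rw [e2]; simp [eval, ← e1, h0]⟩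

end Compile

/-! ### Commands: effect, machine code and cost -/

namespace Cmd

/-- Change one entry, if it exists. -/
def write (K : Ctx) (M : Mem) (a r c v : ℕ) : Mem :=
  if r < K.rows ∧ c < K.wd then
    fun b i j => if b = a ∧ i = r ∧ j = c then v else M b i j
  else M

/-- The effect of a command inside of `δ` loops whose variables have the values `ρ`. -/
def run (K : Ctx) : Cmd → (δ : ℕ) → (ρ : ℕ → ℕ) → Mem → Mem
  | set a r c e, _, ρ, M => write K M a (r.eval K ρ M) (c.eval K ρ M) (e.eval K ρ M)
  | seq A B, δ, ρ, M => run K B δ ρ (run K A δ ρ M)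
  | ite e A B, δ, ρ, M => if e.eval K ρ M = 0 then run K B δ ρ M else run K A δ ρ M
  | loop p A, δ, ρ, M =>
      Nat.rec M (fun i M' => run K A (δ + 1) (Function.update ρ δ i) M') (K.par p)
  | skip, _, _, M => M

/-- The command uses only variables of enclosing loops. -/
def Closed : Cmd → ℕ → Prop
  | set _ r c e, δ => r.Closed δ ∧ c.Closed δ ∧ e.Closed δ
  | seq A B, δ => Closed A δ ∧ Closed B δ
  | ite e A B, δ => e.Closed δ ∧ Closed A δ ∧ Closed B δ
  | loop _ A, δ => Closed A (δ + 1)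
  | skip, _ => True

/-- The machine program for a command inside of `δ` loops. -/
def prog : Cmd → ℕ → Prog
  | set a r c e, _ => .seq (r.prog 0) (.seq (c.prog 1) (.seq (e.prog 2)
      (Exp.guard 0 (.instr (.store a 2 8)) .skip)))
  | seq A B, δ => .seq (prog A δ) (prog B δ)
  | ite e A B, δ => .seq (e.prog 0) (.ifNZ 2 (prog A δ) (prog B δ))
  | loop p A, δ => .seq (.instr (.const (3 * δ + 1) 0))
      (.seq (.instr (.sub 2 (3 * p) (3 * δ + 1)))
      (.whileNZ 2 (.seq (prog A (δ + 1)) (.seq (.instr (.const 2 1))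
        (.seq (.instr (.add (3 * δ + 1) (3 * δ + 1) 2))
          (.instr (.sub 2 (3 * p) (3 * δ + 1))))))))
  | skip, _ => .skip

/-- A bound on the number of steps. -/
def cost (K : Ctx) : Cmd → ℕ
  | set _ r c e => r.cost + c.cost + e.cost + 10
  | seq A B => cost K A + cost K B
  | ite e A B => e.cost + cost K A + cost K B + 1
  | loop p A => K.par p * (cost K A + 4) + 3
  | skip => 0

variable {K : Ctx} {S W : ℕ}

lemma write_bounded {M : Mem} (hM : K.Bounded M) {a r c v : ℕ} (hv : v ≤ K.lim) :
    K.Bounded (write K M a r c v) := by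
  unfold write
  split_ifs with h
  · refine ⟨fun a' r' c' => ?_, fun a' r' c' h' => ?_⟩
    · split_ifs
      exacts [hv, hM.le _ _ _]
    · rw [if_neg, hM.zero _ _ _ h']
      rintro ⟨-, rfl, rfl⟩
      exact h' h
  · exact hM

/-- A compiled command has the effect that `Cmd.run` describes, within the number of steps that
`Cmd.cost` gives. -/
theorem prog_runs (hK : K.Fits S W) (A : Cmd) (δ : ℕ) (hA : A.Closed δ) (ρ : ℕ → ℕ) (M : Mem)
    (s : State) (hs : Represents K δ ρ M s) :
    Runs K.inp S W (A.prog δ) s (A.cost K) fun s' => Represents K δ ρ (A.run K δ ρ M) s' := by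
  have hlim := hK.two_lim_le
  induction A generalizing δ ρ M s with
  | set a r c e =>
    refine Runs.mono (b := r.cost + (c.cost + (e.cost + (1 + 8)))) ?_ (by simp only [cost]; omega)
      (fun _ h => h)
    refine Runs.seq ((Exp.prog_runs hK r hA.1 0 s hs).mono le_rfl ?_)
    rintro s₁ ⟨h1, e1⟩
    have hs1 := hs.sameBelow h1
    refine Runs.seq ((Exp.prog_runs hK c hA.2.1 1 s₁ hs1).mono le_rfl ?_)
    rintro s₂ ⟨h2, e2⟩
    have hs2 := hs1.sameBelow h2
    refine Runs.seq ((Exp.prog_runs hK e hA.2.2 2 s₂ hs2).mono le_rfl ?_)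
    rintro s₃ ⟨h3, e3⟩
    have hs3 := hs2.sameBelow h3
    have e1' : s₃.reg (3 * 0 + 2) = r.eval K ρ M := by
      rw [h3.reg _ (by omega), h2.reg _ (by omega), e1]
    have e2' : s₃.reg (3 * (0 + 1) + 2) = c.eval K ρ M := by
      rw [h3.reg _ (by omega), e2]
    have hv := Exp.eval_le hK hs.var_le hs.bounded e hA.2.2
    refine Exp.guard_runs hK hs3 0 ?_ ?_
    · intro hr hc s₄ h4 h4' h4m
      have hcell : s₃.reg (3 * 0 + 2) * K.wd + s₃.reg (3 * (0 + 1) + 2) < K.rows * K.wd := by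
        calc _ < s₃.reg (3 * 0 + 2) * K.wd + K.wd := by omega
          _ = (s₃.reg (3 * 0 + 2) + 1) * K.wd := by ring
          _ ≤ _ := Nat.mul_le_mul_right _ hr
      have hcl := hK.cells_le
      have hcs := hK.lim_le
      rw [show 3 * 0 + 2 = 2 from rfl] at h4
      refine Runs.store (by rw [h4]; exact hcell.trans_le (hcl.trans hcs)) ?_
      rw [e1'] at hr
      rw [e2'] at hc
      have e8 : s₄.reg 8 = e.eval K ρ M := by
        rw [h4' 8 (by omega) (by omega)]; exact e3
      have e2m : s₄.reg 2 = r.eval K ρ M * K.wd + c.eval K ρ M := by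
        rw [h4, ← e1', ← e2']
      refine ⟨fun i => ?_, fun j hj => ?_, hs.var_le, fun a' r' c' hr' hc' => ?_,
        write_bounded hs.bounded hv⟩
      · simp only [State.setMem]
        rw [h4' _ (by omega) (by omega), hs3.par]
      · simp only [State.setMem]
        rw [h4' _ (by omega) (by omega), hs3.var j hj]
      · simp only [State.setMem, run, write, hr, hc, and_self, if_true]
        rw [e8, e2m]
        by_cases ha : a' = a
        · subst ha
          rw [Function.update_self, Function.update_apply]
          -- Different entries have different addresses, because columns are smaller than the width.
          have : (r' * K.wd + c' = r.eval K ρ M * K.wd + c.eval K ρ M) ↔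
              (r' = r.eval K ρ M ∧ c' = c.eval K ρ M) := by
            constructor
            · intro h
              have h1 : r' = r.eval K ρ M := by
                have := congrArg (· / K.wd) h
                simp only [Nat.add_div_of_dvd_right (Dvd.intro_left _ rfl),
                  Nat.mul_div_cancel _ (show 0 < K.wd by omega), Nat.div_eq_of_lt hc',
                  Nat.div_eq_of_lt hc] at this
                simpa using this
              refine ⟨h1, ?_⟩
              rw [h1] at h
              omega
            · rintro ⟨rfl, rfl⟩; rfl
          simp only [this, true_and]
          rw [h4m, hs3.mem _ _ _ hr' hc']
        · rw [Function.update_of_ne ha, h4m, hs3.mem _ _ _ hr' hc']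
          simp [ha]
    · intro hrc s₄ h4 h4m
      refine (Runs.skip ?_).mono (by omega) (fun _ h => h)
      rw [e1', e2'] at hrc
      simp only [run, write, hrc, if_false]
      refine ⟨fun i => ?_, fun j hj => ?_, hs.var_le, fun a' r' c' hr' hc' => ?_, hs.bounded⟩
      · rw [h4 _ (by omega), hs3.par]
      · rw [h4 _ (by omega), hs3.var j hj]
      · rw [h4m, hs3.mem _ _ _ hr' hc']
  | seq A B ihA ihB =>
    refine Runs.seq ((ihA δ hA.1 ρ M s hs).mono le_rfl ?_)
    intro s₁ h1
    exact ihB δ hA.2 ρ _ s₁ h1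
  | ite e A B ihA ihB =>
    refine Runs.mono (b := e.cost + (cost K A + cost K B + 1)) ?_ (by simp only [cost]; omega)
      (fun _ h => h)
    refine Runs.seq ((Exp.prog_runs hK e hA.1 0 s hs).mono le_rfl ?_)
    rintro s₁ ⟨h1, e1⟩
    have hs1 := hs.sameBelow h1
    simp only [Nat.mul_zero, Nat.zero_add] at e1
    refine Runs.ifNZ (fun h0 => ?_) (fun h0 => ?_)
    · have := ihA δ hA.2.1 ρ M s₁ hs1
      simpa only [run, ← e1, h0, if_false] using this
    · have := ihB δ hA.2.2 ρ M s₁ hs1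
      simpa only [run, ← e1, h0, if_true] using this
  | loop p A ih =>
    have hp := hK.par_le p
    have h1l := hK.one_le
    refine Runs.mono (b := 1 + (1 + (K.par p * ((cost K A + (1 + (1 + 1))) + 1) + 1))) ?_
      (by simp only [cost]; rw [show cost K A + (1 + (1 + 1)) + 1 = cost K A + 4 by ring]; omega)
      (fun _ h => h)
    refine Runs.seq (Runs.const (Nat.zero_le _) (Runs.seq (Runs.sub ?_ ?_)))
    · rw [State.put_reg_of_ne _ _ _ _ (by omega), hs.par]; omega
    let F : ℕ → Mem := fun i =>
      Nat.rec M (fun i M' => run K A (δ + 1) (Function.update ρ δ i) M') i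
    -- The loop variable counts upwards while `j` counts the rounds left. Register `2` is scratch
    -- for the body, so the difference is recomputed after every round.
    let I : ℕ → State → Prop := fun j s' => s'.reg 2 = j ∧ j ≤ K.par p ∧
      s'.reg (3 * δ + 1) = K.par p - j ∧ Represents K δ ρ (F (K.par p - j)) s'
    have hrep : ∀ (s' : State) (x v : ℕ) (M' : Mem), Represents K δ ρ M' s' →
        (x = 2 ∨ x = 3 * δ + 1) → Represents K δ ρ M' (s'.put x v) := by
      intro s' x v M' h hx
      refine ⟨fun i => ?_, fun j hj => ?_, h.var_le, h.mem, h.bounded⟩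
      · rw [State.put_reg_of_ne _ _ _ _ (by omega), h.par]
      · rw [State.put_reg_of_ne _ _ _ _ (by omega), h.var j hj]
    refine (Runs.whileNZ I ?_ ?_ (K.par p) ?_).mono le_rfl ?_
    · rintro j s' ⟨h1, -⟩
      rw [h1]
    · rintro j s' ⟨h1, h2, h3, h4⟩
      have hr' : Represents K (δ + 1) (Function.update ρ δ (K.par p - (j + 1)))
          (F (K.par p - (j + 1))) s' := by
        refine ⟨h4.par, fun i hi => ?_, fun i hi => ?_, h4.mem, h4.bounded⟩
        · by_cases h : i = δ
          · subst h; simp [h3]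
          · rw [Function.update_of_ne h, h4.var i (by omega)]
        · by_cases h : i = δ
          · subst h; simp; omega
          · rw [Function.update_of_ne h]; exact h4.var_le i (by omega)
      refine Runs.seq ((ih (δ + 1) hA _ _ s' hr').mono le_rfl ?_)
      intro s₁ hs1
      have hv := hs1.var δ (by omega)
      rw [Function.update_self] at hv
      have hF : F (K.par p - j) = run K A (δ + 1) (Function.update ρ δ (K.par p - (j + 1)))
          (F (K.par p - (j + 1))) := by
        rw [show K.par p - j = (K.par p - (j + 1)) + 1 by omega]
      have hs1' : Represents K δ ρ (F (K.par p - j)) s₁ := by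
        rw [hF]
        refine ⟨hs1.par, fun i hi => ?_, hs.var_le, hs1.mem, hs1.bounded⟩
        rw [hs1.var i (by omega), Function.update_of_ne (by omega)]
      have hne : 3 * δ + 1 ≠ 2 := by omega
      have hne' : 3 * p ≠ 2 := by omega
      have hne'' : 3 * p ≠ 3 * δ + 1 := by omega
      refine Runs.seq (Runs.const (by omega) (Runs.seq (Runs.add ?_ (Runs.sub ?_ ?_))))
      · rw [State.put_reg_self, State.put_reg_of_ne _ _ _ _ hne, hv]; omega
      · rw [State.put_reg_of_ne _ _ _ _ hne'', State.put_reg_of_ne _ _ _ _ hne', hs1.par]; omega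
      · refine ⟨?_, by omega, ?_, ?_⟩
        · rw [State.put_reg_self, State.put_reg_self, State.put_reg_of_ne _ _ _ _ hne'',
            State.put_reg_of_ne _ _ _ _ hne', State.put_reg_self, hs1.par,
            State.put_reg_of_ne _ _ _ _ hne, hv]
          omega
        · rw [State.put_reg_of_ne _ _ _ _ hne, State.put_reg_self, State.put_reg_self,
            State.put_reg_of_ne _ _ _ _ hne, hv]
          omega
        · exact hrep _ _ _ _ (hrep _ _ _ _ (hrep _ _ _ _ hs1' (.inl rfl)) (.inr rfl)) (.inl rfl)
    · refine ⟨?_, le_rfl, ?_, ?_⟩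
      · simp [show 3 * p ≠ 3 * δ + 1 by omega, hs.par]
      · simp [show 3 * δ + 1 ≠ 2 by omega]
      · simp only [Nat.sub_self]
        exact hrep _ _ _ _ (hrep _ _ _ _ hs (.inr rfl)) (.inl rfl)
    · rintro s' ⟨-, -, -, h⟩
      exact h
  | skip => exact Runs.skip hs

end Cmd

end RAM

/-! ### Treedepth of induced subgraphs -/

namespace SimpleGraph

variable {V : Type*}

/-- The subgraph of `G` induced by `U` has treedepth at most `k`. -/
inductive TdLe [DecidableEq V] (G : SimpleGraph V) : ℕ → Finset V → Prop
  | empty {k : ℕ} : TdLe G k ∅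
  | erase {k : ℕ} {U : Finset V} (r : V) (h : TdLe G k (U.erase r)) : TdLe G (k + 1) U
  | union {k : ℕ} {A B : Finset V} (hA : TdLe G k A) (hB : TdLe G k B) (hd : Disjoint A B)
      (hAB : ∀ a ∈ A, ∀ b ∈ B, ¬G.Adj a b) : TdLe G k (A ∪ B)

/-- The edges of `G` with both ends in `U`. -/
def within (G : SimpleGraph V) (U : Finset V) : SimpleGraph V where
  Adj a b := a ∈ U ∧ b ∈ U ∧ G.Adj a b
  symm := ⟨fun _ _ h => ⟨h.2.1, h.1, h.2.2.symm⟩⟩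
  loopless := ⟨fun _ h => h.2.2.ne rfl⟩

variable {G : SimpleGraph V}

lemma within_mono {U U' : Finset V} (h : U ⊆ U') : G.within U ≤ G.within U' :=
  fun _ _ hab => ⟨h hab.1, h hab.2.1, hab.2.2⟩

lemma Reachable.mem_of_within {U : Finset V} {a b : V} (h : (G.within U).Reachable a b)
    (ha : a ∈ U) : b ∈ U := by
  obtain ⟨p⟩ := h
  induction p with
  | nil => exact ha
  | cons h' _ ih => exact ih h'.2.1

namespace TdLe

variable [DecidableEq V]

lemma mono {k : ℕ} {U H : Finset V} (h : G.TdLe k U) (hH : H ⊆ U) : G.TdLe k H := by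
  induction h generalizing H with
  | empty => rw [Finset.subset_empty.1 hH]; exact .empty
  | erase r _ ih => exact .erase r (ih (Finset.erase_subset_erase r hH))
  | @union k A B _ _ hd hAB ihA ihB =>
    have : H = (H ∩ A) ∪ (H ∩ B) := by
      rw [← Finset.inter_union_distrib_left, Finset.inter_eq_left.2 hH]
    rw [this]
    exact .union (ihA Finset.inter_subset_right) (ihB Finset.inter_subset_right)
      (hd.mono Finset.inter_subset_right Finset.inter_subset_right)
      (fun a ha b hb => hAB a (Finset.mem_inter.1 ha).2 b (Finset.mem_inter.1 hb).2)

lemma succ {k : ℕ} {U : Finset V} (h : G.TdLe k U) : G.TdLe (k + 1) U := by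
  rcases U.eq_empty_or_nonempty with rfl | ⟨r, _⟩
  · exact .empty
  · exact .erase r (h.mono (Finset.erase_subset r U))

lemma not_zero_of_nonempty {U : Finset V} (hU : U.Nonempty) : ¬G.TdLe 0 U := by
  intro h
  have : ∀ k (U : Finset V), G.TdLe k U → k = 0 → U = ∅ := by
    intro k U h
    induction h with
    | empty => exact fun _ => rfl
    | erase => intro h; omega
    | union _ _ _ _ ihA ihB => intro h; rw [ihA h, ihB h]; rfl
  exact hU.ne_empty (this 0 U h rfl)

/-- No edge joins vertices with different labels, so the classes can be split off one at a time by
the binary `union`. -/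
lemma of_classes {X : Type*} [DecidableEq X] {k : ℕ} (U : Finset V) (g : V → X)
    (hg : ∀ u ∈ U, ∀ v ∈ U, G.Adj u v → g u = g v)
    (h : ∀ x, G.TdLe k (U.filter fun u => g u = x)) : G.TdLe k U := by
  have key : ∀ T : Finset X, G.TdLe k (U.filter fun u => g u ∈ T) := by
    intro T
    induction T using Finset.induction with
    | empty => simpa using TdLe.empty
    | insert x T hx ih =>
      have : (U.filter fun u => g u ∈ insert x T) =
          (U.filter fun u => g u = x) ∪ (U.filter fun u => g u ∈ T) := by
        ext u; simp; tauto
      rw [this]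
      refine .union (h x) ih ?_ ?_
      · rw [Finset.disjoint_filter]
        rintro u - rfl
        exact hx
      · intro a ha b hb hab
        rw [Finset.mem_filter] at ha hb
        have := hg a ha.1 b hb.1 hab
        rw [ha.2] at this
        exact hx (this ▸ hb.2)
  have := key (U.image g)
  rwa [Finset.filter_true_of_mem] at this
  exact fun u hu => Finset.mem_image_of_mem g hu

/-- A connected graph of treedepth at most `k + 1` has a vertex whose removal leaves a graph of
treedepth at most `k`. -/
lemma exists_erase {k : ℕ} {U H : Finset V} (h : G.TdLe (k + 1) U) (hH : H ⊆ U) {c : V}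
    (hc : c ∈ H) (hconn : ∀ v ∈ H, (G.within H).Reachable v c) : ∃ r, G.TdLe k (H.erase r) := by
  generalize hk : k + 1 = k' at h
  induction h with
  | empty => exact absurd (hH hc) (by simp)
  | erase r h =>
    obtain rfl : k = _ := Nat.succ.inj hk
    exact ⟨r, h.mono (Finset.erase_subset_erase r hH)⟩
  | @union k A B _ _ hd hAB ihA ihB =>
    -- A connected set that meets `A` lies in `A`, since a path leaving `A` would use an edge
    -- between `A` and `B`.
    have key : ∀ A B : Finset V, H ⊆ A ∪ B → (∀ a ∈ A, ∀ b ∈ B, ¬G.Adj a b) → c ∈ A → H ⊆ A := by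
      intro A B hH hAB hcA v hv
      obtain ⟨p⟩ := hconn v hv
      clear hconn hc ihA ihB
      induction p with
      | nil => exact hcA
      | @cons u w _ h' _ ih =>
        have hw := ih hcA h'.2.1
        rcases Finset.mem_union.1 (hH hv) with h1 | h1
        · exact h1
        · exact absurd h'.2.2.symm (hAB w hw u h1)
    rcases Finset.mem_union.1 (hH hc) with h1 | h1
    · exact ihA (key A B hH hAB h1) hk
    · refine ihB (key B A (by rwa [Finset.union_comm]) ?_ h1) hk
      exact fun a ha b hb hab => hAB b hb a ha hab.symm

/-- Paths have fewer than `2 ^ k` vertices. -/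
lemma length_lt {k : ℕ} {U : Finset V} (h : G.TdLe k U) (l : List V) (hl : l.IsChain G.Adj)
    (hd : l.Nodup) (hU : ∀ v ∈ l, v ∈ U) : l.length < 2 ^ k := by
  induction h generalizing l with
  | empty =>
    rw [List.eq_nil_iff_forall_not_mem.2 fun v hv => absurd (hU v hv) (by simp)]
    simp
  | @erase k U r h ih =>
    by_cases hr : r ∈ l
    · obtain ⟨l₁, l₂, rfl⟩ := List.append_of_mem hr
      have hd' := List.nodup_middle.1 hd
      rw [List.nodup_cons, List.mem_append, not_or] at hd'
      have h1 := ih l₁ hl.left_of_append (List.nodup_append.1 hd).1 (fun v hv =>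
        Finset.mem_erase.2 ⟨fun h => hd'.1.1 (h ▸ hv), hU v (by simp [hv])⟩)
      have h2 := ih l₂ hl.right_of_append.tail (List.nodup_append.1 hd'.2).2.1 (fun v hv =>
        Finset.mem_erase.2 ⟨fun h => hd'.1.2 (h ▸ hv), hU v (by simp [hv])⟩)
      rw [List.length_append, List.length_cons, pow_succ]
      omega
    · have := ih l hl hd (fun v hv => Finset.mem_erase.2 ⟨fun h => hr (h ▸ hv), hU v hv⟩)
      rw [pow_succ]
      omega
  | @union k A B _ _ _ hAB ihA ihB =>
    have key : ∀ (A B : Finset V), (∀ a ∈ A, ∀ b ∈ B, ¬G.Adj a b) → ∀ (l : List V) (v : V),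
        (v :: l).IsChain G.Adj → (∀ w ∈ v :: l, w ∈ A ∪ B) → v ∈ A → ∀ w ∈ v :: l, w ∈ A := by
      intro A B hAB l
      induction l with
      | nil => intro v _ _ hv w hw; rw [List.mem_singleton.1 hw]; exact hv
      | cons x l ih =>
        intro v hc hU hv w hw
        rw [List.isChain_cons_cons] at hc
        have hx : x ∈ A := by
          rcases Finset.mem_union.1 (hU x (by simp)) with h | h
          · exact h
          · exact absurd hc.1 (hAB v hv x h)
        rcases List.mem_cons.1 hw with rfl | hw
        · exact hv
        · exact ih x hc.2 (fun w hw => hU w (List.mem_cons_of_mem _ hw)) hx w hw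
    cases l with
    | nil => simp
    | cons v l =>
      rcases Finset.mem_union.1 (hU v (by simp)) with h | h
      · exact ihA _ hl hd (key A B hAB l v hl hU h)
      · refine ihB _ hl hd (key B A ?_ l v hl (by rwa [Finset.union_comm]) h)
        exact fun a ha b hb hab => hAB b hb a ha hab.symm

open Classical in
/-- The number of ordered adjacent pairs is at most `2 * k` times the number of vertices. -/
lemma card_adj_le {k : ℕ} {U : Finset V} (h : G.TdLe k U) :
    ((U ×ˢ U).filter fun p => G.Adj p.1 p.2).card ≤ 2 * k * U.card := by
  induction h with
  | empty => simp
  | @erase k U r h ih =>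
    -- Deleting `r` loses at most `U.card` pairs with `r` in first place and as many with `r` in
    -- second place, which accounts for the factor `2`.
    have hsub : ((U ×ˢ U).filter fun p => G.Adj p.1 p.2) ⊆
        ((U.erase r ×ˢ U.erase r).filter fun p => G.Adj p.1 p.2) ∪ ({r} ×ˢ U ∪ U ×ˢ {r}) := by
      rintro ⟨a, b⟩ hab
      simp only [Finset.mem_filter, Finset.mem_product, Finset.mem_union, Finset.mem_erase,
        Finset.mem_singleton] at hab ⊢
      tauto
    have h1 := Finset.card_le_card hsub
    have h2 := Finset.card_union_le
      ((U.erase r ×ˢ U.erase r).filter fun p => G.Adj p.1 p.2) ({r} ×ˢ U ∪ U ×ˢ {r})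
    have h3 := Finset.card_union_le ({r} ×ˢ U) (U ×ˢ {r})
    simp only [Finset.card_product, Finset.card_singleton, one_mul, mul_one] at h3
    have h4 : 2 * k * (U.erase r).card ≤ 2 * k * U.card :=
      Nat.mul_le_mul_left _ (Finset.card_le_card (Finset.erase_subset r U))
    calc _ ≤ 2 * k * U.card + (U.card + U.card) := by omega
      _ = _ := by ring
  | @union k A B _ _ hd hAB ihA ihB =>
    have hsub : (((A ∪ B) ×ˢ (A ∪ B)).filter fun p => G.Adj p.1 p.2) ⊆
        ((A ×ˢ A).filter fun p => G.Adj p.1 p.2) ∪ ((B ×ˢ B).filter fun p => G.Adj p.1 p.2) := by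
      rintro ⟨a, b⟩ hab
      simp only [Finset.mem_filter, Finset.mem_product, Finset.mem_union] at hab ⊢
      have h1 := hAB a
      have h2 := hAB b
      have h3 := hab.2.symm
      grind
    have h1 := (Finset.card_le_card hsub).trans (Finset.card_union_le _ _)
    rw [Finset.card_union_of_disjoint hd, mul_add]
    omega

lemma map {W : Type*} [DecidableEq W] (f : V ↪ W) {k : ℕ} {U : Finset V} (h : G.TdLe k U) :
    (G.map f).TdLe k (U.map f) := by
  induction h with
  | empty => exact .empty
  | erase r _ ih => exact .erase (f r) (by rwa [Finset.map_erase] at ih)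
  | union _ _ hd hAB ihA ihB =>
    rw [Finset.map_union]
    refine .union ihA ihB ((Finset.disjoint_map f).2 hd) ?_
    intro a ha b hb hab
    obtain ⟨a, ha', rfl⟩ := Finset.mem_map.1 ha
    obtain ⟨b, hb', rfl⟩ := Finset.mem_map.1 hb
    exact hAB a ha' b hb' (SimpleGraph.map_adj_apply.1 hab)

end TdLe

end SimpleGraph

/-! ### Treedepth decompositions and the treedepth of induced subgraphs -/

namespace RootedForest

variable {α : Type*} (F : RootedForest α)

lemma not_isAncestor_self (v : α) : ¬F.IsAncestor v v := by
  have h : WellFounded F.IsAncestor := WellFounded.transGen F.wf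
  exact (h.irrefl).irrefl v

lemma depth_of_parent [Finite α] {p v : α} (h : F.parent v = some p) :
    F.depth v = F.depth p + 1 := by
  have hset : {u | u = v ∨ F.IsAncestor u v} = insert v {u | u = p ∨ F.IsAncestor u p} := by
    ext u
    simp only [Set.mem_ofPred_eq, Set.mem_insert_iff]
    refine or_congr_right ⟨fun hu => ?_, fun hu => ?_⟩
    · rcases (Relation.transGen_iff F.IsParent u v).1 hu with h' | ⟨w, hw, hwv⟩
      · exact .inl (Option.some_injective _ (h'.symm.trans h))
      · obtain rfl : w = p := Option.some_injective _ (Eq.trans (Eq.symm hwv) h)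
        exact .inr hw
    · rcases hu with rfl | hu
      · exact .single h
      · exact .tail hu h
  unfold depth
  rw [hset, Set.ncard_insert_of_notMem _ (Set.toFinite _)]
  rintro (rfl | h')
  · exact F.not_isAncestor_self v (.single h)
  · exact F.not_isAncestor_self v (.tail h' h)

lemma depth_pos [Finite α] (v : α) : 0 < F.depth v :=
  (Set.ncard_pos (Set.toFinite _)).2 ⟨v, .inl rfl⟩

/-- Climb from a node `j` times. -/
def climb (j : ℕ) (x : Option α) : Option α := (fun y => y.bind F.parent)^[j] x

/-- Being an ancestor becomes a number of climbing steps, namely the difference of the depths. This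
makes the ancestor at a given depth a function of the vertex. -/
lemma IsAncestor.exists_climb [Finite α] {F : RootedForest α} {u v : α} (h : F.IsAncestor u v) :
    ∃ j, F.climb j (some v) = some u ∧ F.depth v = F.depth u + j := by
  induction h with
  | @single b hb => exact ⟨1, hb, F.depth_of_parent hb⟩
  | @tail b c _ hc ih =>
    obtain ⟨j, h1, h2⟩ := ih
    refine ⟨j + 1, ?_, ?_⟩
    · rw [climb, Function.iterate_succ_apply]
      change F.climb j (F.parent c) = some u
      rw [show F.parent c = some b from hc, h1]
    · rw [F.depth_of_parent hc, h2]; ring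

/-- Induction from the deepest layer of the forest upwards, over the sets of vertices of depth
between `t - k + 1` and `t`. Adding one layer, the vertices are classified by their ancestor at the
new top depth; an edge stays in one class, and a class contains at most one vertex of the top layer,
which is erased. -/
lemma tdLe_of_depth [Finite α] {V : Type*} [DecidableEq V] {G : SimpleGraph V} {ψ : V → α}
    (h : IsTreedepthDecomposition G F ψ) {t : ℕ} (k : ℕ) (hk : k ≤ t) (U : Finset V)
    (hU : ∀ u ∈ U, t - k < F.depth (ψ u) ∧ F.depth (ψ u) ≤ t) : G.TdLe k U := by
  classical
  induction k generalizing U with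
  | zero =>
    have : U = ∅ := Finset.eq_empty_of_forall_notMem fun u hu => by have := hU u hu; omega
    rw [this]
    exact .empty
  | succ k ih =>
    -- Climbing from the lower of two comparable vertices passes through the upper one, so both
    -- reach the same ancestor at depth `t - k`.
    have hstep : ∀ u v, t - k ≤ F.depth (ψ u) → F.IsAncestor (ψ u) (ψ v) →
        F.climb (F.depth (ψ u) - (t - k)) (some (ψ u)) =
          F.climb (F.depth (ψ v) - (t - k)) (some (ψ v)) := by
      intro u v hu ha
      obtain ⟨j, h1, h2⟩ := ha.exists_climb
      rw [← h1, h2, show F.depth (ψ u) + j - (t - k) = F.depth (ψ u) - (t - k) + j by omega]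
      unfold climb
      rw [← Function.iterate_add_apply]
    refine SimpleGraph.TdLe.of_classes U
      (fun u => F.climb (F.depth (ψ u) - (t - k)) (some (ψ u))) ?_ ?_
    · intro u hu v hv huv
      have h1 := hU u hu
      have h2 := hU v hv
      rcases h.2 u v huv with ha | ha
      · exact hstep u v (by omega) ha
      · exact (hstep v u (by omega) ha).symm
    · intro x
      by_cases hr : ∃ r ∈ U, F.climb (F.depth (ψ r) - (t - k)) (some (ψ r)) = x ∧
          F.depth (ψ r) = t - k
      · obtain ⟨r, hr, hrx, hrd⟩ := hr
        refine .erase r (ih (by omega) _ fun u hu => ?_)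
        simp only [Finset.mem_erase, Finset.mem_filter] at hu
        have h1 := hU u hu.2.1
        refine ⟨?_, h1.2⟩
        by_contra hlt
        have hd : F.depth (ψ u) = t - k := by omega
        have h2 := hu.2.2
        rw [← hrx, hd, hrd, Nat.sub_self] at h2
        -- Two vertices of a class at depth `t - k` have the same image, and `ψ` is injective.
        exact hu.1 (h.1 (Option.some_injective _ h2))
      · refine (ih (by omega) _ fun u hu => ?_).succ
        simp only [Finset.mem_filter] at hu
        have h1 := hU u hu.1
        refine ⟨?_, h1.2⟩
        by_contra hlt
        exact hr ⟨u, hu.1, hu.2, by omega⟩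

end RootedForest

/-- The forest in which every node `i > 0` has the parent `i - 1`. -/
def pathForest (n : ℕ) : RootedForest (Fin n) where
  parent v := if h : (v : ℕ) = 0 then none else some ⟨v - 1, by omega⟩
  wf := by
    refine Subrelation.wf (r := fun p v : Fin n => p < v) ?_ wellFounded_lt
    intro p v h
    split_ifs at h with h0
    rw [Option.some.injEq] at h
    rw [← h, Fin.lt_def]
    simp only
    omega

lemma pathForest_isAncestor {n : ℕ} (d : ℕ) (u v : Fin n) (h : (v : ℕ) = u + d + 1) :
    (pathForest n).IsAncestor u v := by
  induction d generalizing v with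
  | zero =>
    refine .single ?_
    simp only [RootedForest.IsParent, pathForest]
    rw [dif_neg (by omega), Option.some.injEq]
    ext; simp only; omega
  | succ d ih =>
    refine .tail (ih ⟨v - 1, by omega⟩ (by simp only; omega)) ?_
    simp only [RootedForest.IsParent, pathForest]
    rw [dif_neg (by omega)]

lemma exists_decomposition_of_treedepth_le {n t : ℕ} {G : SimpleGraph (Fin n)}
    (h : treedepth G ≤ t) : ∃ (m : ℕ) (F : RootedForest (Fin m)) (ψ : Fin n → Fin m),
      IsTreedepthDecomposition G F ψ ∧ F.height ≤ t := by
  -- The infimum of the empty set would be `0`; the path forest shows that decompositions exist, so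
  -- the infimum is attained.
  have hne : {h | ∃ (m : ℕ) (F : RootedForest (Fin m)) (ψ : Fin n → Fin m),
      IsTreedepthDecomposition G F ψ ∧ F.height = h}.Nonempty := by
    refine ⟨_, n, pathForest n, id, ⟨Function.injective_id, fun u v huv => ?_⟩, rfl⟩
    rcases lt_or_gt_of_ne huv.ne with h | h
    · exact .inl (pathForest_isAncestor (v - u - 1) u v (by rw [Fin.lt_def] at h; omega))
    · exact .inr (pathForest_isAncestor (u - v - 1) v u (by
        have h : (v : ℕ) < u := h
        omega))
  obtain ⟨m, F, ψ, h1, h2⟩ := Nat.sInf_mem hne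
  exact ⟨m, F, ψ, h1, h2.trans_le h⟩

/-- The search works with natural numbers as vertices, so the graph is transported along the
embedding of `Fin n` into `ℕ`. -/
lemma tdLe_of_treedepth_le {n t : ℕ} {G : SimpleGraph (Fin n)} (h : treedepth G ≤ t) :
    (G.map Fin.valEmbedding).TdLe t (Finset.range n) := by
  obtain ⟨m, F, ψ, h1, h2⟩ := exists_decomposition_of_treedepth_le h
  have := (F.tdLe_of_depth h1 t le_rfl Finset.univ fun u _ => ⟨by
    have := F.depth_pos (ψ u); omega,
    (Finset.le_sup (f := F.depth) (Finset.mem_univ (ψ u))).trans h2⟩).map Fin.valEmbedding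
  have hr : (Finset.univ : Finset (Fin n)).map Fin.valEmbedding = Finset.range n := by
    ext i
    simp only [Finset.mem_map, Finset.mem_univ, true_and, Fin.valEmbedding_apply,
      Finset.mem_range]
    exact ⟨by rintro ⟨a, rfl⟩; exact a.2, fun hi => ⟨⟨i, hi⟩, rfl⟩⟩
  rwa [hr] at this

/-! ### Decompositions given by arrays of parents -/

/-- The number of vertices on the path from `v` to its root is at most `k`. An entry `0` of `par`
marks a root, and an entry `p + 1` says that `p` is the parent. -/
def DepthLe (par : ℕ → ℕ) : ℕ → ℕ → Prop
  | 0, _ => False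
  | k + 1, v => par v = 0 ∨ ∃ p, par v = p + 1 ∧ DepthLe par k p

/-- `u` is a proper ancestor of `v`. -/
def Above (par : ℕ → ℕ) : ℕ → ℕ → Prop := Relation.TransGen fun p v => par v = p + 1

/-- The array `par` holds a treedepth decomposition of height at most `k` of the subgraph of `G`
that is induced by `U`. -/
structure IsDecomp (G : SimpleGraph ℕ) (par : ℕ → ℕ) (k : ℕ) (U : Finset ℕ) : Prop where
  parent_mem : ∀ v ∈ U, ∀ p, par v = p + 1 → p ∈ U
  depth_le : ∀ v ∈ U, DepthLe par k v
  above : ∀ u ∈ U, ∀ v ∈ U, G.Adj u v → Above par u v ∨ Above par v u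

/-- Parents of vertices of `U` stay in `U`, so all chains of ancestors are determined by the entries
on `U`. -/
lemma IsDecomp.congr {G : SimpleGraph ℕ} {par par' : ℕ → ℕ} {k : ℕ} {U : Finset ℕ}
    (h : IsDecomp G par k U) (he : ∀ v ∈ U, par' v = par v) : IsDecomp G par' k U := by
  have habove : ∀ u v, Above par u v → v ∈ U → Above par' u v := by
    intro u v ha
    induction ha with
    | single hb => exact fun hU => .single ((he _ hU).trans hb)
    | tail _ hc ih => exact fun hU => .tail (ih (h.parent_mem _ hU _ hc)) ((he _ hU).trans hc)
  have hdepth : ∀ k v, DepthLe par k v → v ∈ U → DepthLe par' k v := by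
    intro k
    induction k with
    | zero => exact fun _ h _ => h
    | succ k ih =>
      rintro v (h0 | ⟨p, hp, hd⟩) hU
      · exact .inl ((he v hU).trans h0)
      · exact .inr ⟨p, (he v hU).trans hp, ih p hd (h.parent_mem v hU p hp)⟩
  exact ⟨fun v hv p hp => h.parent_mem v hv p ((he v hv).symm.trans hp),
    fun v hv => hdepth k v (h.depth_le v hv) hv,
    fun u hu v hv huv => (h.above u hu v hv huv).imp (fun h => habove _ _ h hv)
      (fun h => habove _ _ h hu)⟩

/-- Decompositions of the classes share one array without interfering, because each class is closed
under parents. The label is only required to be constant along edges. -/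
lemma IsDecomp.of_classes {G : SimpleGraph ℕ} {par : ℕ → ℕ} {k : ℕ} {U : Finset ℕ} (g : ℕ → ℕ)
    (hg : ∀ u ∈ U, ∀ v ∈ U, G.Adj u v → g u = g v)
    (h : ∀ c ∈ U, IsDecomp G par k (U.filter fun u => g u = g c)) : IsDecomp G par k U where
  parent_mem v hv p hp :=
    (Finset.mem_filter.1 ((h v hv).parent_mem v (Finset.mem_filter.2 ⟨hv, rfl⟩) p hp)).1
  depth_le v hv := (h v hv).depth_le v (Finset.mem_filter.2 ⟨hv, rfl⟩)
  above u hu v hv huv := (h v hv).above u (Finset.mem_filter.2 ⟨hu, hg u hu v hv huv⟩) v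
    (Finset.mem_filter.2 ⟨hv, rfl⟩) huv

/-- Put a new root on top of a decomposition. -/
lemma IsDecomp.addRoot {G : SimpleGraph ℕ} {par par' : ℕ → ℕ} {k x : ℕ} {U : Finset ℕ}
    (h : IsDecomp G par k (U.erase x)) (hx : x ∈ U) (hx0 : par' x = 0)
    (he : ∀ v ∈ U, v ≠ x → par' v = if par v = 0 then x + 1 else par v) :
    IsDecomp G par' (k + 1) U := by
  have hpar : ∀ v ∈ U.erase x, ∀ p, par v = p + 1 → par' v = p + 1 := by
    intro v hv p hp
    rw [Finset.mem_erase] at hv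
    rw [he v hv.2 hv.1, hp, if_neg (by omega)]
  have hroot : ∀ v ∈ U.erase x, par v = 0 → par' v = x + 1 := by
    intro v hv hp
    rw [Finset.mem_erase] at hv
    rw [he v hv.2 hv.1, if_pos hp]
  have habove : ∀ u v, Above par u v → v ∈ U.erase x → Above par' u v := by
    intro u v ha
    induction ha with
    | single hb => exact fun hU => .single (hpar _ hU _ hb)
    | tail _ hc ih => exact fun hU => .tail (ih (h.parent_mem _ hU _ hc)) (hpar _ hU _ hc)
  -- Every old chain ends at an old root, whose parent is now `x`: depths grow by one and `x` is
  -- above everything.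
  have hdepth : ∀ k v, DepthLe par k v → v ∈ U.erase x →
      DepthLe par' (k + 1) v ∧ Above par' x v := by
    intro k
    induction k with
    | zero => exact fun _ h _ => h.elim
    | succ k ih =>
      rintro v (h0 | ⟨p, hp, hd⟩) hU
      · exact ⟨.inr ⟨x, hroot v hU h0, .inl hx0⟩, .single (hroot v hU h0)⟩
      · obtain ⟨h1, h2⟩ := ih p hd (h.parent_mem v hU p hp)
        exact ⟨.inr ⟨p, hpar v hU p hp, h1⟩, .tail h2 (hpar v hU p hp)⟩
  refine ⟨fun v hv p hp => ?_, fun v hv => ?_, fun u hu v hv huv => ?_⟩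
  · by_cases hvx : v = x
    · subst hvx; omega
    · have hv' := Finset.mem_erase.2 ⟨hvx, hv⟩
      by_cases h0 : par v = 0
      · rw [hroot v hv' h0] at hp
        rwa [← Nat.succ.inj hp]
      · rw [he v hv hvx, if_neg h0] at hp
        exact Finset.mem_of_mem_erase (h.parent_mem v hv' p hp)
  · by_cases hvx : v = x
    · subst hvx; exact .inl hx0
    · exact (hdepth k v (h.depth_le v (Finset.mem_erase.2 ⟨hvx, hv⟩))
        (Finset.mem_erase.2 ⟨hvx, hv⟩)).1
  · by_cases hux : u = x
    · subst hux
      have hv' := Finset.mem_erase.2 ⟨huv.ne', hv⟩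
      exact .inl (hdepth k v (h.depth_le v hv') hv').2
    · have hu' := Finset.mem_erase.2 ⟨hux, hu⟩
      by_cases hvx : v = x
      · subst hvx
        exact .inr (hdepth k u (h.depth_le u hu') hu').2
      · have hv' := Finset.mem_erase.2 ⟨hvx, hv⟩
        exact (h.above u hu' v hv' huv).imp (fun h => habove _ _ h hv') (fun h => habove _ _ h hu')

/-- The depth bound forces climbing to end after at most `t` vertices; it provides the
well-foundedness of the parent function as well as the height. -/
lemma IsDecomp.exists_forest {n t : ℕ} {G : SimpleGraph (Fin n)} {par : ℕ → ℕ}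
    (h : IsDecomp (G.map Fin.valEmbedding) par t (Finset.range n)) :
    ∃ F : RootedForest (Fin n), (∀ v : Fin n, par v = (F.parent v).elim 0 fun p => (p : ℕ) + 1) ∧
      IsTreedepthDecomposition G F id ∧ F.height ≤ t := by
  -- An entry that points outside of the vertex set would turn into a root here; `parent_mem`
  -- excludes such entries.
  let f : Fin n → Option (Fin n) := fun v =>
    if hp : par v - 1 < n then if par v = 0 then none else some ⟨par v - 1, hp⟩ else none
  have hf : ∀ v p, f v = some p ↔ par v = p + 1 := by
    intro v p
    simp only [f]
    split_ifs with h1 h2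
    · simp [h2]
    · rw [Option.some.injEq, Fin.ext_iff]; simp only; omega
    · simp only [false_iff]
      have := p.2
      omega
  have hf0 : ∀ v : Fin n, par v = (f v).elim 0 fun p => (p : ℕ) + 1 := by
    intro v
    cases hv : f v with
    | some p => exact (hf v p).1 hv
    | none =>
      by_contra h0
      have h0 : par v ≠ 0 := h0
      have h1 := h.parent_mem v (Finset.mem_range.2 v.2) (par v - 1) (by omega)
      have := (hf v ⟨par v - 1, Finset.mem_range.1 h1⟩).2 (by simp only; omega)
      rw [hv] at this
      cases this
  have hacc : ∀ k (v : Fin n), DepthLe par k v → Acc (fun p v : Fin n => f v = some p) v := by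
    intro k
    induction k with
    | zero => exact fun _ h => h.elim
    | succ k ih =>
      rintro v (h0 | ⟨p, hp, hd⟩)
      · exact ⟨_, fun p hp => absurd ((hf v p).1 hp) (by omega)⟩
      · refine ⟨_, fun q hq => ih q ?_⟩
        have := (hf v q).1 hq
        rwa [show (q : ℕ) = p by omega]
  let F : RootedForest (Fin n) :=
    ⟨f, ⟨fun v => hacc t v (h.depth_le v (Finset.mem_range.2 v.2))⟩⟩
  have hdepth : ∀ k (v : Fin n), DepthLe par k v → F.depth v ≤ k := by
    intro k
    induction k with
    | zero => exact fun _ h => h.elim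
    | succ k ih =>
      rintro v (h0 | ⟨p, hp, hd⟩)
      · have : {u | u = v ∨ F.IsAncestor u v} = {v} := by
          ext u
          simp only [Set.mem_ofPred_eq, Set.mem_singleton_iff, or_iff_left_iff_imp]
          intro hu
          obtain ⟨w, -, hw⟩ := (Relation.TransGen.tail'_iff).1 hu
          exact absurd ((hf v w).1 hw) (by omega)
        unfold RootedForest.depth
        rw [this, Set.ncard_singleton]
        omega
      · have hpn := Finset.mem_range.1 (h.parent_mem v (Finset.mem_range.2 v.2) p hp)
        rw [F.depth_of_parent (p := ⟨p, hpn⟩) ((hf v _).2 hp)]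
        have := ih ⟨p, hpn⟩ hd
        omega
  have habove : ∀ a b : ℕ, Above par a b → ∀ v : Fin n, (v : ℕ) = b →
      ∃ u : Fin n, (u : ℕ) = a ∧ F.IsAncestor u v := by
    intro a b hab
    induction hab with
    | single hb =>
      rintro v rfl
      have hpn := Finset.mem_range.1 (h.parent_mem v (Finset.mem_range.2 v.2) a hb)
      exact ⟨⟨a, hpn⟩, rfl, .single ((hf v _).2 hb)⟩
    | @tail b c _ hc ih =>
      rintro v rfl
      have hpn := Finset.mem_range.1 (h.parent_mem v (Finset.mem_range.2 v.2) b hc)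
      obtain ⟨u, hu, hu'⟩ := ih ⟨b, hpn⟩ rfl
      exact ⟨u, hu, .tail hu' ((hf v _).2 hc)⟩
  refine ⟨F, hf0, ⟨Function.injective_id, fun u v huv => ?_⟩, ?_⟩
  · refine (h.above u (Finset.mem_range.2 u.2) v (Finset.mem_range.2 v.2)
      (SimpleGraph.map_adj_apply.2 huv)).imp (fun h => ?_) (fun h => ?_)
    · obtain ⟨w, hw, hw'⟩ := habove _ _ h v rfl
      rwa [Fin.ext hw] at hw'
    · obtain ⟨w, hw, hw'⟩ := habove _ _ h u rfl
      rwa [Fin.ext hw] at hw'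
  · exact Finset.sup_le fun v _ => hdepth t v (h.depth_le v (Finset.mem_range.2 v.2))

lemma treedepth_le_of_isDecomp {n t : ℕ} {G : SimpleGraph (Fin n)} {par : ℕ → ℕ}
    (h : IsDecomp (G.map Fin.valEmbedding) par t (Finset.range n)) : treedepth G ≤ t := by
  obtain ⟨F, -, h1, h2⟩ := h.exists_forest
  have : treedepth G ≤ F.height := Nat.sInf_le ⟨n, F, id, h1, rfl⟩
  exact this.trans h2

/-! ### Leaders of components and pointers to them -/

namespace Search

open SimpleGraph

variable {G : SimpleGraph ℕ} {U : Finset ℕ}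

/-- `L` assigns to each vertex of `U` a vertex of its component in the graph induced by `U`, the
same one to all vertices of the component. -/
structure IsLeader (G : SimpleGraph ℕ) (U : Finset ℕ) (L : ℕ → ℕ) : Prop where
  reach : ∀ v ∈ U, (G.within U).Reachable v (L v)
  eq : ∀ u ∈ U, ∀ v ∈ U, (G.within U).Reachable u v → L u = L v

namespace IsLeader

variable {L : ℕ → ℕ}

lemma mem (h : IsLeader G U L) {v : ℕ} (hv : v ∈ U) : L v ∈ U := (h.reach v hv).mem_of_within hv

lemma leader_leader (h : IsLeader G U L) {v : ℕ} (hv : v ∈ U) : L (L v) = L v :=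
  (h.eq v hv (L v) (h.mem hv) (h.reach v hv)).symm

lemma eq_of_adj (h : IsLeader G U L) {u v : ℕ} (hu : u ∈ U) (hv : v ∈ U) (huv : G.Adj u v) :
    L u = L v :=
  h.eq u hu v hv (SimpleGraph.Adj.reachable ⟨hu, hv, huv⟩)

end IsLeader

/-- `P` maps each vertex of `U` except for the leaders to a neighbour, and fewer than `N` such
steps lead to the leader. -/
structure IsPointer (G : SimpleGraph ℕ) (U : Finset ℕ) (N : ℕ) (L P : ℕ → ℕ) : Prop where
  mem : ∀ v ∈ U, P v ∈ U
  step : ∀ v ∈ U, P v = v ∨ G.Adj v (P v)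
  reach : ∀ v ∈ U, ∃ i < N, P^[i] v = L v
  leader : ∀ v ∈ U, P (L v) = L v

namespace IsPointer

variable {N : ℕ} {L P : ℕ → ℕ}

lemma iterate_mem (h : IsPointer G U N L P) (i : ℕ) {v : ℕ} (hv : v ∈ U) : P^[i] v ∈ U := by
  induction i with
  | zero => exact hv
  | succ i ih => rw [Function.iterate_succ_apply']; exact h.mem _ ih

lemma leader_iterate (h : IsPointer G U N L P) (hL : IsLeader G U L) (i : ℕ) {v : ℕ} (hv : v ∈ U) :
    L (P^[i] v) = L v := by
  induction i with
  | zero => rfl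
  | succ i ih =>
    rw [Function.iterate_succ_apply']
    have hm := h.iterate_mem i hv
    rcases h.step _ hm with h1 | h1
    · rw [h1, ih]
    · rw [← hL.eq_of_adj hm (h.mem _ hm) h1, ih]

lemma iterate_eq_of_le (h : IsPointer G U N L P) {v : ℕ} (hv : v ∈ U) {i j : ℕ}
    (hi : P^[i] v = L v) (hij : i ≤ j) :
    P^[j] v = L v := by
  obtain ⟨d, rfl⟩ := Nat.exists_eq_add_of_le hij
  clear hij
  induction d with
  | zero => exact hi
  | succ d ih => rw [← Nat.add_assoc, Function.iterate_succ_apply', ih, h.leader v hv]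

/-- Once the leader is reached, the iterates are constant, so the orbit of `v` has at most `N`
elements. -/
lemma exists_lt_iterate_eq (h : IsPointer G U N L P) {v : ℕ} (hv : v ∈ U) (j : ℕ) :
    ∃ i < N, P^[i] v = P^[j] v := by
  obtain ⟨i, hi, hi'⟩ := h.reach v hv
  rcases lt_or_ge j i with hj | hj
  · exact ⟨j, hj.trans hi, rfl⟩
  · exact ⟨i, hi, by rw [hi', h.iterate_eq_of_le hv hi' hj]⟩

end IsPointer

/-- The invariant of the propagation of labels and pointers along edges. -/
structure Propagating (G : SimpleGraph ℕ) (U : Finset ℕ) (L P : ℕ → ℕ) : Prop where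
  reach : ∀ v ∈ U, (G.within U).Reachable v (L v)
  le : ∀ v ∈ U, L v ≤ v
  pointer : ∀ v ∈ U, (P v = v ∧ L v = v) ∨ (P v ∈ U ∧ G.Adj v (P v) ∧ L (P v) ≤ L v)
  rank : ∃ D : ℕ → ℕ, ∀ v ∈ U, P v ≠ v → L (P v) = L v → D (P v) < D v

lemma Propagating.init {L P : ℕ → ℕ} (hL : ∀ v ∈ U, L v = v) (hP : ∀ v ∈ U, P v = v) :
    Propagating G U L P where
  reach v hv := by rw [hL v hv]
  le v hv := (hL v hv).le
  pointer v hv := .inl ⟨hP v hv, hL v hv⟩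
  rank := ⟨fun _ => 0, fun v hv h => (h (hP v hv)).elim⟩

/-- Labels only decrease. The vertex `v` gets a rank above that of `u`; an old pointer to `v` now
leads to a strictly smaller label and is therefore exempt from the rank condition. Thus pointers
with equal labels never form a cycle. -/
lemma Propagating.relax {L P : ℕ → ℕ} (h : Propagating G U L P) {u v : ℕ} (hu : u ∈ U)
    (hv : v ∈ U) (huv : G.Adj u v) (hlt : L u < L v) :
    Propagating G U (Function.update L v (L u)) (Function.update P v u) := by
  have hne : u ≠ v := huv.ne
  refine ⟨fun w hw => ?_, fun w hw => ?_, fun w hw => ?_, ?_⟩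
  · by_cases hwv : w = v
    · subst hwv
      rw [Function.update_self]
      exact (SimpleGraph.Adj.reachable (⟨hw, hu, huv.symm⟩ : (G.within U).Adj w u)).trans
        (h.reach u hu)
    · rw [Function.update_of_ne hwv]; exact h.reach w hw
  · by_cases hwv : w = v
    · subst hwv
      rw [Function.update_self]
      exact hlt.le.trans (h.le w hw)
    · rw [Function.update_of_ne hwv]; exact h.le w hw
  · by_cases hwv : w = v
    · subst hwv
      rw [Function.update_self, Function.update_self, Function.update_of_ne hne]
      exact .inr ⟨hu, huv.symm, le_rfl⟩
    · rw [Function.update_of_ne hwv, Function.update_of_ne hwv]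
      refine (h.pointer w hw).imp id fun ⟨h1, h2, h3⟩ => ⟨h1, h2, ?_⟩
      by_cases hp : P w = v
      · rw [hp, Function.update_self]
        rw [hp] at h3
        exact hlt.le.trans h3
      · rwa [Function.update_of_ne hp]
  · obtain ⟨D, hD⟩ := h.rank
    refine ⟨Function.update D v (D u + 1), fun w hw => ?_⟩
    by_cases hwv : w = v
    · subst hwv
      rw [Function.update_self, Function.update_self, Function.update_of_ne hne,
        Function.update_of_ne hne]
      intro _ _
      rw [Function.update_self]
      exact Nat.lt_succ_self _
    · rw [Function.update_of_ne hwv, Function.update_of_ne hwv, Function.update_of_ne hwv]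
      intro hp he
      by_cases hpv : P w = v
      · rw [hpv, Function.update_self] at he
        rcases h.pointer w hw with h1 | h1
        · exact absurd h1.1 hp
        · have := h1.2.2
          rw [hpv] at this
          omega
      · rw [Function.update_of_ne hpv] at he ⊢
        exact hD w hw hp he

/-- After `N` rounds all labels and pointers are final. -/
lemma Propagating.final {L P : ℕ → ℕ} (h : Propagating G U L P) {t : ℕ} {V : Finset ℕ}
    (ht : G.TdLe t V) (hU : U ⊆ V)
    (hL : ∀ u v, u ∈ U → v ∈ U → (∃ p : (G.within U).Walk u v, p.length < 2 ^ t) → L v ≤ u) :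
    IsLeader G U L ∧ IsPointer G U (2 ^ t) L P := by
  -- A shortcut-free walk in `U` has fewer than `2 ^ t` vertices, so the hypothesis for short walks
  -- covers all reachable pairs.
  have hmin : ∀ u ∈ U, ∀ v ∈ U, (G.within U).Reachable u v → L v ≤ u := by
    intro u hu v hv huv
    obtain ⟨p, hp⟩ := huv.exists_isPath
    refine hL u v hu hv ⟨p, ?_⟩
    have hmem : ∀ {a b : ℕ} (q : (G.within U).Walk a b), a ∈ U → ∀ w ∈ q.support, w ∈ U := by
      intro a b q
      induction q with
      | nil => intro ha w hw; rw [Walk.support_nil, List.mem_singleton] at hw; rwa [hw]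
      | cons h' _ ih =>
        intro ha w hw
        rw [Walk.support_cons, List.mem_cons] at hw
        rcases hw with rfl | hw
        · exact ha
        · exact ih h'.2.1 w hw
    have := ht.length_lt p.support
      (List.IsChain.imp (fun _ _ h => h.2.2) p.isChain_adj_support) hp.support_nodup
      (fun w hw => hU (hmem p hu w hw))
    rw [Walk.length_support] at this
    omega
  have hlead : IsLeader G U L := by
    refine ⟨h.reach, fun u hu v hv huv => le_antisymm ?_ ?_⟩
    · exact hmin _ ((h.reach v hv).mem_of_within hv) u hu (huv.trans (h.reach v hv)).symm
    · exact hmin _ ((h.reach u hu).mem_of_within hu) v hv (huv.symm.trans (h.reach u hu)).symm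
  have hfix : ∀ v ∈ U, P v = v → L v = v := by
    intro v hv hp
    rcases h.pointer v hv with h1 | h1
    · exact h1.2
    · exact absurd hp.symm h1.2.1.ne
  have hmemP : ∀ v ∈ U, P v ∈ U := by
    intro v hv
    rcases h.pointer v hv with h1 | h1
    · rwa [h1.1]
    · exact h1.1
  have hstep : ∀ v ∈ U, P v = v ∨ G.Adj v (P v) := fun v hv =>
    (h.pointer v hv).imp And.left fun h => h.2.1
  have hLP : ∀ v ∈ U, L (P v) = L v := by
    intro v hv
    rcases hstep v hv with h1 | h1
    · rw [h1]
    · exact (hlead.eq_of_adj hv (hmemP v hv) h1).symm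
  have hleadP : ∀ v ∈ U, P (L v) = L v := by
    intro v hv
    obtain ⟨D, hD⟩ := h.rank
    -- Following pointers within a component keeps the label and lowers the rank, so it ends at a
    -- fixed point; a fixed point is its own label and hence the leader.
    have hdesc : ∀ (r w : ℕ), w ∈ U → D w = r → L w = L v → ∃ x ∈ U, P x = x ∧ L x = L v := by
      intro r
      induction r using Nat.strong_induction_on with
      | _ r ih =>
        intro w hw hr hLw
        by_cases hp : P w = w
        · exact ⟨w, hw, hp, hLw⟩
        · exact ih (D (P w)) (hr ▸ hD w hw hp (hLP w hw)) (P w) (hmemP w hw) rfl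
            ((hLP w hw).trans hLw)
    obtain ⟨x, hx, hx1, hx2⟩ := hdesc _ (L v) (hlead.mem hv) rfl (hlead.leader_leader hv)
    rw [← hx2, hfix x hx hx1, hx1]
  refine ⟨hlead, hmemP, hstep, ?_, hleadP⟩
  intro v hv
  -- Otherwise the first `2 ^ t` iterates would strictly lower the rank, hence be distinct, and form
  -- a path that is too long.
  by_contra hcon
  push Not at hcon
  obtain ⟨D, hD⟩ := h.rank
  have hm : ∀ i, P^[i] v ∈ U := by
    intro i
    induction i with
    | zero => exact hv
    | succ i ih => rw [Function.iterate_succ_apply']; exact hmemP _ ih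
  have hLi : ∀ i, L (P^[i] v) = L v := by
    intro i
    induction i with
    | zero => rfl
    | succ i ih => rw [Function.iterate_succ_apply', hLP _ (hm i), ih]
  have hnf : ∀ i < 2 ^ t, P (P^[i] v) ≠ P^[i] v := by
    intro i hi hp
    have := hfix _ (hm i) hp
    rw [hLi] at this
    exact hcon i hi this.symm
  have hdec : ∀ i < 2 ^ t, D (P^[i + 1] v) < D (P^[i] v) := by
    intro i hi
    rw [Function.iterate_succ_apply']
    exact hD _ (hm i) (hnf i hi) (hLP _ (hm i))
  have hlt : ∀ j ≤ 2 ^ t, ∀ i < j, D (P^[j] v) < D (P^[i] v) := by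
    intro j
    induction j with
    | zero => intro _ i hi; omega
    | succ j ih =>
      intro hj i hi
      rcases Nat.lt_succ_iff_lt_or_eq.1 hi with h1 | rfl
      · exact (hdec j (by omega)).trans (ih (by omega) i h1)
      · exact hdec i (by omega)
  have := ht.length_lt ((List.range (2 ^ t)).map fun i => P^[i] v) ?_ ?_ ?_
  · simp at this
  · rw [List.isChain_map]
    refine List.isChain_iff_getElem.2 fun i hi => ?_
    simp only [List.length_range] at hi
    simp only [List.getElem_range]
    have h1 := hstep _ (hm i)
    rw [← Function.iterate_succ_apply' P i v] at h1
    rcases h1 with h1 | h1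
    · rw [Function.iterate_succ_apply'] at h1
      exact absurd h1 (hnf i (by omega))
    · exact h1
  · refine List.Nodup.map_on (fun i hi j hj hij => ?_) List.nodup_range
    rw [List.mem_range] at hi hj
    rcases lt_trichotomy i j with h1 | h1 | h1
    · have := hlt j (by omega) i h1
      rw [hij] at this; omega
    · exact h1
    · have := hlt i (by omega) j h1
      rw [hij] at this; omega
  · intro w hw
    obtain ⟨i, -, rfl⟩ := List.mem_map.1 hw
    exact hU (hm i)

end Search

namespace Search

open SimpleGraph

variable {G : SimpleGraph ℕ} {U : Finset ℕ}

/-! ### One round of the search for a root -/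

/-- The vertices of the component with leader `c`. -/
def comp (U : Finset ℕ) (L : ℕ → ℕ) (c : ℕ) : Finset ℕ := U.filter fun v => L v = c

/-- The vertices of `C` at which the array `f` is not `0`. -/
def flagged (C : Finset ℕ) (f : ℕ → ℕ) : Finset ℕ := C.filter fun v => f v ≠ 0

lemma mem_comp {L : ℕ → ℕ} {c v : ℕ} : v ∈ comp U L c ↔ v ∈ U ∧ L v = c := Finset.mem_filter

lemma mem_flagged {C : Finset ℕ} {f : ℕ → ℕ} {v : ℕ} : v ∈ flagged C f ↔ v ∈ C ∧ f v ≠ 0 :=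
  Finset.mem_filter

lemma flagged_congr {C : Finset ℕ} {f g : ℕ → ℕ} (h : ∀ v ∈ C, f v = g v) :
    flagged C f = flagged C g :=
  Finset.filter_congr fun v hv => by rw [h v hv]

/-- For each component of the graph induced by `U`, the array `par` holds a decomposition of
height at most `k` or the array `acc` marks a set of at most `b` vertices that shows that there
is none. In the first case, `acc` marks nothing. -/
structure Solved (G : SimpleGraph ℕ) (U : Finset ℕ) (k b : ℕ) (L acc par : ℕ → ℕ) : Prop where
  leader : IsLeader G U L
  dichotomy : ∀ c ∈ U, L c = c → (flagged (comp U L c) acc = ∅ ∧ IsDecomp G par k (comp U L c)) ∨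
    (¬G.TdLe k (flagged (comp U L c) acc) ∧ (flagged (comp U L c) acc).card ≤ b)

/-- What is known about a component `C` with leader `c` after `j` rounds of trying roots. The
array `todo` marks the roots that are to be tried. -/
def RoundInv (G : SimpleGraph ℕ) (C : Finset ℕ) (c k b j : ℕ) (todo acc par : ℕ → ℕ) : Prop :=
  (flagged C todo = ∅ ∧ flagged C acc = ∅ ∧ IsDecomp G par (k + 1) C) ∨
  (j = 0 ∧ flagged C todo = {c} ∧ flagged C acc = ∅) ∨
  (0 < j ∧ ∃ H ⊆ flagged C acc, ¬G.TdLe k H ∧ flagged C todo ⊆ H ∧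
    (∀ x ∈ H, x ∉ flagged C todo → ∃ H' ⊆ flagged C acc, x ∉ H' ∧ ¬G.TdLe k H') ∧
    (flagged C acc).card + b * (flagged C todo).card ≤ b + b * b ∧
    (flagged C todo = ∅ ∨ (flagged C todo).card + (j - 1) ≤ b))

/-- The three cases of the invariant are: solved; nothing tried yet, with the leader as the only
candidate; and failed so far. In the last case `H` is the witness of the first failed root. Its
vertices are the candidates, and each one that has been tried has a witness avoiding it among the
marked vertices. The size condition reserves `b` marks for the witness of every pending candidate.
The last condition counts the rounds, of which the first one produced `H`. The value `0` of `pick`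
or `sel` means that there is no candidate or no failed part. -/
lemma RoundInv.next {L pick sel L' acc' par' todo acc par todo₂ acc₂ par₂ : ℕ → ℕ}
    {U' : Finset ℕ} {k b j c : ℕ} (hL : IsLeader G U L)
    (h : RoundInv G (comp U L c) c k b j todo acc par)
    (hpick : (pick c = 0 ∧ ∀ v ∈ U, L v = c → todo v = 0) ∨
      ∃ x ∈ U, L x = c ∧ todo x ≠ 0 ∧ pick c = x + 1)
    (hU' : ∀ v, v ∈ U' ↔ v ∈ U ∧ pick (L v) ≠ v + 1)
    (hchild : Solved G U' k b L' acc' par')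
    (hsel : (sel c = 0 ∧ ∀ v ∈ U', L v = c → acc' v = 0) ∨
      ∃ x ∈ U', L x = c ∧ acc' x ≠ 0 ∧ sel c = L' x + 1)
    (htodo : ∀ v ∈ U, L v = c → todo₂ v = if pick c = 0 then todo v else if sel c = 0 then 0 else
      if v ∈ U' ∧ acc' v ≠ 0 ∧ sel c = L' v + 1 ∧ j = 0 then 1 else
      if pick c = v + 1 then 0 else todo v)
    (hacc : ∀ v ∈ U, L v = c → acc₂ v = if pick c = 0 then acc v else if sel c = 0 then 0 else
      if v ∈ U' ∧ acc' v ≠ 0 ∧ sel c = L' v + 1 then 1 else acc v)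
    (hpar : ∀ v ∈ U, L v = c → par₂ v = if pick c = 0 then par v else if sel c = 0 then
      (if pick c = v + 1 then 0 else if par' v = 0 then pick c else par' v) else par v) :
    RoundInv G (comp U L c) c k b (j + 1) todo₂ acc₂ par₂ := by
  have hU'U : U' ⊆ U := fun v hv => ((hU' v).1 hv).1
  rcases hpick with ⟨hp, hT⟩ | ⟨x, hx, hLx, hxt, hp⟩
  · have hT : flagged (comp U L c) todo = ∅ := by
      refine Finset.eq_empty_of_forall_notMem fun v hv => ?_
      rw [mem_flagged, mem_comp] at hv
      exact hv.2 (hT v hv.1.1 hv.1.2)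
    have e1 : flagged (comp U L c) todo₂ = flagged (comp U L c) todo :=
      flagged_congr fun v hv => by
        rw [mem_comp] at hv; rw [htodo v hv.1 hv.2, if_pos hp]
    have e2 : flagged (comp U L c) acc₂ = flagged (comp U L c) acc :=
      flagged_congr fun v hv => by
        rw [mem_comp] at hv; rw [hacc v hv.1 hv.2, if_pos hp]
    unfold RoundInv
    rw [e1, e2]
    rcases h with ⟨h1, h2, h3⟩ | ⟨h1, h2, h3⟩ | ⟨h1, H, h2, h3, h4, h5, h6, h7⟩
    · refine .inl ⟨h1, h2, h3.congr fun v hv => ?_⟩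
      rw [mem_comp] at hv; rw [hpar v hv.1 hv.2, if_pos hp]
    · rw [h2] at hT; simp at hT
    · exact .inr (.inr ⟨by omega, H, h2, h3, h4, h5, h6, .inl hT⟩)
  have hp0 : pick c ≠ 0 := by omega
  have hxT : x ∈ flagged (comp U L c) todo := mem_flagged.2 ⟨mem_comp.2 ⟨hx, hLx⟩, hxt⟩
  have hcomp : ∀ v, v ∈ (comp U L c).erase x ↔ v ∈ U' ∧ L v = c := by
    intro v
    rw [Finset.mem_erase, mem_comp, hU']
    constructor
    · rintro ⟨h1, h2, rfl⟩
      exact ⟨⟨h2, by rw [hp]; omega⟩, rfl⟩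
    · rintro ⟨⟨h1, h2⟩, rfl⟩
      exact ⟨by rintro rfl; exact h2 hp, h1, rfl⟩
  -- The components that remain after deleting the roots refine the old components.
  have hLL : ∀ u ∈ U', ∀ v ∈ U', L' u = L' v → L u = L v := by
    intro u hu v hv huv
    have h1 := hchild.leader.reach u hu
    rw [huv] at h1
    exact hL.eq u (hU'U hu) v (hU'U hv)
      ((h1.trans (hchild.leader.reach v hv).symm).mono (within_mono hU'U))
  rcases hsel with ⟨hs, hnone⟩ | ⟨y, hy, hLy, hya, hs⟩
  · refine .inl ⟨?_, ?_, ?_⟩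
    · refine Finset.eq_empty_of_forall_notMem fun v hv => ?_
      rw [mem_flagged, mem_comp] at hv
      rw [htodo v hv.1.1 hv.1.2, if_neg hp0, if_pos hs] at hv
      exact hv.2 rfl
    · refine Finset.eq_empty_of_forall_notMem fun v hv => ?_
      rw [mem_flagged, mem_comp] at hv
      rw [hacc v hv.1.1 hv.1.2, if_neg hp0, if_pos hs] at hv
      exact hv.2 rfl
    · refine IsDecomp.addRoot (par := par') (x := x) ?_ (mem_comp.2 ⟨hx, hLx⟩) ?_ ?_
      · refine IsDecomp.of_classes L' ?_ ?_
        · intro u hu v hv huv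
          exact hchild.leader.eq_of_adj ((hcomp u).1 hu).1 ((hcomp v).1 hv).1 huv
        · intro w hw
          obtain ⟨hw1, hw2⟩ := (hcomp w).1 hw
          have hm := hchild.leader.mem hw1
          have hll := hchild.leader.leader_leader hw1
          have hset : ((comp U L c).erase x).filter (fun u => L' u = L' w) =
              comp U' L' (L' w) := by
            ext u
            rw [Finset.mem_filter, hcomp, mem_comp]
            constructor
            · rintro ⟨h1, h2⟩; exact ⟨h1.1, h2⟩
            · rintro ⟨h1, h2⟩
              exact ⟨⟨h1, (hLL u h1 w hw1 h2).trans hw2⟩, h2⟩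
          rw [hset]
          rcases hchild.dichotomy (L' w) hm hll with h1 | h1
          · exact h1.2
          · refine absurd ?_ h1.1
            rw [Finset.eq_empty_of_forall_notMem (s := flagged _ _)]
            · exact .empty
            · intro v hv
              rw [mem_flagged, mem_comp] at hv
              exact hv.2 (hnone v hv.1.1 ((hLL v hv.1.1 w hw1 hv.1.2).trans hw2))
      · rw [hpar x hx hLx, if_neg hp0, if_pos hs, if_pos hp]
      · intro v hv hvx
        rw [mem_comp] at hv
        rw [hpar v hv.1 hv.2, if_neg hp0, if_pos hs, if_neg (by omega), hp]
  · have hs0 : sel c ≠ 0 := by omega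
    have hm := hchild.leader.mem hy
    have hll := hchild.leader.leader_leader hy
    -- One failed part of the component is enough; its marks are the witness against the root `x`.
    set Hy := flagged (comp U' L' (L' y)) acc' with hHy
    have hyH : y ∈ Hy := mem_flagged.2 ⟨mem_comp.2 ⟨hy, rfl⟩, hya⟩
    obtain ⟨hbad, hcard⟩ : ¬G.TdLe k Hy ∧ Hy.card ≤ b := by
      rcases hchild.dichotomy (L' y) hm hll with h1 | h1
      · rw [← hHy] at h1
        rw [h1.1] at hyH; simp at hyH
      · exact h1
    have hHyC : ∀ v, v ∈ Hy ↔ (v ∈ U ∧ L v = c) ∧ v ∈ U' ∧ acc' v ≠ 0 ∧ sel c = L' v + 1 := by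
      intro v
      rw [hHy, mem_flagged, mem_comp, hs]
      constructor
      · rintro ⟨⟨h1, h2⟩, h3⟩
        exact ⟨⟨hU'U h1, (hLL v h1 y hy h2).trans hLy⟩, h1, h3, by rw [h2]⟩
      · rintro ⟨-, h1, h2, h3⟩
        exact ⟨⟨h1, by omega⟩, h2⟩
    have hxH : x ∉ Hy := by
      rw [hHyC, hU', hLx]
      tauto
    have hQ : flagged (comp U L c) acc₂ = flagged (comp U L c) acc ∪ Hy := by
      ext v
      rw [mem_flagged, Finset.mem_union, mem_flagged, mem_comp, hHyC]
      by_cases hv : v ∈ U ∧ L v = c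
      · rw [hacc v hv.1 hv.2, if_neg hp0, if_neg hs0]
        split_ifs with h1 <;> simp [h1, hv]
      · simp [hv]
    have hT : flagged (comp U L c) todo₂ =
        (flagged (comp U L c) todo).erase x ∪ (if j = 0 then Hy else ∅) := by
      ext v
      rw [mem_flagged, Finset.mem_union, Finset.mem_erase, mem_flagged, mem_comp]
      have hif : v ∈ (if j = 0 then Hy else ∅) ↔ v ∈ Hy ∧ j = 0 := by
        split_ifs with hj <;> simp [hj]
      rw [hif, hHyC]
      by_cases hv : v ∈ U ∧ L v = c
      · rw [htodo v hv.1 hv.2, if_neg hp0, if_neg hs0]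
        have hvx : pick c = v + 1 ↔ v = x := by rw [hp]; omega
        simp only [hvx]
        split_ifs with h1 h2
        · simp [h1, hv]
        · subst h2
          simp only [hv, and_self, true_and, ne_eq, not_true_eq_false, false_and, and_false,
            false_or, false_iff]
          tauto
        · simp only [hv, h2, and_self, true_and, ne_eq, not_false_eq_true]
          tauto
      · simp [hv]
    refine .inr (.inr ⟨by omega, ?_⟩)
    rw [hQ, hT]
    rcases h with ⟨h1, h2, h3⟩ | ⟨h1, h2, h3⟩ | ⟨h1, H, h2, h3, h4, h5, h6, h7⟩
    · rw [h1] at hxT; simp at hxT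
    -- In the first round the witness also becomes the list of candidates. All of it is pending, so
    -- no tried vertex needs a witness yet, and the budget starts with at most `b + b * b`.
    · have hxc : x = c := by rw [h2] at hxT; simpa using hxT
      refine ⟨Hy, Finset.subset_union_right, hbad, ?_, ?_, ?_, ?_⟩
      · rw [if_pos h1, h2, hxc]; simp
      · intro z hz hz'
        rw [if_pos h1] at hz'
        exact absurd (Finset.mem_union_right _ hz) hz'
      · rw [if_pos h1, h2, h3, hxc]
        simp only [Finset.empty_union, Finset.erase_singleton]
        have := Nat.mul_le_mul_left b hcard
        omega
      · right
        rw [if_pos h1, h2, hxc]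
        simp only [Finset.empty_union, Finset.erase_singleton]
        omega
    -- In a later round `x` leaves the candidates and `Hy` is its witness. The reserve of `b` for
    -- `x` pays for the new marks.
    · have hj : j ≠ 0 := by omega
      have hTc : ((flagged (comp U L c) todo).erase x).card + 1 =
          (flagged (comp U L c) todo).card := Finset.card_erase_add_one hxT
      simp only [if_neg hj, Finset.union_empty]
      refine ⟨H, h2.trans Finset.subset_union_left, h3, (Finset.erase_subset _ _).trans h4, ?_, ?_,
        ?_⟩
      · intro z hz hz'
        by_cases hzx : z = x
        · subst hzx
          exact ⟨Hy, Finset.subset_union_right, hxH, hbad⟩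
        · obtain ⟨H', h8, h9⟩ := h5 z hz fun hh => hz' (Finset.mem_erase.2 ⟨hzx, hh⟩)
          exact ⟨H', h8.trans Finset.subset_union_left, h9⟩
      · have := Finset.card_union_le (flagged (comp U L c) acc) Hy
        rw [← hTc, mul_add, mul_one] at h6
        omega
      · right
        rcases h7 with h7 | h7
        · rw [h7] at hxT; simp at hxT
        · omega

/-- After sufficiently many rounds, add to the marked vertices all vertices to which the pointers
lead. -/
lemma Solved.of_rounds {L P todo acc par acc₂ : ℕ → ℕ} {k b j N : ℕ} (hL : IsLeader G U L)
    (hP : IsPointer G U N L P)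
    (h : ∀ c ∈ U, L c = c → RoundInv G (comp U L c) c k b j todo acc par) (hj : b + 1 ≤ j)
    (hcl : ∀ v ∈ U, acc₂ v ≠ 0 ↔ ∃ u ∈ U, acc u ≠ 0 ∧ ∃ i, P^[i] u = v) :
    Solved G U (k + 1) (N * (b + b * b)) L acc₂ par := by
  refine ⟨hL, fun c hc hcc => ?_⟩
  have hmem : ∀ v, v ∈ flagged (comp U L c) acc₂ ↔
      ∃ u ∈ flagged (comp U L c) acc, ∃ i, P^[i] u = v := by
    intro v
    constructor
    · intro hv
      rw [mem_flagged, mem_comp] at hv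
      obtain ⟨u, hu, hua, i, hi⟩ := (hcl v hv.1.1).1 hv.2
      refine ⟨u, mem_flagged.2 ⟨mem_comp.2 ⟨hu, ?_⟩, hua⟩, i, hi⟩
      rw [← hP.leader_iterate hL i hu, hi, hv.1.2]
    · rintro ⟨u, hu, i, rfl⟩
      rw [mem_flagged, mem_comp] at hu
      have hm := hP.iterate_mem i hu.1.1
      rw [mem_flagged, mem_comp]
      exact ⟨⟨hm, (hP.leader_iterate hL i hu.1.1).trans hu.1.2⟩,
        (hcl _ hm).2 ⟨u, hu.1.1, hu.2, i, rfl⟩⟩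
  have hsub : flagged (comp U L c) acc ⊆ flagged (comp U L c) acc₂ :=
    fun v hv => (hmem v).2 ⟨v, hv, 0, rfl⟩
  rcases h c hc hcc with ⟨h1, h2, h3⟩ | ⟨h1, h2, h3⟩ | ⟨h1, H, h2, h3, h4, h5, h6, h7⟩
  · refine .inl ⟨Finset.eq_empty_of_forall_notMem fun v hv => ?_, h3⟩
    obtain ⟨u, hu, -⟩ := (hmem v).1 hv
    rw [h2] at hu
    simp at hu
  · omega
  · have hT : flagged (comp U L c) todo = ∅ := by
      rcases h7 with h7 | h7
      · exact h7
      · exact Finset.card_eq_zero.1 (by omega)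
    refine .inr ⟨fun htd => ?_, ?_⟩
    · obtain ⟨z, hz⟩ : H.Nonempty := by
        rw [Finset.nonempty_iff_ne_empty]
        rintro rfl
        exact h3 .empty
      have hz' := h2 hz
      rw [mem_flagged, mem_comp] at hz'
      have hcW : c ∈ flagged (comp U L c) acc₂ := by
        obtain ⟨i, -, hi⟩ := hP.reach z hz'.1.1
        exact (hmem c).2 ⟨z, h2 hz, i, by rw [hi, hz'.1.2]⟩
      -- The closed set is connected: it contains the pointer path of each of its vertices to the
      -- leader `c`.
      obtain ⟨r, hr⟩ := htd.exists_erase subset_rfl hcW (fun v hv => by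
        have hv' := hv
        rw [mem_flagged, mem_comp] at hv'
        have hstep : ∀ i, (G.within (flagged (comp U L c) acc₂)).Reachable v (P^[i] v) ∧
            P^[i] v ∈ flagged (comp U L c) acc₂ := by
          intro i
          induction i with
          | zero => exact ⟨Reachable.refl _, hv⟩
          | succ i ih =>
            have hm := hP.iterate_mem i hv'.1.1
            have hm2 : P^[i + 1] v ∈ flagged (comp U L c) acc₂ := by
              obtain ⟨u, hu, l, hl⟩ := (hmem v).1 hv
              exact (hmem _).2 ⟨u, hu, i + 1 + l, by rw [Function.iterate_add_apply, hl]⟩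
            refine ⟨?_, hm2⟩
            rw [Function.iterate_succ_apply'] at hm2 ⊢
            rcases hP.step _ hm with h8 | h8
            · rw [h8]; exact ih.1
            · exact ih.1.trans (SimpleGraph.Adj.reachable ⟨ih.2, hm2, h8⟩)
        obtain ⟨i, -, hi⟩ := hP.reach v hv'.1.1
        have := (hstep i).1
        rwa [hi, hv'.1.2] at this)
      -- Whichever `r` is removed, a witness survives: the one that avoids `r` if `r` is in `H`, and
      -- `H` itself otherwise.
      by_cases hrH : r ∈ H
      · obtain ⟨H', h8, h9, h10⟩ := h5 r hrH (by rw [hT]; simp)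
        exact h10 (hr.mono fun v hv => Finset.mem_erase.2
          ⟨fun hh => h9 (hh ▸ hv), hsub (h8 hv)⟩)
      · exact h3 (hr.mono fun v hv => Finset.mem_erase.2
          ⟨fun hh => hrH (hh ▸ hv), hsub (h2 hv)⟩)
    -- Each marked vertex contributes an orbit of at most `N` vertices; this gives the factor `N`.
    · have hle : flagged (comp U L c) acc₂ ⊆
          (Finset.range N ×ˢ flagged (comp U L c) acc).image fun p => P^[p.1] p.2 := by
        intro v hv
        obtain ⟨u, hu, i, hi⟩ := (hmem v).1 hv
        have hu' := hu
        rw [mem_flagged, mem_comp] at hu'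
        obtain ⟨l, hl, hl'⟩ := hP.exists_lt_iterate_eq hu'.1.1 i
        exact Finset.mem_image.2 ⟨(l, u), Finset.mem_product.2 ⟨Finset.mem_range.2 hl, hu⟩,
          hl'.trans hi⟩
      refine (Finset.card_le_card hle).trans (Finset.card_image_le.trans ?_)
      rw [Finset.card_product, Finset.card_range]
      exact Nat.mul_le_mul_left _ (le_trans (Nat.le_add_right _ _) h6)

end Search

namespace RAM

/-! ### The effect of loops -/

/-- The memory `M` with `f` in row `r` of array `a`. -/
def setRow (M : Mem) (a r : ℕ) (f : ℕ → ℕ) : Mem :=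
  fun a' r' => if a' = a ∧ r' = r then f else M a' r'

lemma setRow_apply (M : Mem) (a r : ℕ) (f : ℕ → ℕ) (a' r' : ℕ) :
    setRow M a r f a' r' = if a' = a ∧ r' = r then f else M a' r' := rfl

@[simp] lemma setRow_self (M : Mem) (a r : ℕ) (f : ℕ → ℕ) : setRow M a r f a r = f := by
  simp [setRow_apply]

@[simp] lemma setRow_setRow (M : Mem) (a r : ℕ) (f g : ℕ → ℕ) :
    setRow (setRow M a r f) a r g = setRow M a r g := by
  funext a' r'
  simp only [setRow_apply]
  split_ifs <;> rfl

@[simp] lemma setRow_eq_self (M : Mem) (a r : ℕ) : setRow M a r (M a r) = M := by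
  funext a' r'
  simp only [setRow_apply]
  split_ifs with h
  · rw [h.1, h.2]
  · rfl

namespace Cmd

variable {K : Ctx}

lemma write_eq {M : Mem} {a r c v : ℕ} (hr : r < K.rows) (hc : c < K.wd) :
    write K M a r c v = setRow M a r (Function.update (M a r) c v) := by
  funext a' r' c'
  simp only [write, hr, hc, and_self, if_true, setRow_apply]
  by_cases h : a' = a ∧ r' = r
  · obtain ⟨rfl, rfl⟩ := h
    simp [Function.update_apply]
  · rw [if_neg h, if_neg]
    tauto

lemma run_seq (A B : Cmd) (δ : ℕ) (ρ : ℕ → ℕ) (M : Mem) :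
    (seq A B).run K δ ρ M = B.run K δ ρ (A.run K δ ρ M) := rfl

lemma run_ite (e : Exp) (A B : Cmd) (δ : ℕ) (ρ : ℕ → ℕ) (M : Mem) :
    (ite e A B).run K δ ρ M = if e.eval K ρ M = 0 then B.run K δ ρ M else A.run K δ ρ M := rfl

lemma run_skip (δ : ℕ) (ρ : ℕ → ℕ) (M : Mem) : skip.run K δ ρ M = M := rfl

lemma run_set {a : ℕ} {r c e : Exp} {δ : ℕ} {ρ : ℕ → ℕ} {M : Mem} (hr : r.eval K ρ M < K.rows)
    (hc : c.eval K ρ M < K.wd) :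
    (set a r c e).run K δ ρ M = setRow M a (r.eval K ρ M)
      (Function.update (M a (r.eval K ρ M)) (c.eval K ρ M) (e.eval K ρ M)) :=
  write_eq hr hc

lemma run_loop_induction {p : ℕ} {A : Cmd} {δ : ℕ} {ρ : ℕ → ℕ} {M : Mem} (I : ℕ → Mem → Prop)
    (h0 : I 0 M)
    (hs : ∀ i < K.par p, ∀ M', I i M' → I (i + 1) (A.run K (δ + 1) (Function.update ρ δ i) M')) :
    I (K.par p) ((loop p A).run K δ ρ M) := by
  have : ∀ j ≤ K.par p, I j
      (Nat.rec M (fun i M' => run K A (δ + 1) (Function.update ρ δ i) M') j) := by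
    intro j
    induction j with
    | zero => exact fun _ => h0
    | succ j ih => exact fun hj => hs j (by omega) _ (ih (by omega))
  exact this _ le_rfl

/-- A loop that computes the entries of one row. -/
lemma run_loop_fill {p a : ℕ} {eR e : Exp} {δ : ℕ} {ρ : ℕ → ℕ} {M : Mem} (r : ℕ) (f : ℕ → ℕ)
    (hr : r < K.rows) (hp : K.par p ≤ K.wd)
    (h : ∀ i < K.par p, ∀ g : ℕ → ℕ, g i = M a r i →
      eR.eval K (Function.update ρ δ i) (setRow M a r g) = r ∧
      e.eval K (Function.update ρ δ i) (setRow M a r g) = f i) :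
    (loop p (set a eR (.var δ) e)).run K δ ρ M =
      setRow M a r fun v => if v < K.par p then f v else M a r v := by
  refine run_loop_induction
    (I := fun i M' => M' = setRow M a r fun v => if v < i then f v else M a r v) ?_ ?_
  · simp
  · rintro i hi M' rfl
    obtain ⟨h1, h2⟩ := h i hi (fun v => if v < i then f v else M a r v) (by simp)
    have hv : (Exp.var δ).eval K (Function.update ρ δ i)
        (setRow M a r fun v => if v < i then f v else M a r v) = i := by simp [Exp.eval]
    rw [run_set (by rw [h1]; exact hr) (by rw [hv]; omega), h1, h2, hv, setRow_setRow,
      setRow_self]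
    congr 1
    funext v
    simp only [Function.update_apply]
    split_ifs <;> first | omega | (subst_vars; rfl)

/-- A loop that writes to the entries `ix i` of one row, for all `i` with `cnd i ≠ 0`. -/
lemma run_loop_scatter {p a : ℕ} {eC eR eI e : Exp} {δ : ℕ} {ρ : ℕ → ℕ} {M : Mem} (r : ℕ)
    (cnd ix f : ℕ → ℕ) (hr : r < K.rows)
    (hix : ∀ i < K.par p, cnd i ≠ 0 → ix i < K.wd)
    (h : ∀ i < K.par p, ∀ g : ℕ → ℕ,
      eC.eval K (Function.update ρ δ i) (setRow M a r g) = cnd i ∧ (cnd i ≠ 0 →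
      eR.eval K (Function.update ρ δ i) (setRow M a r g) = r ∧
      eI.eval K (Function.update ρ δ i) (setRow M a r g) = ix i ∧
      e.eval K (Function.update ρ δ i) (setRow M a r g) = f i)) :
    ∃ g : ℕ → ℕ, (loop p (ite eC (set a eR eI e) skip)).run K δ ρ M = setRow M a r g ∧
      ∀ c, (g c = M a r c ∧ ∀ i < K.par p, cnd i ≠ 0 → ix i ≠ c) ∨
        ∃ i < K.par p, cnd i ≠ 0 ∧ ix i = c ∧ g c = f i := by
  refine run_loop_induction (I := fun j M' => ∃ g : ℕ → ℕ, M' = setRow M a r g ∧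
      ∀ c, (g c = M a r c ∧ ∀ i < j, cnd i ≠ 0 → ix i ≠ c) ∨
        ∃ i < j, cnd i ≠ 0 ∧ ix i = c ∧ g c = f i) ?_ ?_
  · exact ⟨M a r, by simp, fun c => .inl ⟨rfl, by simp⟩⟩
  · rintro j hj M' ⟨g, rfl, hg⟩
    obtain ⟨h1, h2⟩ := h j hj g
    rw [run_ite, h1]
    split_ifs with hc
    · refine ⟨g, rfl, fun c => ?_⟩
      rcases hg c with ⟨h3, h4⟩ | ⟨i, hi, h3⟩
      · refine .inl ⟨h3, fun i hi hci => ?_⟩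
        rcases Nat.lt_succ_iff_lt_or_eq.1 hi with h5 | rfl
        · exact h4 i h5 hci
        · exact absurd hc hci
      · exact .inr ⟨i, by omega, h3⟩
    · obtain ⟨h3, h4, h5⟩ := h2 hc
      refine ⟨Function.update g (ix j) (f j), ?_, fun c => ?_⟩
      · rw [run_set (by rw [h3]; exact hr) (by rw [h4]; exact hix j hj hc), h3, h4, h5,
          setRow_setRow, setRow_self]
      · by_cases hcx : c = ix j
        · exact .inr ⟨j, by omega, hc, hcx.symm, by rw [hcx, Function.update_self]⟩
        · rw [Function.update_of_ne hcx]
          rcases hg c with ⟨h6, h7⟩ | ⟨i, hi, h6⟩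
          · refine .inl ⟨h6, fun i hi hci => ?_⟩
            rcases Nat.lt_succ_iff_lt_or_eq.1 hi with h8 | rfl
            · exact h7 i h8 hci
            · exact fun hh => hcx hh.symm
          · exact .inr ⟨i, by omega, h6⟩

/-- The command does not write to array `a`. -/
def Keeps (a : ℕ) : Cmd → Prop
  | set b _ _ _ => b ≠ a
  | seq A B => Keeps a A ∧ Keeps a B
  | ite _ A B => Keeps a A ∧ Keeps a B
  | loop _ A => Keeps a A
  | skip => True

lemma run_of_keeps {a : ℕ} (A : Cmd) (h : A.Keeps a) (δ : ℕ) (ρ : ℕ → ℕ) (M : Mem) :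
    A.run K δ ρ M a = M a := by
  induction A generalizing δ ρ M with
  | set b r c e =>
    have h : b ≠ a := h
    simp only [run, write]
    split_ifs
    · funext r' c'
      simp [h.symm]
    · rfl
  | seq A B ihA ihB => rw [run_seq, ihB h.2, ihA h.1]
  | ite e A B ihA ihB =>
    rw [run_ite]
    split_ifs
    exacts [ihB h.2 _ _ _, ihA h.1 _ _ _]
  | loop p A ih =>
    refine run_loop_induction (I := fun _ M' => M' a = M a) rfl ?_
    intro i _ M' hM'
    rw [ih h, hM']
  | skip => rfl

end Cmd

/-! ### Derived expressions -/

namespace Exp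

/-- Conjunction. -/
def and (e f : Exp) : Exp := ite e f zero
/-- Negation. -/
def not (e : Exp) : Exp := ite e zero one
/-- Equality. -/
def eq (e f : Exp) : Exp := ite (sub e f) zero (ite (sub f e) zero one)
/-- The entry in row `0` and column `0` of array `a`. -/
def cell (a : ℕ) : Exp := get a zero zero

variable {K : Ctx} {ρ : ℕ → ℕ} {M : Mem}

@[simp] lemma eval_zero : zero.eval K ρ M = 0 := by rw [eval]
@[simp] lemma eval_one : one.eval K ρ M = 1 := by rw [eval]
@[simp] lemma eval_param (i : ℕ) : (param i).eval K ρ M = K.par i := by rw [eval]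
@[simp] lemma eval_var (j : ℕ) : (var j).eval K ρ M = ρ j := by rw [eval]
@[simp] lemma eval_get (a : ℕ) (r c : Exp) :
    (get a r c).eval K ρ M = M a (r.eval K ρ M) (c.eval K ρ M) := by rw [eval]
@[simp] lemma eval_inp (e : Exp) : (inp e).eval K ρ M = K.inp.getD (e.eval K ρ M) 0 := by rw [eval]
@[simp] lemma eval_sub (e f : Exp) :
    (sub e f).eval K ρ M = e.eval K ρ M - f.eval K ρ M := by rw [eval]
@[simp] lemma eval_ite (c e f : Exp) : (ite c e f).eval K ρ M =
    if c.eval K ρ M = 0 then f.eval K ρ M else e.eval K ρ M := by rw [eval]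
@[simp] lemma eval_cell (a : ℕ) : (cell a).eval K ρ M = M a 0 0 := by
  rw [cell, eval_get, eval_zero]

lemma eval_add {e f : Exp} (h : e.eval K ρ M + f.eval K ρ M ≤ K.lim) :
    (add e f).eval K ρ M = e.eval K ρ M + f.eval K ρ M := if_pos h

@[simp] lemma eval_and (e f : Exp) : (and e f).eval K ρ M =
    if e.eval K ρ M = 0 then 0 else f.eval K ρ M := by
  rw [and, eval_ite, eval_zero]

@[simp] lemma eval_not (e : Exp) : (not e).eval K ρ M =
    if e.eval K ρ M = 0 then 1 else 0 := by
  rw [not, eval_ite, eval_zero, eval_one]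

@[simp] lemma eval_eq (e f : Exp) : (eq e f).eval K ρ M =
    if e.eval K ρ M = f.eval K ρ M then 1 else 0 := by
  simp only [eq, eval_ite, eval_sub, eval_zero, eval_one]
  rcases lt_trichotomy (e.eval K ρ M) (f.eval K ρ M) with h | h | h
  · rw [if_pos (by omega), if_neg (by omega), if_neg (by omega)]
  · simp [h]
  · rw [if_neg (by omega), if_neg (by omega)]

end Exp

end RAM

namespace Search

open RAM RAM.Exp RAM.Cmd SimpleGraph

/-! ### The program

Parameters: `4` is the number of vertices, `5` is `t`, `6` is the length of all adjacency lists
together, `7` is a number of rounds, `8` is the number of steps of the main loop, `9` is the sum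
of `4` and `6`.

Row `d` of the arrays is for the level `d` of the recursion: `0` parents, `1` vertices that are
present, `2` leaders, `3` pointers, `4` marked vertices, `5` roots to be tried, `6` and `7` for
each leader the root that is being tried and the component where it fails, `10` number of roots
that were tried. The arrays `8` and `9` hold the edges. In single cells: `11` the level, `12`
whether to return from the level, `13` the answer. -/

/-- The current level. -/
def level : Exp := cell 11
/-- The next level. -/
def below : Exp := add level one
def parent (d v : Exp) : Exp := get 0 d v
def alive (d v : Exp) : Exp := get 1 d v
def leader (d v : Exp) : Exp := get 2 d v
def pointer (d v : Exp) : Exp := get 3 d v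
def mark (d v : Exp) : Exp := get 4 d v
def todo (d v : Exp) : Exp := get 5 d v
/-- The root that is being tried for the component of `v`. -/
def picked (d v : Exp) : Exp := get 6 d (leader d v)
/-- The component where that root fails. -/
def failed (d v : Exp) : Exp := get 7 d (leader d v)
/-- The vertex `v` is marked in that component. -/
def hit (v : Exp) : Exp :=
  and (alive below v) (and (mark below v) (eq (failed level v) (add (leader below v) one)))

/-- Propagate the label along the edge number `e`. -/
def relax (e : Exp) : Cmd :=
  .ite (and (alive level (get 8 zero e)) (and (alive level (get 9 zero e))
      (sub (leader level (get 9 zero e)) (leader level (get 8 zero e)))))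
    (.seq (.set 3 level (get 9 zero e) (get 8 zero e))
      (.set 2 level (get 9 zero e) (leader level (get 8 zero e)))) .skip

/-- Find the components of the current level. -/
def enter : Cmd :=
  .seq (.loop 4 (.set 2 level (var 1) (var 1))) <|
  .seq (.loop 4 (.set 3 level (var 1) (var 1))) <|
  .seq (.loop 7 (.loop 6 (relax (var 2)))) <|
  .seq (.loop 4 (.set 4 level (var 1) zero)) <|
  .seq (.loop 4 (.set 5 level (var 1) (and (alive level (var 1))
    (eq (leader level (var 1)) (var 1)))))
  (.set 10 level zero zero)

/-- Choose a root for each component, remove it, and go to the next level. -/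
def descend : Cmd :=
  .seq (.loop 4 (.set 6 level (var 1) zero)) <|
  .seq (.loop 4 (.ite (and (alive level (var 1)) (todo level (var 1)))
    (.set 6 level (leader level (var 1)) (add (var 1) one)) .skip)) <|
  .seq (.loop 4 (.set 1 below (var 1) (and (alive level (var 1))
    (not (eq (picked level (var 1)) (add (var 1) one)))))) <|
  .seq (.loop 4 (.set 5 level (var 1)
    (.ite (eq (picked level (var 1)) (add (var 1) one)) zero (todo level (var 1))))) <|
  .seq (.set 12 zero zero zero)
  (.set 11 zero zero below)

/-- Come back from the next level. -/
def ascend : Cmd :=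
  .seq (.set 11 zero zero (sub level one)) <|
  .seq (.loop 4 (.set 7 level (var 1) zero)) <|
  .seq (.loop 4 (.ite (and (alive below (var 1)) (mark below (var 1)))
    (.set 7 level (leader level (var 1)) (add (leader below (var 1)) one)) .skip)) <|
  .seq (.loop 4 (.set 0 level (var 1) (.ite (picked level (var 1))
    (.ite (failed level (var 1)) (parent level (var 1))
      (.ite (eq (picked level (var 1)) (add (var 1) one)) zero
        (.ite (parent below (var 1)) (parent below (var 1)) (picked level (var 1)))))
    (parent level (var 1))))) <|
  .seq (.loop 4 (.set 5 level (var 1) (.ite (picked level (var 1))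
    (.ite (failed level (var 1))
      (.ite (and (hit (var 1)) (not (get 10 level zero))) one (todo level (var 1))) zero)
    (todo level (var 1))))) <|
  .seq (.loop 4 (.set 4 level (var 1) (.ite (picked level (var 1))
    (.ite (failed level (var 1)) (.ite (hit (var 1)) one (mark level (var 1))) zero)
    (mark level (var 1)))))
  (.set 10 level zero (add (get 10 level zero) one))

/-- Add to the marked vertices all vertices to which pointers lead. -/
def finish : Cmd :=
  .seq (.loop 7 (.loop 4 (.ite (and (alive level (var 2)) (mark level (var 2)))
    (.set 4 level (pointer level (var 2)) one) .skip)))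
  (.set 12 zero zero one)

/-- On the last level, no component has a decomposition. -/
def leaf : Cmd :=
  .seq (.loop 4 (.set 4 level (var 1) (todo level (var 1))))
  (.set 12 zero zero one)

/-- One step of the search. -/
def step : Cmd :=
  .ite (cell 12)
    (.ite level (.seq ascend (.ite (sub (param 7) (get 10 level zero)) descend finish)) .skip)
    (.seq enter (.ite (sub (param 5) level) descend leaf))

/-- The parameters of the search. -/
structure Params (K : Ctx) (n t m X : ℕ) : Prop where
  par_four : K.par 4 = n
  par_five : K.par 5 = t
  par_six : K.par 6 = m
  par_seven : K.par 7 = X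
  rows : K.rows = t + 2
  n_lt : n < K.wd
  n_lt_lim : n < K.lim
  t_lt_lim : t < K.lim
  X_lt_lim : X < K.lim

/-- The arrays `8` and `9` hold the edges of the graph on `0, …, n - 1`. -/
structure Edges (G : SimpleGraph ℕ) (n m : ℕ) (M : Mem) : Prop where
  lt : ∀ u v, G.Adj u v → u < n
  adj : ∀ e < m, G.Adj (M 8 0 e) (M 9 0 e)
  exists_of_adj : ∀ u v, G.Adj u v → ∃ e < m, M 8 0 e = u ∧ M 9 0 e = v

end Search

namespace RAM

lemma setRow_of_ne (M : Mem) {a a' r r' : ℕ} (f : ℕ → ℕ) (h : a' ≠ a ∨ r' ≠ r) :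
    setRow M a r f a' r' = M a' r' := by
  rw [setRow_apply, if_neg]
  omega

end RAM

namespace Search

open RAM RAM.Exp RAM.Cmd SimpleGraph

variable {K : Ctx} {n t m X d : ℕ} {G : SimpleGraph ℕ} {U : Finset ℕ} {M : Mem}

/-! ### The effect of the parts of a step -/

lemma Edges.lt_right (h : Edges G n m M) {u v : ℕ} (huv : G.Adj u v) : v < n :=
  h.lt v u huv.symm

lemma Edges.congr {M' : Mem} (h : Edges G n m M) (h8 : M' 8 0 = M 8 0) (h9 : M' 9 0 = M 9 0) :
    Edges G n m M' :=
  ⟨h.lt, by rw [h8, h9]; exact h.adj, by rw [h8, h9]; exact h.exists_of_adj⟩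

lemma run_relax (hK : Params K n t m X) (hd : d ≤ t) (hM : M 11 0 0 = d) (hE : Edges G n m M)
    {ρ : ℕ → ℕ} {δ e : ℕ} (he : e < m) (hρ : ρ 2 = e) :
    (relax (var 2)).run K δ ρ M =
      if M 1 d (M 8 0 e) ≠ 0 ∧ M 1 d (M 9 0 e) ≠ 0 ∧ M 2 d (M 8 0 e) < M 2 d (M 9 0 e) then
        setRow (setRow M 3 d (Function.update (M 3 d) (M 9 0 e) (M 8 0 e))) 2 d
          (Function.update (M 2 d) (M 9 0 e) (M 2 d (M 8 0 e)))
      else M := by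
  have hr : d < K.rows := by rw [hK.rows]; omega
  have hw : M 9 0 e < K.wd := (hE.lt_right (hE.adj e he)).trans hK.n_lt
  unfold relax
  rw [run_ite]
  by_cases hc : M 1 d (M 8 0 e) ≠ 0 ∧ M 1 d (M 9 0 e) ≠ 0 ∧ M 2 d (M 8 0 e) < M 2 d (M 9 0 e)
  · rw [if_pos hc, if_neg, run_seq,
      run_set (a := 3) (M := M) (by simp [level, hM, hr]) (by simp [hρ, hw])]
    · rw [run_set (by simp [level, hM, hr, setRow_apply]) (by simp [hρ, hw, setRow_apply])]
      simp [level, hM, hρ, leader, setRow_apply]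
    · simp [alive, level, leader, hM, hρ, hc]
      omega
  · rw [if_neg hc, if_pos, run_skip]
    simp only [eval_and, alive, level, leader, eval_get, eval_cell, eval_zero, eval_var, hM, hρ,
      eval_sub]
    by_contra h
    apply hc
    split_ifs at h with h1 h2
    · exact absurd rfl h
    · exact absurd rfl h
    · exact ⟨h1, h2, by omega⟩

/-- After `j` rounds the label of `v` is at most every vertex that has a walk of length at most `j`
to `v`, as in the Bellman-Ford algorithm. At least `2 ^ t` rounds suffice because paths are short.
-/
lemma run_propagate (hK : Params K n t m X) (hd : d ≤ t) (hM : M 11 0 0 = d)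
    (hU : ∀ v, v ∈ U ↔ v < n ∧ M 1 d v ≠ 0) (hE : Edges G n m M)
    (htd : G.TdLe t (Finset.range n)) (hX : 2 ^ t ≤ X) (hL : ∀ v ∈ U, M 2 d v = v)
    (hP : ∀ v ∈ U, M 3 d v = v) (ρ : ℕ → ℕ) :
    ∃ L P, (Cmd.loop 7 (.loop 6 (relax (var 2)))).run K 1 ρ M = setRow (setRow M 2 d L) 3 d P ∧
      IsLeader G U L ∧ IsPointer G U (2 ^ t) L P := by
  have key : ∃ L P, (Cmd.loop 7 (.loop 6 (relax (var 2)))).run K 1 ρ M =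
      setRow (setRow M 2 d L) 3 d P ∧ Propagating G U L P ∧
      ∀ u v, u ∈ U → v ∈ U → (∃ p : (G.within U).Walk u v, p.length ≤ K.par 7) → L v ≤ u := by
    refine run_loop_induction (I := fun j M' => ∃ L P, M' = setRow (setRow M 2 d L) 3 d P ∧
      Propagating G U L P ∧ ∀ u v, u ∈ U → v ∈ U →
        (∃ p : (G.within U).Walk u v, p.length ≤ j) → L v ≤ u) ?_ ?_
    · refine ⟨M 2 d, M 3 d, by simp, .init hL hP, ?_⟩
      rintro u v hu hv ⟨p, hp⟩
      have := Walk.eq_of_length_eq_zero (Nat.le_zero.1 hp)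
      rw [← this, hL u hu]
    · rintro j - M' ⟨L, P, rfl, hLP, hj⟩
      -- Updates are made in place. Labels only decrease during a round, so comparing with the
      -- labels at its start loses nothing.
      have inner : ∃ L' P', (Cmd.loop 6 (relax (var 2))).run K (1 + 1) (Function.update ρ 1 j)
          (setRow (setRow M 2 d L) 3 d P) = setRow (setRow M 2 d L') 3 d P' ∧
          Propagating G U L' P' ∧ (∀ v ∈ U, L' v ≤ L v) ∧ ∀ e < K.par 6, M 8 0 e ∈ U →
            M 9 0 e ∈ U → L' (M 9 0 e) ≤ L (M 8 0 e) := by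
        refine run_loop_induction (I := fun i M' => ∃ L' P', M' = setRow (setRow M 2 d L') 3 d P' ∧
          Propagating G U L' P' ∧ (∀ v ∈ U, L' v ≤ L v) ∧ ∀ e < i, M 8 0 e ∈ U →
            M 9 0 e ∈ U → L' (M 9 0 e) ≤ L (M 8 0 e)) ?_ ?_
        · exact ⟨L, P, rfl, hLP, fun _ _ => le_rfl, by simp⟩
        · rintro i hi M' ⟨L', P', rfl, h1, h2, h3⟩
          rw [hK.par_six] at hi
          rw [run_relax (d := d) (e := i) hK hd (by simp [setRow_apply, hM])
            (hE.congr (by simp [setRow_apply]) (by simp [setRow_apply])) hi (by simp)]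
          have hadj := hE.adj i hi
          have hu := hE.lt _ _ hadj
          have hv := hE.lt_right hadj
          simp only [setRow_apply, Nat.reduceEqDiff, false_and, if_false, if_true, and_true]
          split_ifs with hc
          · have huU := (hU _).2 ⟨hu, hc.1⟩
            have hvU := (hU _).2 ⟨hv, hc.2.1⟩
            refine ⟨Function.update L' (M 9 0 i) (L' (M 8 0 i)),
              Function.update P' (M 9 0 i) (M 8 0 i), ?_, h1.relax huU hvU hadj hc.2.2, ?_, ?_⟩
            · funext a r
              simp only [setRow_apply]
              split_ifs <;> first | rfl | (exfalso; omega)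
            · intro v hv
              by_cases hvv : v = M 9 0 i
              · rw [hvv, Function.update_self]
                exact hc.2.2.le.trans (h2 _ hvU)
              · rw [Function.update_of_ne hvv]; exact h2 v hv
            · intro e he hu' hv'
              by_cases hvv : M 9 0 e = M 9 0 i
              · rw [hvv, Function.update_self]
                rcases Nat.lt_succ_iff_lt_or_eq.1 he with h4 | rfl
                · have := h3 e h4 hu' hv'
                  rw [hvv] at this
                  exact hc.2.2.le.trans this
                · exact h2 _ huU
              · rw [Function.update_of_ne hvv]
                rcases Nat.lt_succ_iff_lt_or_eq.1 he with h4 | rfl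
                · exact h3 e h4 hu' hv'
                · exact absurd rfl hvv
          · refine ⟨L', P', rfl, h1, h2, fun e he hu' hv' => ?_⟩
            rcases Nat.lt_succ_iff_lt_or_eq.1 he with h4 | rfl
            · exact h3 e h4 hu' hv'
            · have := h2 _ hu'
              by_contra hlt
              exact hc ⟨((hU _).1 hu').2, ((hU _).1 hv').2, by omega⟩
      obtain ⟨L', P', h1, h2, h3, h4⟩ := inner
      refine ⟨L', P', h1, h2, ?_⟩
      rintro u v hu hv ⟨p, hp⟩
      -- The last edge of the walk is split off: the shorter walk is covered by the earlier rounds,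
      -- the edge by the present one.
      cases hq : p.reverse with
      | nil =>
        exact (h3 u hu).trans (hj u u hu hu ⟨Walk.nil, by simp⟩)
      | @cons _ w _ hadj q =>
        have hlen : q.length + 1 = p.length := by
          rw [← Walk.length_reverse p, hq, Walk.length_cons]
        obtain ⟨e, he, he1, he2⟩ := hE.exists_of_adj w v hadj.2.2.symm
        have h5 := h4 e (by rw [hK.par_six]; exact he) (by rw [he1]; exact hadj.2.1)
          (by rw [he2]; exact hv)
        rw [he1, he2] at h5
        exact h5.trans (hj u w hu hadj.2.1 ⟨q.reverse, by rw [Walk.length_reverse]; omega⟩)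
  obtain ⟨L, P, h1, h2, h3⟩ := key
  refine ⟨L, P, h1, h2.final htd (fun v hv => Finset.mem_range.2 ((hU v).1 hv).1) ?_⟩
  rintro u v hu hv ⟨p, hp⟩
  exact h3 u v hu hv ⟨p, by rw [hK.par_seven]; omega⟩

/-- Any vertex serves as the first root of a component; the leaders are taken, since there is
exactly one of them in each component. Entries of absent vertices carry no information, so the
conclusions about labels are restricted to `U`. -/
lemma enter_spec (hK : Params K n t m X) (hd : d ≤ t) (hM : M 11 0 0 = d)
    (hU : ∀ v, v ∈ U ↔ v < n ∧ M 1 d v ≠ 0) (hE : Edges G n m M)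
    (htd : G.TdLe t (Finset.range n)) (hX : 2 ^ t ≤ X) (ρ : ℕ → ℕ) :
    ∃ M', enter.run K 1 ρ M = M' ∧ IsLeader G U (M' 2 d) ∧ IsPointer G U (2 ^ t) (M' 2 d) (M' 3 d) ∧
      (∀ v ∈ U, M' 4 d v = 0) ∧ (∀ v ∈ U, M' 5 d v ≠ 0 ↔ M' 2 d v = v) ∧ M' 10 d 0 = 0 ∧
      ∀ a r, (a ∉ [2, 3, 4, 5, 10] ∨ r ≠ d) → M' a r = M a r := by
  have hr : d < K.rows := by rw [hK.rows]; omega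
  have hn : K.par 4 ≤ K.wd := by rw [hK.par_four]; exact hK.n_lt.le
  have hwd : 0 < K.wd := (Nat.zero_le _).trans_lt hK.n_lt
  refine ⟨_, rfl, ?_⟩
  unfold enter
  rw [run_seq, run_loop_fill d (fun v => v) hr hn (by
    intro i _ g _
    simp [level, setRow_apply, hM])]
  rw [run_seq, run_loop_fill d (fun v => v) hr hn (by
    intro i _ g _
    simp [level, setRow_apply, hM])]
  rw [run_seq]
  obtain ⟨L, P, h1, h2, h3⟩ := run_propagate (U := U)
    (M := setRow (setRow M 2 d fun v => if v < K.par 4 then v else M 2 d v) 3 d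
      fun v => if v < K.par 4 then v else
        setRow M 2 d (fun v => if v < K.par 4 then v else M 2 d v) 3 d v) (d := d) hK hd
    (by simp [setRow_apply, hM]) (by simpa [setRow_apply] using hU)
    (hE.congr (by simp [setRow_apply]) (by simp [setRow_apply])) htd hX
    (by intro v hv; simp [setRow_apply, hK.par_four, ((hU v).1 hv).1])
    (by intro v hv; simp [setRow_apply, hK.par_four, ((hU v).1 hv).1]) ρ
  rw [h1, run_seq, run_loop_fill d (fun _ => 0) hr hn (by
    intro i _ g _
    simp [level, setRow_apply, hM])]
  rw [run_seq, run_loop_fill d (fun v => if M 1 d v = 0 then 0 else if L v = v then 1 else 0) hr hn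
    (by
      intro i _ g _
      simp [level, setRow_apply, hM, alive, leader])]
  rw [run_set (by simp [level, setRow_apply, hM, hr]) (by simp [hwd])]
  simp only [level, setRow_apply, hM, eval_cell, eval_zero, Nat.reduceEqDiff, false_and, if_false,
    true_and, if_true, and_self, Function.update_self]
  refine ⟨h2, h3, ?_, ?_, ?_⟩
  · intro v hv
    simp [hK.par_four, ((hU v).1 hv).1]
  · intro v hv
    simp [hK.par_four, ((hU v).1 hv).1, ((hU v).1 hv).2]
  · intro a r har
    simp only [List.mem_cons, List.not_mem_nil, or_false, not_or] at har
    split_ifs <;> first | rfl | (exfalso; omega)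

end Search

/-! ### Moving between the levels of the recursion -/

namespace Search

open RAM RAM.Exp RAM.Cmd SimpleGraph

variable {K : Ctx} {n t m X d : ℕ} {G : SimpleGraph ℕ} {U : Finset ℕ} {M : Mem}

/-- All candidates of a component write to the cell of its leader. The last one wins, and any winner
will do. Only roots that are really picked are deleted from the vertex set and from the candidates.
-/
lemma descend_spec (hK : Params K n t m X) (hd : d < t) (hM : M 11 0 0 = d)
    (hU : ∀ v, v ∈ U ↔ v < n ∧ M 1 d v ≠ 0) (hL : ∀ v ∈ U, M 2 d v < n) (ρ : ℕ → ℕ) :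
    ∃ M', descend.run K 1 ρ M = M' ∧
      (∀ c < n, (M' 6 d c = 0 ∧ ∀ v ∈ U, M 2 d v = c → M 5 d v = 0) ∨
        ∃ x ∈ U, M 2 d x = c ∧ M 5 d x ≠ 0 ∧ M' 6 d c = x + 1) ∧
      (∀ v < n, M' 1 (d + 1) v ≠ 0 ↔ M 1 d v ≠ 0 ∧ M' 6 d (M 2 d v) ≠ v + 1) ∧
      (∀ v < n, M' 5 d v = if M' 6 d (M 2 d v) = v + 1 then 0 else M 5 d v) ∧
      M' 11 0 0 = d + 1 ∧ M' 12 0 0 = 0 ∧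
      ∀ a r, a ≠ 11 → a ≠ 12 → (a ∉ [5, 6] ∨ r ≠ d) → (a ≠ 1 ∨ r ≠ d + 1) → M' a r = M a r := by
  have hr : d < K.rows := by rw [hK.rows]; omega
  have hr1 : d + 1 < K.rows := by rw [hK.rows]; omega
  have hr0 : 0 < K.rows := by omega
  have hn : K.par 4 ≤ K.wd := by rw [hK.par_four]; exact hK.n_lt.le
  have hwd : 0 < K.wd := (Nat.zero_le _).trans_lt hK.n_lt
  have hdl : d + 1 ≤ K.lim := by have := hK.t_lt_lim; omega
  have hvl : ∀ v < K.par 4, v + 1 ≤ K.lim := by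
    intro v hv; rw [hK.par_four] at hv; have := hK.n_lt_lim; omega
  refine ⟨_, rfl, ?_⟩
  unfold descend
  rw [run_seq, run_loop_fill d (fun _ => 0) hr hn (by
    intro i _ g _
    simp [level, setRow_apply, hM])]
  rw [run_seq]
  obtain ⟨g, hg, hg'⟩ := run_loop_scatter (K := K) (p := 4) (a := 6) (δ := 1) (ρ := ρ)
    (eC := and (alive level (var 1)) (todo level (var 1)))
    (eR := level) (eI := leader level (var 1)) (e := add (var 1) one)
    (M := setRow M 6 d fun v => if v < K.par 4 then 0 else M 6 d v) d
    (fun v => if M 1 d v = 0 then 0 else M 5 d v) (fun v => M 2 d v) (fun v => v + 1) hr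
    (by
      intro i hi hc
      rw [hK.par_four] at hi
      have : M 1 d i ≠ 0 := by
        intro h
        simp [h] at hc
      exact (hL i ((hU i).2 ⟨hi, this⟩)).trans hK.n_lt)
    (by
      intro i hi g
      simp [level, setRow_apply, hM, alive, todo, leader, Exp.eval_add, hvl i hi])
  rw [hg, run_seq, run_loop_fill (d + 1)
    (fun v => if M 1 d v = 0 then 0 else if g (M 2 d v) = v + 1 then 0 else 1) hr1 hn (by
      intro i hi g' _
      simp [level, below, setRow_apply, hM, alive, picked, leader, Exp.eval_add, hvl i hi, hdl])]
  rw [run_seq, run_loop_fill d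
    (fun v => if g (M 2 d v) = v + 1 then 0 else M 5 d v) hr hn (by
      intro i hi g' hgi
      simp only [setRow_apply] at hgi
      simp at hgi
      simp [level, setRow_apply, hM, picked, leader, todo, Exp.eval_add, hvl i hi, hgi])]
  rw [run_seq, run_set (a := 12) (by simp [hr0]) (by simp [hwd]),
    run_set (a := 11) (by simp [hr0]) (by simp [hwd])]
  simp only [level, below, setRow_apply, eval_zero, Nat.reduceEqDiff, false_and,
    if_false, true_and, if_true, and_self, Function.update_self, Nat.left_eq_add,
    one_ne_zero, Nat.add_eq_left, OfNat.ofNat_ne_one, OfNat.one_ne_ofNat]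
  refine ⟨?_, ?_, ?_, ?_, ?_⟩
  · intro c hc
    rcases hg' c with ⟨h1, h2⟩ | ⟨i, hi, h1, h2, h3⟩
    · refine .inl ⟨?_, fun v hv hvc => ?_⟩
      · rw [h1]; simp [hK.par_four, hc]
      · have hv' := (hU v).1 hv
        have := h2 v (by rw [hK.par_four]; exact hv'.1)
        simp only [hv'.2, if_false] at this
        by_contra h
        exact this h hvc
    · rw [hK.par_four] at hi
      have hi1 : M 1 d i ≠ 0 := by
        intro h
        simp [h] at h1
      simp only [hi1, if_false] at h1
      exact .inr ⟨i, (hU i).2 ⟨hi, hi1⟩, h2, h1, h3⟩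
  · intro v hv
    simp [hK.par_four, hv]
  · intro v hv
    simp [hK.par_four, hv]
  · simp [Exp.eval_add, setRow_apply, hM, hdl]
  · intro a r h11 h12 h1 h2
    simp only [List.mem_cons, List.not_mem_nil, or_false, not_or] at h1
    split_ifs <;> first | rfl | (exfalso; omega)

/-- The conclusions have the form of the hypotheses of `RoundInv.next`. Again all marked vertices of
failed parts compete for the cell of the leader, and the winner `sel` names one failed part.
Parents, candidates and marks are then updated from data of the next level. -/
lemma ascend_spec (hK : Params K n t m X) (hd : d < t) (hM : M 11 0 0 = d + 1) {U' : Finset ℕ}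
    (hU' : ∀ v, v ∈ U' ↔ v < n ∧ M 1 (d + 1) v ≠ 0) (hL : ∀ v ∈ U', M 2 d v < n)
    (hL' : ∀ v ∈ U', M 2 (d + 1) v < n) (hcnt : M 10 d 0 < K.lim) (ρ : ℕ → ℕ) :
    ∃ M', ascend.run K 1 ρ M = M' ∧ ∃ sel : ℕ → ℕ,
      (∀ c < n, (sel c = 0 ∧ ∀ v ∈ U', M 2 d v = c → M 4 (d + 1) v = 0) ∨
        ∃ x ∈ U', M 2 d x = c ∧ M 4 (d + 1) x ≠ 0 ∧ sel c = M 2 (d + 1) x + 1) ∧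
      (∀ v < n, M' 5 d v = if M 6 d (M 2 d v) = 0 then M 5 d v else
        if sel (M 2 d v) = 0 then 0 else
        if v ∈ U' ∧ M 4 (d + 1) v ≠ 0 ∧ sel (M 2 d v) = M 2 (d + 1) v + 1 ∧ M 10 d 0 = 0 then 1
        else M 5 d v) ∧
      (∀ v < n, M' 4 d v = if M 6 d (M 2 d v) = 0 then M 4 d v else
        if sel (M 2 d v) = 0 then 0 else
        if v ∈ U' ∧ M 4 (d + 1) v ≠ 0 ∧ sel (M 2 d v) = M 2 (d + 1) v + 1 then 1
        else M 4 d v) ∧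
      (∀ v < n, M' 0 d v = if M 6 d (M 2 d v) = 0 then M 0 d v else
        if sel (M 2 d v) = 0 then (if M 6 d (M 2 d v) = v + 1 then 0 else
          if M 0 (d + 1) v = 0 then M 6 d (M 2 d v) else M 0 (d + 1) v) else M 0 d v) ∧
      M' 10 d 0 = M 10 d 0 + 1 ∧ M' 11 0 0 = d ∧
      ∀ a r, a ≠ 11 → (a ∉ [0, 4, 5, 7, 10] ∨ r ≠ d) → M' a r = M a r := by
  have hr : d < K.rows := by rw [hK.rows]; omega
  have hr0 : 0 < K.rows := by omega
  have hn : K.par 4 ≤ K.wd := by rw [hK.par_four]; exact hK.n_lt.le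
  have hwd : 0 < K.wd := (Nat.zero_le _).trans_lt hK.n_lt
  have hdl : d + 1 ≤ K.lim := by have := hK.t_lt_lim; omega
  have hvl : ∀ v < K.par 4, v + 1 ≤ K.lim := by
    intro v hv; rw [hK.par_four] at hv; have := hK.n_lt_lim; omega
  have hll : ∀ v < K.par 4, M 1 (d + 1) v ≠ 0 → M 2 (d + 1) v + 1 ≤ K.lim := by
    intro v hv h
    rw [hK.par_four] at hv
    have := hL' v ((hU' v).2 ⟨hv, h⟩)
    have := hK.n_lt_lim; omega
  -- The memory after the level has been decreased; all later expressions refer to level `d`.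
  obtain ⟨M₀, hM₀⟩ : ∃ M₀, M₀ = setRow M 11 0 (Function.update (M 11 0) 0 d) := ⟨_, rfl⟩
  have hM0 : M₀ 11 0 0 = d := by simp [hM₀]
  have hM0' : ∀ a r, a ≠ 11 → M₀ a r = M a r := by
    intro a r ha
    rw [hM₀, setRow_of_ne _ _ (.inl ha)]
  refine ⟨_, rfl, ?_⟩
  unfold ascend
  rw [run_seq, run_set (a := 11) (by simp [hr0]) (by simp [hwd]),
    show setRow M 11 (zero.eval K ρ M) (Function.update (M 11 (zero.eval K ρ M))
      (zero.eval K ρ M) ((sub level one).eval K ρ M)) = M₀ by simp [hM₀, level, hM]]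
  rw [run_seq, run_loop_fill d (fun _ => 0) hr hn (by
    intro i _ g _
    simp [level, setRow_apply, hM0])]
  rw [run_seq]
  obtain ⟨g, hg, hg'⟩ := run_loop_scatter (K := K) (p := 4) (a := 7) (δ := 1) (ρ := ρ)
    (eC := and (alive below (var 1)) (mark below (var 1)))
    (eR := level) (eI := leader level (var 1)) (e := add (leader below (var 1)) one)
    (M := setRow M₀ 7 d fun v => if v < K.par 4 then 0 else M₀ 7 d v) d
    (fun v => if M 1 (d + 1) v = 0 then 0 else M 4 (d + 1) v) (fun v => M 2 d v)
    (fun v => M 2 (d + 1) v + 1) hr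
    (by
      intro i hi hc
      rw [hK.par_four] at hi
      have : M 1 (d + 1) i ≠ 0 := by
        intro h
        simp [h] at hc
      exact (hL i ((hU' i).2 ⟨hi, this⟩)).trans hK.n_lt)
    (by
      intro i hi g
      refine ⟨?_, fun hc => ?_⟩
      · simp [level, below, setRow_apply, hM0, hM0', alive, mark, Exp.eval_add, hdl]
      · have : M 1 (d + 1) i ≠ 0 := by
          intro h
          simp [h] at hc
        simp [level, below, setRow_apply, hM0, hM0', leader, Exp.eval_add, hdl, hll i hi this])
  have hhit : ∀ i < K.par 4, ∀ M' : Mem, M' 11 0 0 = d → M' 1 (d + 1) = M 1 (d + 1) →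
      M' 4 (d + 1) = M 4 (d + 1) → M' 2 (d + 1) = M 2 (d + 1) → M' 2 d = M 2 d → M' 7 d = g →
      ((hit (var 1)).eval K (Function.update ρ 1 i) M' = 0 ↔
        ¬(i ∈ U' ∧ M 4 (d + 1) i ≠ 0 ∧ g (M 2 d i) = M 2 (d + 1) i + 1)) := by
    intro i hi M' e1 e2 e3 e4 e5 e6
    have hin : i < n := by rw [← hK.par_four]; exact hi
    -- A vertex that is absent below may have a label there whose successor exceeds the limit, so
    -- this case is settled by the first factor of the conjunction alone.
    by_cases h1 : M 1 (d + 1) i = 0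
    · simp [hit, alive, below, level, e1, e2, Exp.eval_add, hdl, h1, hU']
    · have := hll i hi h1
      simp [hit, alive, below, level, mark, failed, leader, e1, e2, e3, e4, e5, e6, Exp.eval_add,
        hdl, h1, hU', hin, this]
  have htodo : ∀ i < K.par 4, ∀ M' : Mem, M' 11 0 0 = d → M' 1 (d + 1) = M 1 (d + 1) →
      M' 4 (d + 1) = M 4 (d + 1) → M' 2 (d + 1) = M 2 (d + 1) → M' 2 d = M 2 d → M' 7 d = g →
      M' 6 d = M 6 d → M' 10 d = M 10 d → M' 5 d i = M 5 d i →
      (Exp.ite (picked level (var 1)) (.ite (failed level (var 1))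
        (.ite (and (hit (var 1)) (not (get 10 level zero))) one (todo level (var 1))) zero)
        (todo level (var 1))).eval K (Function.update ρ 1 i) M' =
      if M 6 d (M 2 d i) = 0 then M 5 d i else if g (M 2 d i) = 0 then 0 else
        if i ∈ U' ∧ M 4 (d + 1) i ≠ 0 ∧ g (M 2 d i) = M 2 (d + 1) i + 1 ∧ M 10 d 0 = 0 then 1
        else M 5 d i := by
    intro i hi M' e1 e2 e3 e4 e5 e6 e7 e8 e9
    have hh := hhit i hi M' e1 e2 e3 e4 e5 e6
    simp only [picked, level, leader, failed, todo, eval_get, eval_cell, eval_var, eval_not,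
      eval_and, eval_ite, eval_zero, eval_one, Function.update_self, e1, e5, e6, e7, e8, e9, hh]
    by_cases h : i ∈ U' ∧ M 4 (d + 1) i ≠ 0 ∧ g (M 2 d i) = M 2 (d + 1) i + 1
    · by_cases hc : M 10 d 0 = 0 <;> simp [h, hc]
    · have : ¬(i ∈ U' ∧ M 4 (d + 1) i ≠ 0 ∧ g (M 2 d i) = M 2 (d + 1) i + 1 ∧ M 10 d 0 = 0) :=
        fun h' => h ⟨h'.1, h'.2.1, h'.2.2.1⟩
      simp only [h, this, not_false_eq_true, if_true, if_false]
  have hmark : ∀ i < K.par 4, ∀ M' : Mem, M' 11 0 0 = d → M' 1 (d + 1) = M 1 (d + 1) →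
      M' 4 (d + 1) = M 4 (d + 1) → M' 2 (d + 1) = M 2 (d + 1) → M' 2 d = M 2 d → M' 7 d = g →
      M' 6 d = M 6 d → M' 4 d i = M 4 d i →
      (Exp.ite (picked level (var 1)) (.ite (failed level (var 1))
        (.ite (hit (var 1)) one (mark level (var 1))) zero)
        (mark level (var 1))).eval K (Function.update ρ 1 i) M' =
      if M 6 d (M 2 d i) = 0 then M 4 d i else if g (M 2 d i) = 0 then 0 else
        if i ∈ U' ∧ M 4 (d + 1) i ≠ 0 ∧ g (M 2 d i) = M 2 (d + 1) i + 1 then 1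
        else M 4 d i := by
    intro i hi M' e1 e2 e3 e4 e5 e6 e7 e8
    have hh := hhit i hi M' e1 e2 e3 e4 e5 e6
    simp only [picked, level, leader, failed, mark, eval_get, eval_cell, eval_var,
      eval_ite, eval_zero, eval_one, Function.update_self, e1, e5, e6, e7, e8, hh]
    by_cases h : i ∈ U' ∧ M 4 (d + 1) i ≠ 0 ∧ g (M 2 d i) = M 2 (d + 1) i + 1
    · simp [h]
    · simp only [h, not_false_eq_true, if_true, if_false]
  rw [hg, run_seq, run_loop_fill d
    (fun v => if M 6 d (M 2 d v) = 0 then M 0 d v else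
        if g (M 2 d v) = 0 then (if M 6 d (M 2 d v) = v + 1 then 0 else
          if M 0 (d + 1) v = 0 then M 6 d (M 2 d v) else M 0 (d + 1) v) else M 0 d v) hr hn (by
      intro i hi g' hgi
      simp [setRow_apply, hM0'] at hgi
      simp [level, below, setRow_apply, hM0, hM0', parent, picked, failed, leader, Exp.eval_add,
        hvl i hi, hdl, hgi])]
  rw [run_seq, run_loop_fill d
    (fun v => if M 6 d (M 2 d v) = 0 then M 5 d v else
        if g (M 2 d v) = 0 then 0 else
        if v ∈ U' ∧ M 4 (d + 1) v ≠ 0 ∧ g (M 2 d v) = M 2 (d + 1) v + 1 ∧ M 10 d 0 = 0 then 1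
        else M 5 d v) hr hn (by
      intro i hi g' hgi
      simp [setRow_apply, hM0'] at hgi
      refine ⟨by simp [level, setRow_apply, hM0], htodo i hi _ ?_ ?_ ?_ ?_ ?_ ?_ ?_ ?_ ?_⟩ <;>
        simp [setRow_apply, hM0, hM0', hgi])]
  rw [run_seq, run_loop_fill d
    (fun v => if M 6 d (M 2 d v) = 0 then M 4 d v else
        if g (M 2 d v) = 0 then 0 else
        if v ∈ U' ∧ M 4 (d + 1) v ≠ 0 ∧ g (M 2 d v) = M 2 (d + 1) v + 1 then 1
        else M 4 d v) hr hn (by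
      intro i hi g' hgi
      simp [setRow_apply, hM0'] at hgi
      refine ⟨by simp [level, setRow_apply, hM0], hmark i hi _ ?_ ?_ ?_ ?_ ?_ ?_ ?_ ?_⟩ <;>
        simp [setRow_apply, hM0, hM0', hgi])]
  rw [run_set (by simp [level, setRow_apply, hM0, hr]) (by simp [hwd])]
  refine ⟨g, ?_, ?_, ?_, ?_, ?_, ?_, ?_⟩
  · intro c hc
    rcases hg' c with ⟨h1, h2⟩ | ⟨i, hi, h1, h2, h3⟩
    · refine .inl ⟨?_, fun v hv hvc => ?_⟩
      · rw [h1]; simp [hK.par_four, hc]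
      · have hv' := (hU' v).1 hv
        have := h2 v (by rw [hK.par_four]; exact hv'.1)
        simp only [hv'.2, if_false] at this
        by_contra h
        exact this h hvc
    · rw [hK.par_four] at hi
      have hi1 : M 1 (d + 1) i ≠ 0 := by
        intro h
        simp [h] at h1
      simp only [hi1, if_false] at h1
      exact .inr ⟨i, (hU' i).2 ⟨hi, hi1⟩, h2, h1, h3⟩
  · intro v hv
    simp [level, setRow_apply, hM0, hK.par_four, hv]
  · intro v hv
    simp [level, setRow_apply, hM0, hK.par_four, hv]
  · intro v hv
    simp [level, setRow_apply, hM0, hK.par_four, hv]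
  · have : M 10 d 0 + 1 ≤ K.lim := hcnt
    simp [level, setRow_apply, hM0, hM0', Exp.eval_add, this]
  · simp [level, setRow_apply, hM0]
  · intro a r h11 h1
    simp only [List.mem_cons, List.not_mem_nil, or_false, not_or] at h1
    simp only [level, setRow_apply, eval_cell, hM0, Nat.reduceEqDiff, false_and, if_false]
    split_ifs <;> first | exact hM0' _ _ h11 | (exfalso; omega)

/-- Marks never leave the orbits of marked vertices, and each round carries them at least one
pointer further. Orbits are exhausted before `2 ^ t` steps. -/
lemma finish_spec (hK : Params K n t m X) (hd : d ≤ t) (hM : M 11 0 0 = d)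
    (hU : ∀ v, v ∈ U ↔ v < n ∧ M 1 d v ≠ 0) (hP : IsPointer G U (2 ^ t) (M 2 d) (M 3 d))
    (hX : 2 ^ t ≤ X) (ρ : ℕ → ℕ) :
    ∃ M', finish.run K 1 ρ M = M' ∧
      (∀ v ∈ U, M' 4 d v ≠ 0 ↔ ∃ u ∈ U, M 4 d u ≠ 0 ∧ ∃ i, (M 3 d)^[i] u = v) ∧
      M' 12 0 0 = 1 ∧ ∀ a r, a ≠ 12 → (a ≠ 4 ∨ r ≠ d) → M' a r = M a r := by
  have hr : d < K.rows := by rw [hK.rows]; omega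
  have hr0 : 0 < K.rows := by omega
  have hwd : 0 < K.wd := (Nat.zero_le _).trans_lt hK.n_lt
  have hPlt : ∀ v ∈ U, M 3 d v < K.wd := fun v hv =>
    ((hU _).1 (hP.mem v hv)).1.trans hK.n_lt
  have key : ∃ g, (Cmd.loop 7 (.loop 4 (.ite (and (alive level (var 2)) (mark level (var 2)))
      (.set 4 level (pointer level (var 2)) one) .skip))).run K 1 ρ M = setRow M 4 d g ∧
      (∀ v ∈ U, g v ≠ 0 → ∃ u ∈ U, M 4 d u ≠ 0 ∧ ∃ i, (M 3 d)^[i] u = v) ∧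
      ∀ u ∈ U, M 4 d u ≠ 0 → ∀ i ≤ K.par 7, g ((M 3 d)^[i] u) ≠ 0 := by
    refine run_loop_induction (I := fun j M' => ∃ g, M' = setRow M 4 d g ∧
      (∀ v ∈ U, g v ≠ 0 → ∃ u ∈ U, M 4 d u ≠ 0 ∧ ∃ i, (M 3 d)^[i] u = v) ∧
      ∀ u ∈ U, M 4 d u ≠ 0 → ∀ i ≤ j, g ((M 3 d)^[i] u) ≠ 0) ?_ ?_
    · refine ⟨M 4 d, by simp, fun v hv h => ⟨v, hv, h, 0, rfl⟩, fun u hu h i hi => ?_⟩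
      rw [Nat.le_zero.1 hi]
      exact h
    · rintro j - M' ⟨g, rfl, hg1, hg2⟩
      -- Marks that are set during a round may travel several steps in it; this does no harm, as
      -- only a lower bound on the progress is needed.
      obtain ⟨g', hg', h1, h2, h3⟩ : ∃ g', (Cmd.loop 4 (.ite (and (alive level (var 2))
          (mark level (var 2))) (.set 4 level (pointer level (var 2)) one) .skip)).run K (1 + 1)
            (Function.update ρ 1 j) (setRow M 4 d g) = setRow M 4 d g' ∧
          (∀ v ∈ U, g' v ≠ 0 → ∃ u ∈ U, M 4 d u ≠ 0 ∧ ∃ i, (M 3 d)^[i] u = v) ∧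
          (∀ v, g v ≠ 0 → g' v ≠ 0) ∧ ∀ v < K.par 4, v ∈ U → g v ≠ 0 → g' (M 3 d v) ≠ 0 := by
        refine run_loop_induction (I := fun i M' => ∃ g', M' = setRow M 4 d g' ∧
          (∀ v ∈ U, g' v ≠ 0 → ∃ u ∈ U, M 4 d u ≠ 0 ∧ ∃ i, (M 3 d)^[i] u = v) ∧
          (∀ v, g v ≠ 0 → g' v ≠ 0) ∧ ∀ v < i, v ∈ U → g v ≠ 0 → g' (M 3 d v) ≠ 0) ?_ ?_
        · exact ⟨g, rfl, hg1, fun _ h => h, by simp⟩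
        · rintro i hi M' ⟨g', rfl, h1, h2, h3⟩
          rw [hK.par_four] at hi
          rw [run_ite]
          have hev : (and (alive level (var 2)) (mark level (var 2))).eval K
              (Function.update (Function.update ρ 1 j) (1 + 1) i) (setRow M 4 d g') =
              if M 1 d i = 0 then 0 else g' i := by
            simp [alive, mark, level, setRow_apply, hM]
          rw [hev]
          by_cases hc : M 1 d i ≠ 0 ∧ g' i ≠ 0
          · have hiU := (hU i).2 ⟨hi, hc.1⟩
            rw [if_neg (by simp [hc]), run_set (by simp [level, setRow_apply, hM, hr])
              (by simp [pointer, level, setRow_apply, hM, hPlt i hiU])]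
            refine ⟨Function.update g' (M 3 d i) 1, ?_, fun v hv hgv => ?_, fun v hgv => ?_,
              fun v hv hvU hgv => ?_⟩
            · simp [pointer, level, setRow_apply, hM]
            · by_cases hvi : v = M 3 d i
              · obtain ⟨u, hu, hu', l, hl⟩ := h1 i hiU hc.2
                exact ⟨u, hu, hu', l + 1, by rw [Function.iterate_succ_apply', hl, hvi]⟩
              · rw [Function.update_of_ne hvi] at hgv
                exact h1 v hv hgv
            · by_cases hvi : v = M 3 d i
              · rw [hvi, Function.update_self]; exact one_ne_zero
              · rw [Function.update_of_ne hvi]; exact h2 v hgv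
            · by_cases hvi : M 3 d v = M 3 d i
              · rw [hvi, Function.update_self]; exact one_ne_zero
              · rw [Function.update_of_ne hvi]
                rcases Nat.lt_succ_iff_lt_or_eq.1 hv with h4 | rfl
                · exact h3 v h4 hvU hgv
                · exact absurd rfl hvi
          · have hc0 : (if M 1 d i = 0 then 0 else g' i) = 0 := by
              split_ifs with h5
              · rfl
              · by_contra h
                exact hc ⟨h5, h⟩
            rw [if_pos hc0, run_skip]
            refine ⟨g', rfl, h1, h2, fun v hv hvU hgv => ?_⟩
            rcases Nat.lt_succ_iff_lt_or_eq.1 hv with h4 | rfl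
            · exact h3 v h4 hvU hgv
            · exact absurd ⟨((hU v).1 hvU).2, h2 v hgv⟩ hc
      refine ⟨g', hg', h1, fun u hu hu' i hi => ?_⟩
      rcases Nat.le_succ_iff.1 hi with h4 | rfl
      · exact h2 _ (hg2 u hu hu' i h4)
      · have hm := hP.iterate_mem j hu
        rw [Function.iterate_succ_apply']
        exact h3 _ (by rw [hK.par_four]; exact ((hU _).1 hm).1) hm (hg2 u hu hu' j le_rfl)
  obtain ⟨g, hg, hg1, hg2⟩ := key
  refine ⟨_, rfl, ?_⟩
  unfold finish
  rw [run_seq, hg, run_set (by simp [hr0]) (by simp [hwd])]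
  refine ⟨?_, ?_, ?_⟩
  · intro v hv
    have : (setRow (setRow M 4 d g) 12 (zero.eval K ρ (setRow M 4 d g))
        (Function.update (setRow M 4 d g 12 (zero.eval K ρ (setRow M 4 d g)))
          (zero.eval K ρ (setRow M 4 d g)) (one.eval K ρ (setRow M 4 d g)))) 4 d = g := by
      simp [setRow_apply]
    rw [this]
    refine ⟨hg1 v hv, ?_⟩
    rintro ⟨u, hu, hu', i, rfl⟩
    obtain ⟨l, hl, hl'⟩ := hP.exists_lt_iterate_eq hu i
    rw [← hl']
    exact hg2 u hu hu' l (by rw [hK.par_seven]; omega)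
  · simp [setRow_apply]
  · intro a r h12 h4
    simp only [eval_zero, setRow_apply]
    split_ifs <;> first | rfl | (exfalso; omega)

lemma leaf_spec (hK : Params K n t m X) (hd : d ≤ t) (hM : M 11 0 0 = d) (ρ : ℕ → ℕ) :
    ∃ M', leaf.run K 1 ρ M = M' ∧ (∀ v < n, M' 4 d v = M 5 d v) ∧
      M' 12 0 0 = 1 ∧ ∀ a r, a ≠ 12 → (a ≠ 4 ∨ r ≠ d) → M' a r = M a r := by
  have hr : d < K.rows := by rw [hK.rows]; omega
  have hr0 : 0 < K.rows := by omega
  have hn : K.par 4 ≤ K.wd := by rw [hK.par_four]; exact hK.n_lt.le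
  have hwd : 0 < K.wd := (Nat.zero_le _).trans_lt hK.n_lt
  refine ⟨_, rfl, ?_⟩
  unfold leaf
  rw [run_seq, run_loop_fill d (fun v => M 5 d v) hr hn (by
    intro i _ g _
    simp [level, todo, setRow_apply, hM]), run_set (by simp [hr0]) (by simp [hwd])]
  refine ⟨?_, ?_, ?_⟩
  · intro v hv
    simp [setRow_apply, hK.par_four, hv]
  · simp [setRow_apply]
  · intro a r h12 h4
    simp only [eval_zero, setRow_apply]
    split_ifs <;> first | rfl | (exfalso; omega)

end Search

namespace Search

open RAM RAM.Exp RAM.Cmd SimpleGraph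

variable {K : Ctx} {n t m X : ℕ} {G : SimpleGraph ℕ}

/-! ### Correctness of the search -/

/-- The bound for the number of marked vertices of a component. -/
def markBound (t : ℕ) : ℕ → ℕ
  | 0 => 1
  | k + 1 => 2 ^ t * (markBound t k + markBound t k * markBound t k)

/-- The number of steps that the search spends on a level. -/
def duration (X : ℕ) : ℕ → ℕ
  | 0 => 1
  | k + 1 => 1 + X * (duration X k + 1)

/-- The part of the memory that does not change while the search is on level `d` or below. -/
def Untouched (d : ℕ) (M M' : Mem) : Prop :=
  ∀ a r, a ≠ 11 → a ≠ 12 → (r < d ∨ a = 8 ∨ a = 9 ∨ (a = 1 ∧ r = d)) → M' a r = M a r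

lemma Untouched.trans {d : ℕ} {M M' M'' : Mem} (h : Untouched d M M') (h' : Untouched d M' M'') :
    Untouched d M M'' :=
  fun a r h1 h2 h3 => (h' a r h1 h2 h3).trans (h a r h1 h2 h3)

/-- The state on level `d` after `j` rounds. -/
structure AtRound (G : SimpleGraph ℕ) (n t m d k : ℕ) (U : Finset ℕ) (M₀ : Mem) (j : ℕ)
    (M : Mem) : Prop where
  level : M 11 0 0 = d
  count : M 10 d 0 = j
  alive : ∀ v, v ∈ U ↔ v < n ∧ M 1 d v ≠ 0
  leader : IsLeader G U (M 2 d)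
  pointer : IsPointer G U (2 ^ t) (M 2 d) (M 3 d)
  inv : ∀ c ∈ U, M 2 d c = c →
    RoundInv G (comp U (M 2 d) c) c k (markBound t k) j (M 5 d) (M 4 d) (M 0 d)
  edges : Edges G n m M
  untouched : Untouched d M₀ M

lemma atRound_zero (hK : Params K n t m X) {d k : ℕ} (hd : d ≤ t) {M : Mem} {U : Finset ℕ}
    (hM : M 11 0 0 = d) (hU : ∀ v, v ∈ U ↔ v < n ∧ M 1 d v ≠ 0) (hE : Edges G n m M)
    (htd : G.TdLe t (Finset.range n)) (hX : 2 ^ t ≤ X) (ρ : ℕ → ℕ) :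
    AtRound G n t m d k U M 0 (enter.run K 1 ρ M) ∧
      ∀ v ∈ U, (enter.run K 1 ρ M) 5 d v ≠ 0 ↔ (enter.run K 1 ρ M) 2 d v = v := by
  obtain ⟨M', hM', h1, h2, h3, h4, h5, h6⟩ := enter_spec (U := U) hK hd hM hU hE htd hX ρ
  rw [hM']
  refine ⟨⟨?_, h5, ?_, h1, h2, ?_,
    hE.congr (h6 _ _ (.inl (by simp))) (h6 _ _ (.inl (by simp))), ?_⟩, h4⟩
  · rw [h6 _ _ (.inl (by simp)), hM]
  · rw [h6 _ _ (.inl (by simp))]; exact hU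
  · intro c hc hcc
    refine .inr (.inl ⟨rfl, ?_, ?_⟩)
    · ext v
      rw [mem_flagged, mem_comp, Finset.mem_singleton]
      constructor
      · rintro ⟨⟨hv, hvc⟩, hv5⟩
        rw [← (h4 v hv).1 hv5, hvc]
      · rintro rfl
        exact ⟨⟨hc, hcc⟩, (h4 v hc).2 hcc⟩
    · refine Finset.eq_empty_of_forall_notMem fun v hv => ?_
      rw [mem_flagged, mem_comp] at hv
      exact hv.2 (h3 v hv.1.1)
  · intro a r _ _ har
    refine h6 a r ?_
    simp only [List.mem_cons, List.not_mem_nil, or_false, not_or]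
    omega

/-- What the search has achieved when it returns from level `d`. -/
structure Returned (G : SimpleGraph ℕ) (t d k : ℕ) (U : Finset ℕ) (M₀ M : Mem) : Prop where
  level : M 11 0 0 = d
  mode : M 12 0 0 = 1
  solved : Solved G U k (markBound t k) (M 2 d) (M 4 d) (M 0 d)
  untouched : Untouched d M₀ M

/-- The lower levels work in their own rows, so the data of level `d` are still those left by
`descend` when the search returns, and `RoundInv.next` applies to each component. -/
lemma AtRound.next (hK : Params K n t m X) {d k j : ℕ} (hd : d < t) {M₀ M M₂ : Mem}
    {U U' : Finset ℕ} (h : AtRound G n t m d k U M₀ j M) (hj : j < X) (ρ ρ' : ℕ → ℕ)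
    (hU' : ∀ v, v ∈ U' ↔ v < n ∧ (descend.run K 1 ρ M) 1 (d + 1) v ≠ 0)
    (h₂ : Returned G t (d + 1) k U' (descend.run K 1 ρ M) M₂) :
    AtRound G n t m d k U M₀ (j + 1) (ascend.run K 1 ρ' M₂) := by
  have hLn : ∀ v ∈ U, M 2 d v < n := fun v hv => ((h.alive _).1 (h.leader.mem hv)).1
  obtain ⟨M₁, hM₁, p1, p2, p3, p4, p5, p6⟩ := descend_spec (U := U) hK hd h.level h.alive hLn ρ
  rw [hM₁] at hU' h₂
  have e2 : M₂ 2 d = M 2 d := by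
    rw [h₂.untouched 2 d (by omega) (by omega) (by omega),
      p6 2 d (by omega) (by omega) (.inl (by simp)) (by omega)]
  have e3 : M₂ 3 d = M 3 d := by
    rw [h₂.untouched 3 d (by omega) (by omega) (by omega),
      p6 3 d (by omega) (by omega) (.inl (by simp)) (by omega)]
  have e4 : M₂ 4 d = M 4 d := by
    rw [h₂.untouched 4 d (by omega) (by omega) (by omega),
      p6 4 d (by omega) (by omega) (.inl (by simp)) (by omega)]
  have e0 : M₂ 0 d = M 0 d := by
    rw [h₂.untouched 0 d (by omega) (by omega) (by omega),
      p6 0 d (by omega) (by omega) (.inl (by simp)) (by omega)]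
  have e10 : M₂ 10 d = M 10 d := by
    rw [h₂.untouched 10 d (by omega) (by omega) (by omega),
      p6 10 d (by omega) (by omega) (.inl (by simp)) (by omega)]
  have e5 : M₂ 5 d = M₁ 5 d := h₂.untouched 5 d (by omega) (by omega) (by omega)
  have e6 : M₂ 6 d = M₁ 6 d := h₂.untouched 6 d (by omega) (by omega) (by omega)
  have e1 : M₂ 1 d = M 1 d := by
    rw [h₂.untouched 1 d (by omega) (by omega) (by omega),
      p6 1 d (by omega) (by omega) (.inl (by simp)) (by omega)]
  have e1' : M₂ 1 (d + 1) = M₁ 1 (d + 1) := h₂.untouched 1 (d + 1) (by omega) (by omega) (by omega)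
  have hUU' : ∀ v, v ∈ U' ↔ v ∈ U ∧ M₁ 6 d (M 2 d v) ≠ v + 1 := by
    intro v
    rw [hU', h.alive]
    constructor
    · rintro ⟨h1, h2⟩
      have := (p2 v h1).1 h2
      exact ⟨⟨h1, this.1⟩, this.2⟩
    · rintro ⟨⟨h1, h2⟩, h3⟩
      exact ⟨h1, (p2 v h1).2 ⟨h2, h3⟩⟩
  obtain ⟨M₃, hM₃, sel, q1, q2, q3, q4, q5, q6, q7⟩ := ascend_spec (M := M₂) (U' := U') hK hd
    h₂.level (by rw [e1']; exact hU') (by rw [e2]; exact fun v hv => hLn v ((hUU' v).1 hv).1)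
    (fun v hv => ((hU' _).1 (h₂.solved.leader.mem hv)).1)
    (by rw [e10, h.count]; exact hj.trans hK.X_lt_lim) ρ'
  rw [hM₃]
  have hrow : ∀ a, a ≠ 11 → a ∉ [0, 4, 5, 7, 10] → ∀ r, M₃ a r = M₂ a r :=
    fun a h1 h2 r => q7 a r h1 (.inl h2)
  have f2 : M₃ 2 d = M 2 d := by rw [hrow 2 (by omega) (by simp), e2]
  have f3 : M₃ 3 d = M 3 d := by rw [hrow 3 (by omega) (by simp), e3]
  have f1 : M₃ 1 d = M 1 d := by rw [hrow 1 (by omega) (by simp), e1]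
  have hunt : Untouched d M M₃ := by
    intro a r h11 h12 har
    rw [q7 a r h11 (by
      simp only [List.mem_cons, List.not_mem_nil, or_false, not_or]; omega),
      h₂.untouched a r h11 h12 (by omega), p6 a r h11 h12 (by
        simp only [List.mem_cons, List.not_mem_nil, or_false, not_or]; omega) (by omega)]
  refine ⟨q6, by rw [q5, e10, h.count], by rw [f1]; exact h.alive, by rw [f2]; exact h.leader,
    by rw [f2, f3]; exact h.pointer, ?_,
    h.edges.congr (hunt 8 0 (by omega) (by omega) (by omega))
      (hunt 9 0 (by omega) (by omega) (by omega)), h.untouched.trans hunt⟩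
  rw [f2]
  rw [e2] at q1 q2 q3 q4
  rw [e6] at q2 q3 q4
  rw [e5, e10] at q2
  rw [e4] at q3
  rw [e0] at q4
  intro c hc hcc
  have hcn := ((h.alive c).1 hc).1
  refine RoundInv.next (U' := U') (pick := M₁ 6 d) (sel := sel) (L' := M₂ 2 (d + 1))
    (acc' := M₂ 4 (d + 1)) (par' := M₂ 0 (d + 1)) h.leader (h.inv c hc hcc) (p1 c hcn)
    hUU' h₂.solved (q1 c hcn) ?_ ?_ ?_
  · intro v hv hvc
    have hvn := ((h.alive v).1 hv).1
    rw [q2 v hvn, p3 v hvn, hvc, h.count]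
    by_cases hp : M₁ 6 d c = 0
    · simp [hp]
    · simp only [hp, if_false]
  · intro v hv hvc
    rw [q3 v ((h.alive v).1 hv).1, hvc]
  · intro v hv hvc
    rw [q4 v ((h.alive v).1 hv).1, hvc]

/-- The search spends `duration X k` steps on a level, and then has solved it. -/
theorem returned_of_enter (hK : Params K n t m X) (htd : G.TdLe t (Finset.range n))
    (hX : 2 ^ t ≤ X) (hb : ∀ k < t, markBound t k + 1 ≤ X) (s : ℕ → Mem)
    (hs : ∀ i, ∃ ρ, s (i + 1) = step.run K 1 ρ (s i)) (k d i : ℕ) (U : Finset ℕ)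
    (hd : d + k = t) (hE : Edges G n m (s i)) (hlev : s i 11 0 0 = d) (hmode : s i 12 0 0 = 0)
    (hU : ∀ v, v ∈ U ↔ v < n ∧ s i 1 d v ≠ 0) :
    Returned G t d k U (s i) (s (i + duration X k)) := by
  induction k generalizing d i U with
  | zero =>
    obtain ⟨ρ, hρ⟩ := hs i
    obtain ⟨h1, h1'⟩ := atRound_zero (k := 0) hK (by omega) hlev hU hE htd hX ρ
    have hstep : s (i + duration X 0) = leaf.run K 1 ρ (enter.run K 1 ρ (s i)) := by
      rw [duration, hρ, step, run_ite, if_pos (by simp [hmode]), run_seq, run_ite, if_pos]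
      simp only [eval_sub, eval_param, Search.level, eval_cell, h1.level, hK.par_five]
      omega
    obtain ⟨M', hM', h2, h3, h4⟩ := leaf_spec (d := d) hK (by omega) h1.level ρ
    have f2 := h4 2 d (by omega) (by omega)
    rw [hstep, hM']
    refine ⟨?_, h3, ⟨by rw [f2]; exact h1.leader, ?_⟩, ?_⟩
    · rw [h4 11 0 (by omega) (by omega), h1.level]
    · intro c hc hcc
      -- For height `0` every component fails, and its leader alone is a witness; hence `markBound t
      -- 0 = 1`.
      right
      have : flagged (comp U (M' 2 d) c) (M' 4 d) = {c} := by
        rw [f2] at hcc ⊢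
        ext v
        rw [mem_flagged, mem_comp, Finset.mem_singleton]
        constructor
        · rintro ⟨⟨hv, hvc⟩, hv4⟩
          rw [h2 v ((hU v).1 hv).1] at hv4
          rw [← (h1' v hv).1 hv4, hvc]
        · rintro rfl
          rw [h2 v ((hU v).1 hc).1]
          exact ⟨⟨hc, hcc⟩, (h1' v hc).2 hcc⟩
      rw [this]
      exact ⟨TdLe.not_zero_of_nonempty (Finset.singleton_nonempty c), by simp [markBound]⟩
    · refine h1.untouched.trans fun a r h11 h12 har => h4 a r h12 (by omega)
  | succ k ih =>
    obtain ⟨ρ, hρ⟩ := hs i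
    obtain ⟨h1, -⟩ := atRound_zero (k := k) hK (by omega) hlev hU hE htd hX ρ
    have hX0 : 0 < X := lt_of_lt_of_le (by positivity) hX
    -- One round consists of the visit to the next level and one step that ascends and then either
    -- descends again or finishes. All `X` rounds are carried out, even if the candidates have run
    -- out.
    have hround : ∀ j < X, ∀ i' M ρ, AtRound G n t m d k U (s i) j M →
        s i' = descend.run K 1 ρ M → ∃ M' ρ', AtRound G n t m d k U (s i) (j + 1) M' ∧
          s (i' + (duration X k + 1)) =
            if j + 1 < X then descend.run K 1 ρ' M' else finish.run K 1 ρ' M' := by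
      intro j hj i' M ρ hM hi'
      obtain ⟨M₁, hM₁, p1, p2, p3, p4, p5, p6⟩ := descend_spec (U := U) hK (by omega) hM.level
        hM.alive (fun v hv => ((hM.alive _).1 (hM.leader.mem hv)).1) ρ
      have hE' : Edges G n m (s i') := by
        rw [hi', hM₁]
        exact hM.edges.congr (p6 8 0 (by omega) (by omega) (.inl (by simp)) (by omega))
          (p6 9 0 (by omega) (by omega) (.inl (by simp)) (by omega))
      have hU' : ∀ v, v ∈ ((Finset.range n).filter fun v => s i' 1 (d + 1) v ≠ 0) ↔
          v < n ∧ s i' 1 (d + 1) v ≠ 0 := by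
        intro v
        rw [Finset.mem_filter, Finset.mem_range]
      have hret := ih (d + 1) i' _ (by omega) hE' (by rw [hi', hM₁, p4]) (by rw [hi', hM₁, p5]) hU'
      obtain ⟨ρ', hρ'⟩ := hs (i' + duration X k)
      have hlev' := hret.level
      have hmode' := hret.mode
      rw [hi'] at hret hU'
      have hnext := hM.next hK (by omega) hj ρ ρ' hU' hret
      refine ⟨_, ρ', hnext, ?_⟩
      rw [← Nat.add_assoc, hρ', step, run_ite, if_neg (by simp [hmode']), run_ite,
        if_neg (by simp [Search.level, hlev']), run_seq, run_ite]
      have hev : (sub (param 7) (get 10 Search.level zero)).eval K ρ'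
          (ascend.run K 1 ρ' (s (i' + duration X k))) = X - (j + 1) := by
        simp only [eval_sub, eval_param, hK.par_seven, eval_get, Search.level, eval_cell,
          eval_zero, hnext.level, hnext.count]
      rw [hev]
      split_ifs <;> first | rfl | (exfalso; omega)
    have hrounds : ∀ j < X, ∃ M ρ, AtRound G n t m d k U (s i) j M ∧
        s (i + 1 + j * (duration X k + 1)) = descend.run K 1 ρ M := by
      intro j
      induction j with
      | zero =>
        intro _
        refine ⟨_, ρ, h1, ?_⟩
        rw [Nat.zero_mul, Nat.add_zero, hρ, step, run_ite, if_pos (by simp [hmode]), run_seq,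
          run_ite, if_neg]
        simp only [eval_sub, eval_param, Search.level, eval_cell, h1.level, hK.par_five]
        omega
      | succ j ihj =>
        intro hj
        obtain ⟨M, ρ, hM, hi'⟩ := ihj (by omega)
        obtain ⟨M', ρ', hM', hi''⟩ := hround j (by omega) _ M ρ hM hi'
        rw [if_pos hj] at hi''
        exact ⟨M', ρ', hM', by rw [← hi'', Nat.succ_mul, Nat.add_assoc (i + 1)]⟩
    obtain ⟨M, ρ, hM, hi'⟩ := hrounds (X - 1) (by omega)
    obtain ⟨M', ρ', hM', hi''⟩ := hround (X - 1) (by omega) _ M ρ hM hi'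
    rw [if_neg (by omega), Nat.sub_add_cancel hX0] at *
    -- The first step enters and descends; the remaining steps are `X` rounds.
    have hidx : i + 1 + (X - 1) * (duration X k + 1) + (duration X k + 1) =
        i + duration X (k + 1) := by
      obtain ⟨x, rfl⟩ : ∃ x, X = x + 1 := ⟨X - 1, by omega⟩
      simp only [duration, Nat.add_sub_cancel]
      ring
    rw [hidx] at hi''
    obtain ⟨M'', hM'', r1, r2, r3⟩ := finish_spec (U := U) hK (by omega) hM'.level hM'.alive
      hM'.pointer hX ρ'
    rw [hi'', hM'']
    have f2 := r3 2 d (by omega) (by omega)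
    have f0 := r3 0 d (by omega) (by omega)
    refine ⟨?_, r2, ?_, ?_⟩
    · rw [r3 11 0 (by omega) (by omega), hM'.level]
    · rw [f2, f0]
      exact Solved.of_rounds hM'.leader hM'.pointer hM'.inv (hb k (by omega)) r1
    · refine hM'.untouched.trans fun a r h11 h12 har => r3 a r h12 (by omega)

end Search

namespace Search

open RAM RAM.Exp RAM.Cmd SimpleGraph

variable {K : Ctx} {n t m X : ℕ} {G : SimpleGraph ℕ}

/-! ### Reading the edges -/

def three : Exp := add one (add one one)

/-- Store the edges in the arrays `8` and `9`. The cells `14` and `15` hold the current vertex and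
the current position. -/
def loadEdges : Cmd :=
  .loop 9 (.ite (sub (inp (add (cell 14) three)) (add (add (param 4) three) (cell 15)))
    (.seq (.set 8 zero (cell 15) (cell 14)) <|
      .seq (.set 9 zero (cell 15) (inp (add (add (param 4) three) (cell 15))))
      (.set 15 zero zero (add (cell 15) one)))
    (.set 14 zero zero (add (cell 14) one)))

/-- The input describes the graph `G`; the neighbours of `v` are at the positions `p v`, …,
`p (v + 1) - 1` behind the header. -/
structure Describes (inp : List ℕ) (G : SimpleGraph ℕ) (n m : ℕ) (p : ℕ → ℕ) : Prop where
  zero : p 0 = 0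
  last : p n = m
  mono : Monotone p
  position : ∀ v < n, inp.getD (v + 3) 0 = n + 3 + p (v + 1)
  adj : ∀ v < n, ∀ e, p v ≤ e → e < p (v + 1) → G.Adj v (inp.getD (n + 3 + e) 0)
  exists_of_adj : ∀ u v, G.Adj u v → u < n ∧
    ∃ e, p u ≤ e ∧ e < p (u + 1) ∧ inp.getD (n + 3 + e) 0 = v

/-- Each iteration advances either the vertex or the position, so exactly `n + m` iterations consume
all the lists. The offset `3` skips `n`, `t` and the first position, which is known. -/
lemma loadEdges_spec (hK : Params K n t m X) (hK9 : K.par 9 = n + m) (hwd : n + m + 3 ≤ K.wd)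
    (hlim : n + m + 3 ≤ K.lim) {p : ℕ → ℕ} (hp : Describes K.inp G n m p) (ρ : ℕ → ℕ) :
    Edges G n m (loadEdges.run K 0 ρ fun _ _ _ => 0) := by
  have hr0 : 0 < K.rows := by rw [hK.rows]; omega
  obtain ⟨h1, h2, h3, h4⟩ : ∃ v e, (v + e = K.par 9 ∧ v ≤ n ∧ e ≤ m) ∧
      ∀ e' < e, ∃ v' < n, p v' ≤ e' ∧ e' < p (v' + 1) ∧
        (loadEdges.run K 0 ρ fun _ _ _ => 0) 8 0 e' = v' ∧
        (loadEdges.run K 0 ρ fun _ _ _ => 0) 9 0 e' = K.inp.getD (n + 3 + e') 0 := by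
    have := run_loop_induction (K := K) (p := 9) (δ := 0) (ρ := ρ) (M := fun _ _ _ => 0)
      (A := .ite (sub (inp (add (cell 14) three)) (add (add (param 4) three) (cell 15)))
        (.seq (.set 8 zero (cell 15) (cell 14)) <|
          .seq (.set 9 zero (cell 15) (inp (add (add (param 4) three) (cell 15))))
          (.set 15 zero zero (add (cell 15) one)))
        (.set 14 zero zero (add (cell 14) one)))
      (I := fun i M => ∃ v e, M 14 0 0 = v ∧ M 15 0 0 = e ∧ v + e = i ∧ v ≤ n ∧ p v ≤ e ∧
        (v < n → e ≤ p (v + 1)) ∧ e ≤ m ∧ ∀ e' < e, ∃ v' < n, p v' ≤ e' ∧ e' < p (v' + 1) ∧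
          M 8 0 e' = v' ∧ M 9 0 e' = K.inp.getD (n + 3 + e') 0) ?_ ?_
    · obtain ⟨v, e, -, -, h1, h2, -, -, h3, h4⟩ := this
      exact ⟨v, e, ⟨h1, h2, h3⟩, h4⟩
    · refine ⟨0, 0, rfl, rfl, rfl, Nat.zero_le _, hp.zero.le, fun _ => Nat.zero_le _,
        Nat.zero_le _, by simp⟩
    · rintro i hi M ⟨v, e, hv, he, hve, hvn, hpv, hpv', hem, hM⟩
      rw [hK9] at hi
      -- If the vertex were `n`, the position would be `m` and the loop would be over.
      have hvlt : v < n := by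
        rcases hvn.lt_or_eq with h | rfl
        · exact h
        · rw [hp.last] at hpv
          omega
      have hpm : p (v + 1) ≤ m := by rw [← hp.last]; exact hp.mono hvlt
      have h3 : ∀ (ρ : ℕ → ℕ) (M : Mem), three.eval K ρ M = 3 := by
        intro ρ M
        have h2 : (1 + 1 : ℕ) ≤ K.lim := by omega
        have h3 : (1 + (1 + 1) : ℕ) ≤ K.lim := by omega
        rw [three, Exp.eval_add, Exp.eval_add] <;>
          simp only [eval_one, Exp.eval_add, h2, h3]
      have hpos : ∀ (ρ : ℕ → ℕ) (M : Mem), M 15 0 0 = e →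
          (add (add (param 4) three) (cell 15)).eval K ρ M = n + 3 + e := by
        intro ρ M hM
        have h4 : (add (param 4) three).eval K ρ M = n + 3 := by
          rw [Exp.eval_add, h3, eval_param, hK.par_four]
          rw [h3, eval_param, hK.par_four]; omega
        rw [Exp.eval_add, h4, eval_cell, hM]
        rw [h4, eval_cell, hM]; omega
      have hcond : (sub (inp (add (cell 14) three)) (add (add (param 4) three) (cell 15))).eval K
          (Function.update ρ 0 i) M = p (v + 1) - e := by
        rw [eval_sub, eval_inp, hpos _ _ he, Exp.eval_add, eval_cell, hv, h3, hp.position v hvlt]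
        · omega
        · rw [eval_cell, hv, h3]; omega
      rw [run_ite, hcond]
      split_ifs with hc
      · have hval : (add (cell 14) one).eval K (Function.update ρ 0 i) M = v + 1 := by
          rw [Exp.eval_add, eval_cell, hv, eval_one]
          rw [eval_cell, hv, eval_one]; omega
        rw [run_set (by simp [hr0]) (by simp; omega), hval]
        refine ⟨v + 1, e, by simp, by simpa [setRow_apply] using he, by omega, hvlt, by omega,
          fun h => ?_, hem, ?_⟩
        · have := hp.mono (Nat.le_succ (v + 1))
          exact (show e ≤ p (v + 1) from hpv' hvlt).trans this
        · simpa [setRow_apply] using hM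
      · have hewd : e < K.wd := by omega
        have hsucc : e + 1 ≤ K.lim := by omega
        rw [run_seq, run_set (a := 8) (by simp [hr0]) (by simp [he, hewd]), run_seq,
          run_set (a := 9) (by simp [hr0]) (by simp [setRow_apply, he, hewd]),
          run_set (a := 15) (by simp [hr0]) (by simp; omega)]
        rw [eval_inp, hpos _ _ (by simp [setRow_apply, he])]
        refine ⟨v, e + 1, by simpa [setRow_apply] using hv, ?_, by omega, hvn, by omega, by omega,
          by omega, ?_⟩
        · simp [setRow_apply, Exp.eval_add, he, hsucc]
        · intro e' he'
          simp only [eval_zero, eval_cell, setRow_apply, hv, he]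
          rcases Nat.lt_succ_iff_lt_or_eq.1 he' with h5 | rfl
          · obtain ⟨v', h6, h7, h8, h9, h10⟩ := hM e' h5
            refine ⟨v', h6, h7, h8, ?_, ?_⟩
            · simp [Function.update_of_ne h5.ne, h9]
            · simp [he, Function.update_of_ne h5.ne, h10]
          · exact ⟨v, hvlt, hpv, by omega, by simp, by simp [he]⟩
  generalize loadEdges.run K 0 ρ (fun _ _ _ => 0) = M at *
  obtain ⟨⟨h3, h4, h5⟩, h6⟩ := And.intro h3 h4
  -- The two counters add up to `n + m`, with `n` and `m` as their respective bounds, so both are at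
  -- their ends.
  have he : h2 = m := by omega
  subst he
  refine ⟨fun u v huv => (hp.exists_of_adj u v huv).1, fun e he => ?_, fun u v huv => ?_⟩
  · obtain ⟨v, hv, h7, h8, h9, h10⟩ := h6 e he
    rw [h9, h10]
    exact hp.adj v hv e h7 h8
  · obtain ⟨hu, e, h7, h8, h9⟩ := hp.exists_of_adj u v huv
    have he : e < h2 := by
      rw [← hp.last]
      exact h8.trans_le (hp.mono hu)
    obtain ⟨v', hv', h10, h11, h12, h13⟩ := h6 e he
    refine ⟨e, he, ?_, by rw [h13, h9]⟩
    rw [h12]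
    -- A position lies in the list of one vertex only, because the offsets are monotone.
    rcases lt_trichotomy v' u with h | h | h
    · have : p (v' + 1) ≤ p u := hp.mono h
      omega
    · exact h
    · have : p (u + 1) ≤ p v' := hp.mono h
      omega

/-! ### Checking a decomposition -/

/-- Climb to the parent, where a vertex `v` is given as `v + 1`, and `0` is above the roots. -/
def up (par : ℕ → ℕ) (x : ℕ) : ℕ := if x = 0 then 0 else par (x - 1)

lemma up_iterate_zero (par : ℕ → ℕ) (i : ℕ) : (up par)^[i] 0 = 0 := by
  induction i with
  | zero => rfl
  | succ i ih => rw [Function.iterate_succ_apply', ih, up, if_pos rfl]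

/-- The value `0` above the roots is absorbing, so a depth bound becomes a condition on a fixed
number of climbs. -/
lemma depthLe_iff {par : ℕ → ℕ} {k v : ℕ} : DepthLe par k v ↔ (up par)^[k] (v + 1) = 0 := by
  induction k generalizing v with
  | zero => simp [DepthLe]
  | succ k ih =>
    have h : up par (v + 1) = par v := by simp [up]
    rw [Function.iterate_succ_apply, h, DepthLe]
    cases hp : par v with
    | zero => simp [up_iterate_zero]
    | succ p => rw [← ih]; simp

lemma above_iff {par : ℕ → ℕ} {u v : ℕ} :
    Above par u v ↔ ∃ i, (up par)^[i + 1] (v + 1) = u + 1 := by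
  constructor
  · intro h
    induction h with
    | single hb => exact ⟨0, by simp [up, hb]⟩
    | @tail b c _ hc ih =>
      obtain ⟨i, hi⟩ := ih
      refine ⟨i + 1, ?_⟩
      rw [Function.iterate_succ_apply, show up par (c + 1) = b + 1 by simp [up, hc], hi]
  · rintro ⟨i, hi⟩
    induction i generalizing v with
    | zero => exact .single (by simpa [up] using hi)
    | succ i ih =>
      rw [Function.iterate_succ_apply, show up par (v + 1) = par v by simp [up]] at hi
      cases hp : par v with
      | zero =>
        rw [hp, up_iterate_zero] at hi
        omega
      | succ p =>
        rw [hp] at hi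
        exact .tail (ih hi) hp

/-- After `k` climbs the walk is above its root and stays there, so an ancestor is met within `k`
climbs. -/
lemma above_iff_of_depthLe {par : ℕ → ℕ} {k u v : ℕ} (h : DepthLe par k v) :
    Above par u v ↔ ∃ i < k, (up par)^[i + 1] (v + 1) = u + 1 := by
  rw [above_iff]
  refine ⟨?_, fun ⟨i, _, hi⟩ => ⟨i, hi⟩⟩
  rintro ⟨i, hi⟩
  refine ⟨i, ?_, hi⟩
  by_contra hk
  obtain ⟨j, rfl⟩ := Nat.exists_eq_add_of_le (not_lt.1 hk)
  rw [depthLe_iff] at h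
  rw [show k + j + 1 = (j + 1) + k by ring, Function.iterate_add_apply, h, up_iterate_zero] at hi
  omega

/-- This is what the program tests: `t` climbs for each vertex, and `t` climbs from both ends of
each edge. The bound `par v ≤ n` says that the parent is a vertex, because of the shift by one. -/
lemma isDecomp_iff {M : Mem} (hE : Edges G n m M) {par : ℕ → ℕ} :
    IsDecomp G par t (Finset.range n) ↔
      (∀ v < n, par v ≤ n ∧ (up par)^[t] (v + 1) = 0) ∧
      ∀ e < m, ∃ i < t, (up par)^[i + 1] (M 8 0 e + 1) = M 9 0 e + 1 ∨
        (up par)^[i + 1] (M 9 0 e + 1) = M 8 0 e + 1 := by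
  constructor
  · intro h
    refine ⟨fun v hv => ⟨?_, depthLe_iff.1 (h.depth_le v (Finset.mem_range.2 hv))⟩, fun e he => ?_⟩
    · cases hp : par v with
      | zero => omega
      | succ p =>
        have := Finset.mem_range.1 (h.parent_mem v (Finset.mem_range.2 hv) p hp)
        omega
    · have hadj := hE.adj e he
      have hu := Finset.mem_range.2 (hE.lt _ _ hadj)
      have hv := Finset.mem_range.2 (hE.lt_right hadj)
      rcases h.above _ hu _ hv hadj with h1 | h1
      · obtain ⟨i, hi, hi'⟩ := (above_iff_of_depthLe (h.depth_le _ hv)).1 h1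
        exact ⟨i, hi, .inr hi'⟩
      · obtain ⟨i, hi, hi'⟩ := (above_iff_of_depthLe (h.depth_le _ hu)).1 h1
        exact ⟨i, hi, .inl hi'⟩
  · rintro ⟨h1, h2⟩
    refine ⟨fun v hv p hp => ?_, fun v hv => depthLe_iff.2 (h1 v (Finset.mem_range.1 hv)).2,
      fun u _ v _ huv => ?_⟩
    · have := (h1 v (Finset.mem_range.1 hv)).1
      rw [Finset.mem_range]
      omega
    · obtain ⟨e, he, rfl, rfl⟩ := hE.exists_of_adj u v huv
      obtain ⟨i, -, hi | hi⟩ := h2 e he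
      · exact .inr (above_iff.2 ⟨i, hi⟩)
      · exact .inl (above_iff.2 ⟨i, hi⟩)

/-- Replace the vertex in cell `a` by its parent. -/
def climb (a : ℕ) : Cmd :=
  .set a zero zero (.ite (cell a) (parent zero (sub (cell a) one)) zero)

/-- Check the vertex number `var 0`. -/
def checkVertex : Cmd :=
  .seq (.set 16 zero zero (add (var 0) one)) <|
  .seq (.loop 5 (climb 16))
  (.ite (.ite (cell 16) one (sub (parent zero (var 0)) (param 4))) (.set 13 zero zero zero) .skip)

/-- Check the edge number `var 0`. -/
def checkEdge : Cmd :=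
  .seq (.set 16 zero zero (add (get 8 zero (var 0)) one)) <|
  .seq (.set 17 zero zero (add (get 9 zero (var 0)) one)) <|
  .seq (.set 18 zero zero zero) <|
  .seq (.loop 5 (.seq (climb 16) <| .seq (climb 17)
    (.ite (.ite (eq (cell 16) (add (get 9 zero (var 0)) one)) one
        (eq (cell 17) (add (get 8 zero (var 0)) one)))
      (.set 18 zero zero one) .skip)))
  (.ite (cell 18) .skip (.set 13 zero zero zero))

/-- Write to cell `13` whether row `0` of array `0` holds a decomposition of height at most `t`. -/
def check : Cmd :=
  .seq (.set 13 zero zero one) <| .seq (.loop 4 checkVertex) (.loop 6 checkEdge)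

/-- The memory `M` with `v` in cell `a`. -/
def setCell (M : Mem) (a v : ℕ) : Mem := setRow M a 0 (Function.update (M a 0) 0 v)

lemma setCell_self (M : Mem) (a v : ℕ) : setCell M a v a 0 0 = v := by simp [setCell]

lemma setCell_of_ne (M : Mem) {a b : ℕ} (v : ℕ) (h : b ≠ a) : setCell M a v b = M b := by
  funext r
  rw [setCell, setRow_of_ne _ _ (.inl h)]

lemma run_setCell (hr : 0 < K.rows) (hw : 0 < K.wd) (a : ℕ) (e : Exp) (δ : ℕ) (ρ : ℕ → ℕ)
    (M : Mem) : (Cmd.set a zero zero e).run K δ ρ M = setCell M a (e.eval K ρ M) := by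
  rw [run_set (by simpa using hr) (by simpa using hw)]
  simp [setCell]

lemma run_climb (hr : 0 < K.rows) (hw : 0 < K.wd) (a : ℕ) (δ : ℕ) (ρ : ℕ → ℕ) (M : Mem) :
    (climb a).run K δ ρ M = setCell M a (up (M 0 0) (M a 0 0)) := by
  rw [climb, run_setCell hr hw]
  simp [parent, up]

lemma checkVertex_spec (hK : Params K n t m X) {v : ℕ} (hv : v < n) (δ : ℕ) (ρ : ℕ → ℕ)
    (hρ : ρ 0 = v) (M : Mem) :
    (checkVertex.run K δ ρ M) 13 0 0 =
      if M 0 0 v ≤ n ∧ (up (M 0 0))^[t] (v + 1) = 0 then M 13 0 0 else 0 := by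
  have hr : 0 < K.rows := by rw [hK.rows]; omega
  have hw : 0 < K.wd := by have := hK.n_lt; omega
  have hvl : v + 1 ≤ K.lim := by have := hK.n_lt_lim; omega
  have hval : (add (var 0) one).eval K ρ M = v + 1 := by
    rw [Exp.eval_add, eval_var, hρ, eval_one]
    rw [eval_var, hρ, eval_one]; exact hvl
  rw [checkVertex, run_seq, run_setCell hr hw, hval, run_seq]
  obtain ⟨h1, h2⟩ : (∀ a, a ≠ 16 → ((Cmd.loop 5 (climb 16)).run K δ ρ (setCell M 16 (v + 1))) a =
      M a) ∧ ((Cmd.loop 5 (climb 16)).run K δ ρ (setCell M 16 (v + 1))) 16 0 0 =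
        (up (M 0 0))^[K.par 5] (v + 1) := by
    refine run_loop_induction (I := fun i M' => (∀ a, a ≠ 16 → M' a = M a) ∧
      M' 16 0 0 = (up (M 0 0))^[i] (v + 1)) ?_ ?_
    · exact ⟨fun a ha => setCell_of_ne _ _ ha, setCell_self _ _ _⟩
    · rintro i - M' ⟨h1, h2⟩
      rw [run_climb hr hw, h2, h1 0 (by omega), ← Function.iterate_succ_apply' (up (M 0 0))]
      exact ⟨fun a ha => by rw [setCell_of_ne _ _ ha, h1 a ha], setCell_self _ _ _⟩
  generalize (Cmd.loop 5 (climb 16)).run K δ ρ (setCell M 16 (v + 1)) = M' at *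
  rw [hK.par_five] at h2
  rw [run_ite, run_setCell hr hw, run_skip]
  have hev : (Exp.ite (cell 16) one (sub (parent zero (var 0)) (param 4))).eval K ρ M' =
      if (up (M 0 0))^[t] (v + 1) = 0 then M 0 0 v - n else 1 := by
    simp [parent, h1 0, h2, hρ, hK.par_four]
  rw [hev]
  by_cases hc : M 0 0 v ≤ n ∧ (up (M 0 0))^[t] (v + 1) = 0
  · rw [if_pos hc, if_pos (by rw [if_pos hc.2]; omega), h1 13 (by omega)]
  · rw [if_neg hc, if_neg, setCell_self, eval_zero]
    split_ifs with h3
    · intro h4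
      exact hc ⟨by omega, h3⟩
    · exact not_false

/-- Both ends climb simultaneously, and cell `18` records whether one has met the other. With `δ =
0` the inner loop would overwrite the variable that holds the edge. -/
lemma checkEdge_spec (hK : Params K n t m X) {M : Mem} (hE : Edges G n m M) {e : ℕ} (he : e < m)
    (δ : ℕ) (ρ : ℕ → ℕ) (hρ : ρ 0 = e) (hδ : δ ≠ 0) :
    (checkEdge.run K δ ρ M) 13 0 0 =
      if ∃ i < t, (up (M 0 0))^[i + 1] (M 8 0 e + 1) = M 9 0 e + 1 ∨
        (up (M 0 0))^[i + 1] (M 9 0 e + 1) = M 8 0 e + 1 then M 13 0 0 else 0 := by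
  have hr : 0 < K.rows := by rw [hK.rows]; omega
  have hw : 0 < K.wd := by have := hK.n_lt; omega
  have hn := hK.n_lt_lim
  have hul : M 8 0 e + 1 ≤ K.lim := by have := hE.lt _ _ (hE.adj e he); omega
  have hvl : M 9 0 e + 1 ≤ K.lim := by have := hE.lt_right (hE.adj e he); omega
  have hval8 : ∀ (ρ : ℕ → ℕ) (M' : Mem), ρ 0 = e → M' 8 = M 8 →
      (add (get 8 zero (var 0)) one).eval K ρ M' = M 8 0 e + 1 := by
    intro ρ M' hρ h8
    rw [Exp.eval_add] <;> simp [hρ, h8, hul]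
  have hval9 : ∀ (ρ : ℕ → ℕ) (M' : Mem), ρ 0 = e → M' 9 = M 9 →
      (add (get 9 zero (var 0)) one).eval K ρ M' = M 9 0 e + 1 := by
    intro ρ M' hρ h9
    rw [Exp.eval_add] <;> simp [hρ, h9, hvl]
  rw [checkEdge, run_seq, run_setCell hr hw, hval8 _ _ hρ rfl, run_seq, run_setCell hr hw,
    hval9 _ _ hρ (setCell_of_ne _ _ (by omega)), run_seq, run_setCell hr hw, run_seq, eval_zero]
  set M₁ := setCell (setCell (setCell M 16 (M 8 0 e + 1)) 17 (M 9 0 e + 1)) 18 0 with hM₁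
  set A : Cmd := .seq (climb 16) <| .seq (climb 17)
    (.ite (.ite (eq (cell 16) (add (get 9 zero (var 0)) one)) one
        (eq (cell 17) (add (get 8 zero (var 0)) one)))
      (.set 18 zero zero one) .skip) with hA
  obtain ⟨h1, -, -, h2⟩ : (∀ a, a ≠ 16 → a ≠ 17 → a ≠ 18 → ((Cmd.loop 5 A).run K δ ρ M₁) a = M a) ∧
      ((Cmd.loop 5 A).run K δ ρ M₁) 16 0 0 = (up (M 0 0))^[K.par 5] (M 8 0 e + 1) ∧
      ((Cmd.loop 5 A).run K δ ρ M₁) 17 0 0 = (up (M 0 0))^[K.par 5] (M 9 0 e + 1) ∧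
      (((Cmd.loop 5 A).run K δ ρ M₁) 18 0 0 ≠ 0 ↔ ∃ i < K.par 5,
        (up (M 0 0))^[i + 1] (M 8 0 e + 1) = M 9 0 e + 1 ∨
        (up (M 0 0))^[i + 1] (M 9 0 e + 1) = M 8 0 e + 1) := by
    refine run_loop_induction (I := fun j M' => (∀ a, a ≠ 16 → a ≠ 17 → a ≠ 18 → M' a = M a) ∧
      M' 16 0 0 = (up (M 0 0))^[j] (M 8 0 e + 1) ∧
      M' 17 0 0 = (up (M 0 0))^[j] (M 9 0 e + 1) ∧
      (M' 18 0 0 ≠ 0 ↔ ∃ i < j, (up (M 0 0))^[i + 1] (M 8 0 e + 1) = M 9 0 e + 1 ∨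
        (up (M 0 0))^[i + 1] (M 9 0 e + 1) = M 8 0 e + 1)) ?_ ?_
    · refine ⟨fun a h1 h2 h3 => ?_, ?_, ?_, ?_⟩
      · rw [hM₁, setCell_of_ne _ _ h3, setCell_of_ne _ _ h2, setCell_of_ne _ _ h1]
      · rw [hM₁, setCell_of_ne _ _ (by omega), setCell_of_ne _ _ (by omega), setCell_self]
        rfl
      · rw [hM₁, setCell_of_ne _ _ (by omega), setCell_self]
        rfl
      · rw [hM₁, setCell_self]
        simp
    · rintro j - M' ⟨h1, h2, h3, h4⟩
      rw [hA, run_seq, run_climb hr hw, h2, h1 0 (by omega) (by omega) (by omega),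
        ← Function.iterate_succ_apply' (up (M 0 0)), run_seq, run_climb hr hw,
        setCell_of_ne _ _ (show 17 ≠ 16 by omega), h3, setCell_of_ne _ _ (show 0 ≠ 16 by omega),
        h1 0 (by omega) (by omega) (by omega), ← Function.iterate_succ_apply' (up (M 0 0))]
      set M₂ := setCell (setCell M' 16 ((up (M 0 0))^[j.succ] (M 8 0 e + 1))) 17
        ((up (M 0 0))^[j.succ] (M 9 0 e + 1)) with hM₂
      have k1 : ∀ a, a ≠ 16 → a ≠ 17 → a ≠ 18 → M₂ a = M a := by
        intro a h5 h6 h7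
        rw [hM₂, setCell_of_ne _ _ h6, setCell_of_ne _ _ h5, h1 a h5 h6 h7]
      have k2 : M₂ 16 0 0 = (up (M 0 0))^[j + 1] (M 8 0 e + 1) := by
        rw [hM₂, setCell_of_ne _ _ (by omega), setCell_self]
      have k3 : M₂ 17 0 0 = (up (M 0 0))^[j + 1] (M 9 0 e + 1) := by
        rw [hM₂, setCell_self]
      have k4 : M₂ 18 = M' 18 := by
        rw [hM₂, setCell_of_ne _ _ (by omega), setCell_of_ne _ _ (by omega)]
      have hρ' : Function.update ρ δ j 0 = e := by
        rw [Function.update_of_ne (Ne.symm hδ), hρ]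
      have hev : (Exp.ite (eq (cell 16) (add (get 9 zero (var 0)) one)) one
          (eq (cell 17) (add (get 8 zero (var 0)) one))).eval K (Function.update ρ δ j) M₂ =
          if (up (M 0 0))^[j + 1] (M 8 0 e + 1) = M 9 0 e + 1 ∨
            (up (M 0 0))^[j + 1] (M 9 0 e + 1) = M 8 0 e + 1 then 1 else 0 := by
        rw [eval_ite, eval_eq, eval_eq, hval8 _ _ hρ' (k1 8 (by omega) (by omega) (by omega)),
          hval9 _ _ hρ' (k1 9 (by omega) (by omega) (by omega)), eval_cell, eval_cell, k2, k3,
          eval_one]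
        by_cases h5 : (up (M 0 0))^[j + 1] (M 8 0 e + 1) = M 9 0 e + 1
        · rw [if_pos h5, if_neg Nat.one_ne_zero, if_pos (.inl h5)]
        · rw [if_neg h5, if_pos rfl]
          simp only [h5, false_or]
      have hex : (∃ i < j + 1, (up (M 0 0))^[i + 1] (M 8 0 e + 1) = M 9 0 e + 1 ∨
          (up (M 0 0))^[i + 1] (M 9 0 e + 1) = M 8 0 e + 1) ↔ M' 18 0 0 ≠ 0 ∨
          ((up (M 0 0))^[j + 1] (M 8 0 e + 1) = M 9 0 e + 1 ∨
            (up (M 0 0))^[j + 1] (M 9 0 e + 1) = M 8 0 e + 1) := by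
        rw [h4]
        constructor
        · rintro ⟨i, hi, h5⟩
          rcases Nat.lt_succ_iff_lt_or_eq.1 hi with h6 | rfl
          · exact .inl ⟨i, h6, h5⟩
          · exact .inr h5
        · rintro (⟨i, hi, h5⟩ | h5)
          · exact ⟨i, by omega, h5⟩
          · exact ⟨j, by omega, h5⟩
      rw [run_ite, hev, run_setCell hr hw, run_skip, hex]
      by_cases h5 : (up (M 0 0))^[j + 1] (M 8 0 e + 1) = M 9 0 e + 1 ∨
          (up (M 0 0))^[j + 1] (M 9 0 e + 1) = M 8 0 e + 1
      · rw [if_pos h5, if_neg Nat.one_ne_zero, eval_one]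
        refine ⟨fun a h6 h7 h8 => ?_, ?_, ?_, ?_⟩
        · rw [setCell_of_ne _ _ h8, k1 a h6 h7 h8]
        · rw [setCell_of_ne _ _ (by omega), k2]
        · rw [setCell_of_ne _ _ (by omega), k3]
        · rw [setCell_self]
          exact ⟨fun _ => .inr h5, fun _ => Nat.one_ne_zero⟩
      · rw [if_neg h5, if_pos rfl]
        refine ⟨k1, k2, k3, ?_⟩
        rw [k4]
        exact ⟨.inl, fun h => h.resolve_right h5⟩
  generalize (Cmd.loop 5 A).run K δ ρ M₁ = M' at *
  rw [hK.par_five] at h2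
  rw [run_ite, run_skip, run_setCell hr hw, eval_cell]
  by_cases hc : ∃ i < t, (up (M 0 0))^[i + 1] (M 8 0 e + 1) = M 9 0 e + 1 ∨
      (up (M 0 0))^[i + 1] (M 9 0 e + 1) = M 8 0 e + 1
  · rw [if_pos hc, if_neg (h2.2 hc), h1 13 (by omega) (by omega) (by omega)]
  · rw [if_neg hc, if_pos, setCell_self, eval_zero]
    by_contra h
    exact hc (h2.1 h)

lemma ite_ite_zero {p q : Prop} [Decidable p] [Decidable q] [Decidable (p ∧ q)] (a : ℕ) :
    (if q then if p then a else 0 else 0) = if p ∧ q then a else 0 := by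
  by_cases hp : p <;> by_cases hq : q <;> simp [hp, hq]

-- Cell `13` starts with `1` and is only ever reset to `0`, so it ends as the conjunction of all
-- tests. The array of parents is left unchanged.
open Classical in
lemma check_spec (hK : Params K n t m X) {M : Mem} (hE : Edges G n m M) (ρ : ℕ → ℕ) :
    (check.run K 0 ρ M) 0 = M 0 ∧ (check.run K 0 ρ M) 13 0 0 =
      if IsDecomp G (M 0 0) t (Finset.range n) then 1 else 0 := by
  have hr : 0 < K.rows := by rw [hK.rows]; omega
  have hw : 0 < K.wd := by have := hK.n_lt; omega
  have hkeep : ∀ a, a ≤ 9 → checkVertex.Keeps a ∧ checkEdge.Keeps a := by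
    intro a ha
    constructor <;>
      simp only [checkVertex, checkEdge, climb, Cmd.Keeps, and_true, true_and] <;> omega
  refine ⟨run_of_keeps _ (by
    have := hkeep 0 (by omega)
    exact ⟨by simp [Cmd.Keeps], this⟩) _ _ _, ?_⟩
  rw [check, run_seq, run_setCell hr hw, run_seq, eval_one]
  obtain ⟨h1, h2⟩ : (∀ a ≤ 9, ((Cmd.loop 4 checkVertex).run K 0 ρ (setCell M 13 1)) a = M a) ∧
      ((Cmd.loop 4 checkVertex).run K 0 ρ (setCell M 13 1)) 13 0 0 =
        if ∀ v < K.par 4, M 0 0 v ≤ n ∧ (up (M 0 0))^[t] (v + 1) = 0 then 1 else 0 := by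
    refine run_loop_induction (I := fun j M' => (∀ a ≤ 9, M' a = M a) ∧ M' 13 0 0 =
      if ∀ v < j, M 0 0 v ≤ n ∧ (up (M 0 0))^[t] (v + 1) = 0 then 1 else 0) ?_ ?_
    · exact ⟨fun a ha => setCell_of_ne _ _ (by omega), by rw [setCell_self]; simp⟩
    · rintro j hj M' ⟨h1, h2⟩
      rw [hK.par_four] at hj
      refine ⟨fun a ha => by rw [run_of_keeps _ (hkeep a ha).1, h1 a ha], ?_⟩
      rw [checkVertex_spec hK hj _ _ (by simp), h1 0 (by omega), h2]
      simp only [Nat.forall_lt_succ_right]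
      exact ite_ite_zero _
  generalize (Cmd.loop 4 checkVertex).run K 0 ρ (setCell M 13 1) = M₁ at *
  obtain ⟨h3, h4⟩ : (∀ a ≤ 9, ((Cmd.loop 6 checkEdge).run K 0 ρ M₁) a = M a) ∧
      ((Cmd.loop 6 checkEdge).run K 0 ρ M₁) 13 0 0 =
        if ∀ e < K.par 6, ∃ i < t, (up (M 0 0))^[i + 1] (M 8 0 e + 1) = M 9 0 e + 1 ∨
          (up (M 0 0))^[i + 1] (M 9 0 e + 1) = M 8 0 e + 1 then M₁ 13 0 0 else 0 := by
    refine run_loop_induction (I := fun j M' => (∀ a ≤ 9, M' a = M a) ∧ M' 13 0 0 =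
      if ∀ e < j, ∃ i < t, (up (M 0 0))^[i + 1] (M 8 0 e + 1) = M 9 0 e + 1 ∨
          (up (M 0 0))^[i + 1] (M 9 0 e + 1) = M 8 0 e + 1 then M₁ 13 0 0 else 0) ?_ ?_
    · exact ⟨h1, by simp⟩
    · rintro j hj M' ⟨h5, h6⟩
      rw [hK.par_six] at hj
      refine ⟨fun a ha => by rw [run_of_keeps _ (hkeep a ha).2, h5 a ha], ?_⟩
      have hE' : Edges G n m M' := hE.congr (by rw [h5 8 (by omega)]) (by rw [h5 9 (by omega)])
      rw [checkEdge_spec hK hE' hj _ _ (by simp) (by omega), h5 0 (by omega), h5 8 (by omega),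
        h5 9 (by omega), h6]
      simp only [Nat.forall_lt_succ_right]
      exact ite_ite_zero _
  rw [h4, h2, hK.par_four, hK.par_six]
  simp only [isDecomp_iff hE]
  split_ifs <;> first | rfl | (exfalso; tauto)

end Search

namespace Search

open RAM RAM.Exp RAM.Cmd SimpleGraph

variable {K : Ctx} {n t m X : ℕ} {G : SimpleGraph ℕ}

/-! ### The whole algorithm -/

/-- Read the edges, search for a decomposition, and check the result. -/
def main : Cmd :=
  .seq loadEdges <| .seq (.loop 4 (.set 1 zero (var 0) one)) <| .seq (.loop 8 step) check

/-- A witness of failure would be a subset of `U` of treedepth more than `k`, which monotonicity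
excludes; so every component is solved. -/
lemma Solved.isDecomp {U : Finset ℕ} {k b : ℕ} {L acc par : ℕ → ℕ} (h : Solved G U k b L acc par)
    (htd : G.TdLe k U) : IsDecomp G par k U := by
  refine IsDecomp.of_classes L (fun u hu v hv huv => h.leader.eq u hu v hv
    (Adj.reachable (G := G.within U) ⟨hu, hv, huv⟩)) fun c hc => ?_
  rcases h.dichotomy (L c) (h.leader.mem hc) (h.leader.leader_leader hc) with h1 | h1
  · exact h1.2
  · refine absurd (htd.mono fun v hv => ?_) h1.1
    exact (mem_comp.1 (mem_flagged.1 hv).1).1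

/-- In `duration X t` steps, the search finds a decomposition if there is one. -/
lemma search_spec (hK : Params K n t m X) (htd : G.TdLe t (Finset.range n))
    (hX : 2 ^ t ≤ X) (hb : ∀ k < t, markBound t k + 1 ≤ X) (hY : duration X t ≤ K.par 8)
    {M : Mem} (hE : Edges G n m M) (hlev : M 11 0 0 = 0) (hmode : M 12 0 0 = 0)
    (halive : ∀ v < n, M 1 0 v = 1) (ρ : ℕ → ℕ) :
    IsDecomp G ((Cmd.loop 8 step).run K 0 ρ M 0 0) t (Finset.range n) := by
  let s : ℕ → Mem := fun j =>
    Nat.rec M (fun i M' => step.run K 1 (Function.update ρ 0 i) M') j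
  have hs : ∀ i, s (i + 1) = step.run K 1 (Function.update ρ 0 i) (s i) := fun i => rfl
  have hret := returned_of_enter hK htd hX hb s (fun i => ⟨_, hs i⟩) t 0 0 (Finset.range n)
    (by omega) hE hlev hmode fun v => by
      rw [Finset.mem_range]
      exact ⟨fun h => ⟨h, by rw [show s 0 1 0 v = 1 from halive v h]; exact Nat.one_ne_zero⟩,
        fun h => h.1⟩
  rw [Nat.zero_add] at hret
  -- In return mode on level `0` a step does nothing, so surplus steps of the main loop are
  -- harmless.
  have hstay : ∀ j, s (duration X t + j) = s (duration X t) := by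
    intro j
    induction j with
    | zero => rfl
    | succ j ih =>
      rw [← Nat.add_assoc, hs, ih, step, run_ite, if_neg (by simp [hret.mode]), run_ite,
        if_pos (by simp [level, hret.level]), run_skip]
  obtain ⟨j, hj⟩ := Nat.exists_eq_add_of_le hY
  have hrun : (Cmd.loop 8 step).run K 0 ρ M = s (duration X t) := by
    rw [← hstay j, ← hj]
    rfl
  rw [hrun]
  exact hret.solved.isDecomp htd

lemma main_closed : main.Closed 0 := by
  simp [main, loadEdges, step, check, checkVertex, checkEdge, climb, enter, descend, ascend, finish,
    leaf, relax, level, below, parent, alive, leader, pointer, mark, todo, picked, failed, hit,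
    three, Exp.and, Exp.not, Exp.eq, cell, Cmd.Closed, Exp.Closed]

/-- The search is trusted only if the treedepth is at most `t`; then its result passes the check.
Whatever passes the check is a decomposition, whether or not the search behaved as intended. -/
theorem main_spec (hK : Params K n t m X) (hK9 : K.par 9 = n + m) (hwd : n + m + 3 ≤ K.wd)
    (hlim : n + m + 3 ≤ K.lim) {p : ℕ → ℕ} (hp : Describes K.inp G n m p)
    (hX : 2 ^ t ≤ X) (hb : ∀ k < t, markBound t k + 1 ≤ X) (hY : duration X t ≤ K.par 8)
    (ρ : ℕ → ℕ) :
    (main.run K 0 ρ (fun _ _ _ => 0) 13 0 0 = 1 ∧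
      IsDecomp G (main.run K 0 ρ (fun _ _ _ => 0) 0 0) t (Finset.range n)) ∨
    (main.run K 0 ρ (fun _ _ _ => 0) 13 0 0 = 0 ∧ ¬G.TdLe t (Finset.range n)) := by
  classical
  have hE := loadEdges_spec hK hK9 hwd hlim hp ρ
  have h11 : loadEdges.run K 0 ρ (fun _ _ _ => 0) 11 = fun _ _ => 0 :=
    run_of_keeps _ (by simp [loadEdges, Cmd.Keeps]) _ _ _
  have h12 : loadEdges.run K 0 ρ (fun _ _ _ => 0) 12 = fun _ _ => 0 :=
    run_of_keeps _ (by simp [loadEdges, Cmd.Keeps]) _ _ _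
  rw [main, run_seq, run_seq, run_seq]
  generalize loadEdges.run K 0 ρ (fun _ _ _ => 0) = M at *
  have hr : 0 < K.rows := by rw [hK.rows]; omega
  have hfill := run_loop_fill (K := K) (p := 4) (a := 1) (eR := zero) (e := one) (δ := 0) (ρ := ρ)
    (M := M) 0 (fun _ => 1) hr (by rw [hK.par_four]; exact hK.n_lt.le)
    (fun i hi g hg => ⟨by simp, by simp⟩)
  rw [hfill, hK.par_four]
  set M₁ := setRow M 1 0 fun v => if v < n then 1 else M 1 0 v with hM₁
  have hE₁ : Edges G n m M₁ := hE.congr (setRow_of_ne _ _ (by simp)) (setRow_of_ne _ _ (by simp))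
  -- This does not use the bound on the treedepth: the search never writes to the arrays of edges,
  -- so the check always refers to the given graph.
  have hE₂ : Edges G n m ((Cmd.loop 8 step).run K 0 ρ M₁) := by
    have hkeep : ∀ a, a = 8 ∨ a = 9 → (Cmd.loop 8 step).Keeps a := by
      rintro a (rfl | rfl) <;>
        simp [step, enter, descend, ascend, finish, leaf, relax, Cmd.Keeps]
    exact hE₁.congr (by rw [run_of_keeps _ (hkeep 8 (.inl rfl))])
      (by rw [run_of_keeps _ (hkeep 9 (.inr rfl))])
  obtain ⟨h1, h2⟩ := check_spec hK hE₂ ρ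
  rw [h1, h2]
  by_cases hd : IsDecomp G ((Cmd.loop 8 step).run K 0 ρ M₁ 0 0) t (Finset.range n)
  · exact .inl ⟨if_pos hd, hd⟩
  · refine .inr ⟨if_neg hd, fun htd => hd ?_⟩
    refine search_spec hK htd hX hb hY hE₁ ?_ ?_ ?_ ρ
    · rw [hM₁, setRow_of_ne _ _ (by simp), h11]
    · rw [hM₁, setRow_of_ne _ _ (by simp), h12]
    · intro v hv
      rw [hM₁, setRow_self]
      exact if_pos hv

/-! ### Bounds -/

/-- The nested loops for propagating labels and for spreading marks cost `X` times the number of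
edges or vertices; all else is linear. The constant is generous. -/
lemma step_cost_le {N : ℕ} (hN : 1 ≤ N) (hX : 1 ≤ X) (h4 : K.par 4 ≤ N) (h6 : K.par 6 ≤ N)
    (h7 : K.par 7 = X) : step.cost K ≤ 5000 * (X * N) := by
  have e1 : K.par 4 * X ≤ X * N := (Nat.mul_le_mul_right _ h4).trans (Nat.mul_comm _ _).le
  have e2 : X * K.par 6 ≤ X * N := Nat.mul_le_mul_left _ h6
  have e3 : K.par 4 ≤ X * N := h4.trans (Nat.le_mul_of_pos_left _ hX)
  have e4 : X ≤ X * N := Nat.le_mul_of_pos_right _ hN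
  simp only [step, enter, descend, ascend, finish,
    leaf, relax, level, below, parent, alive, leader, pointer, mark, todo, picked, failed, hit,
    Exp.and, Exp.not, Exp.eq, cell, Cmd.cost, Exp.cost, h7]
  ring_nf
  omega

/-- The `Y` steps of the search dominate. Reading is linear in `n + m`, and checking takes at most
`t ≤ Y` climbs per vertex or edge. -/
lemma main_cost_le {N Y : ℕ} (hN : 1 ≤ N) (hX : 1 ≤ X) (hY : 1 ≤ Y) (h4 : K.par 4 ≤ N)
    (h5 : K.par 5 ≤ Y) (h6 : K.par 6 ≤ N) (h7 : K.par 7 = X) (h8 : K.par 8 = Y)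
    (h9 : K.par 9 ≤ N) : main.cost K ≤ 7000 * (Y * (X * N)) := by
  have hs : K.par 8 * step.cost K ≤ 5000 * (Y * (X * N)) := by
    rw [h8, ← Nat.mul_assoc, Nat.mul_comm 5000, Nat.mul_assoc]
    exact Nat.mul_le_mul_left _ (step_cost_le hN hX h4 h6 h7)
  have e0 : N ≤ X * N := Nat.le_mul_of_pos_left _ hX
  have e1 : X * N ≤ Y * (X * N) := Nat.le_mul_of_pos_left _ hY
  have e2 : Y ≤ Y * (X * N) := Nat.le_mul_of_pos_right _ (by omega)
  have e3 : K.par 4 * K.par 5 ≤ Y * (X * N) := by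
    rw [Nat.mul_comm]
    exact Nat.mul_le_mul h5 (h4.trans e0)
  have e4 : K.par 5 * K.par 6 ≤ Y * (X * N) := Nat.mul_le_mul h5 (h6.trans e0)
  simp only [main, loadEdges, check, checkVertex, checkEdge, climb, parent, three, Exp.eq, cell,
    Cmd.cost, Exp.cost]
  generalize step.cost K = c at *
  generalize Y * (X * N) = D at *
  ring_nf
  omega

/-- From `b + b * b ≤ 2 * b * b` the recurrence is at most squaring times `2 ^ (t + 1)`. The extra
factor on the left turns this into pure squaring. -/
lemma markBound_mul_le (t k : ℕ) : markBound t k * 2 ^ (t + 1) ≤ 2 ^ ((t + 1) * 2 ^ k) := by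
  induction k with
  | zero => simp [markBound]
  | succ k ih =>
    calc markBound t (k + 1) * 2 ^ (t + 1)
        ≤ 2 ^ t * (markBound t k * markBound t k + markBound t k * markBound t k) *
          2 ^ (t + 1) := by
          rw [markBound]
          gcongr
          exact Nat.le_mul_self _
      _ = (markBound t k * 2 ^ (t + 1)) * (markBound t k * 2 ^ (t + 1)) := by ring
      _ ≤ 2 ^ ((t + 1) * 2 ^ k) * 2 ^ ((t + 1) * 2 ^ k) := Nat.mul_le_mul ih ih
      _ = 2 ^ ((t + 1) * 2 ^ (k + 1)) := by ring

/-- The right side serves as the common number `X` of rounds on all levels; the summand `1` is for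
the round that tries the leader. -/
lemma markBound_add_one_le {t k : ℕ} (hk : k < t) : markBound t k + 1 ≤ 2 ^ 2 ^ (2 * t + 1) := by
  have h1 := markBound_mul_le t k
  have h2 : 1 ≤ 2 ^ ((t + 1) * 2 ^ k) := Nat.one_le_two_pow
  have h3 : markBound t k * 2 ≤ markBound t k * 2 ^ (t + 1) :=
    Nat.mul_le_mul_left _ (Nat.le_self_pow (by omega) 2)
  have h4 : 2 ^ ((t + 1) * 2 ^ k) * 2 ≤ 2 ^ 2 ^ (2 * t + 1) := by
    rw [← pow_succ]
    refine Nat.pow_le_pow_right (by omega) ?_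
    have h5 : (t + 1) * 2 ^ k ≤ 2 ^ t * 2 ^ t :=
      Nat.mul_le_mul (Nat.lt_two_pow_self) (Nat.pow_le_pow_right (by omega) hk.le)
    have h6 : 1 ≤ 2 ^ t * 2 ^ t := Nat.mul_pos (by positivity) (by positivity)
    have h7 : 2 ^ (2 * t + 1) = 2 ^ t * 2 ^ t * 2 := by ring
    omega
  omega

lemma two_pow_le (t : ℕ) : 2 ^ t ≤ 2 ^ 2 ^ (2 * t + 1) := by
  refine Nat.pow_le_pow_right (by omega) ?_
  exact (Nat.lt_two_pow_self).le.trans (Nat.pow_le_pow_right (by omega) (by omega))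

/-- A level multiplies the duration by `X`, and a second factor `X` absorbs the additive terms. -/
lemma duration_add_one_le {X : ℕ} (hX : 2 ≤ X) (k : ℕ) : duration X k + 1 ≤ X ^ (2 * k + 1) := by
  induction k with
  | zero => simpa [duration] using hX
  | succ k ih =>
    calc duration X (k + 1) + 1 = 2 + X * (duration X k + 1) := by rw [duration]; ring
      _ ≤ X * (duration X k + 1) + X * (duration X k + 1) := by
        gcongr
        exact hX.trans (Nat.le_mul_of_pos_right _ (by omega))
      _ = 2 * (X * (duration X k + 1)) := by ring
      _ ≤ X * (X * X ^ (2 * k + 1)) := by gcongr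
      _ = X ^ (2 * (k + 1) + 1) := by ring

lemma duration_le (t : ℕ) : duration (2 ^ 2 ^ (2 * t + 1)) t ≤ 2 ^ 2 ^ (4 * t + 1) := by
  have h1 := duration_add_one_le (Nat.le_self_pow (Nat.two_pow_pos (2 * t + 1)).ne' 2) t
  refine (Nat.le_succ _).trans (h1.trans ?_)
  rw [← pow_mul]
  refine Nat.pow_le_pow_right (by omega) ?_
  calc 2 ^ (2 * t + 1) * (2 * t + 1) ≤ 2 ^ (2 * t + 1) * 2 ^ (2 * t) :=
        Nat.mul_le_mul_left _ Nat.lt_two_pow_self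
    _ = 2 ^ (4 * t + 1) := by ring

end Search

namespace Search

open RAM SimpleGraph

/-! ### The input -/

section Input

variable {n : ℕ} (adj : Fin n → List (Fin n))

/-- The number of entries before the adjacency list of `v`. -/
def offset (v : ℕ) : ℕ := (((List.ofFn adj).take v).map List.length).sum

lemma offset_succ {v : ℕ} (hv : v < n) :
    offset adj (v + 1) = offset adj v + (adj ⟨v, hv⟩).length := by
  have h : v < (List.ofFn adj).length := by simpa using hv
  rw [offset, List.take_succ_eq_append_getElem h, List.map_append, List.sum_append]
  simp [offset]

lemma offset_mono : Monotone (offset adj) := by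
  refine monotone_nat_of_le_succ fun v => ?_
  by_cases hv : v < n
  · rw [offset_succ adj hv]; omega
  · rw [offset, offset, List.take_of_length_le (by simp; omega),
      List.take_of_length_le (by simp; omega)]

/-- The length of all adjacency lists together. -/
def total : ℕ := (List.ofFn adj).flatten.length

lemma offset_last : offset adj n = total adj := by
  rw [offset, total, List.take_of_length_le (by simp), List.length_flatten]

lemma flatten_getElem? {v j : ℕ} (hv : v < n) (hj : j < (adj ⟨v, hv⟩).length) :
    (List.ofFn adj).flatten[offset adj v + j]? = some (adj ⟨v, hv⟩)[j] := by
  have h := List.drop_take_succ_flatten_eq_getElem (List.ofFn adj) v (by simpa using hv)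
  rw [← List.map_take, ← List.map_take, List.getElem_ofFn] at h
  change ((List.ofFn adj).flatten.take (offset adj (v + 1))).drop (offset adj v) = _ at h
  have h' := congrArg (fun l => l[j]?) h
  simp only [List.getElem?_drop, List.getElem?_eq_getElem hj] at h'
  rw [← h', List.getElem?_take_of_lt]
  rw [offset_succ adj hv]; omega

variable (t : ℕ)

lemma length_encodeInput : (encodeInput t adj).length = n + 3 + total adj := by
  simp only [encodeInput, total, List.length_append, List.length_map, List.length_cons,
    List.length_nil, List.length_range]
  omega

lemma encodeInput_zero : (encodeInput t adj)[0]? = some n := rfl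

lemma encodeInput_one : (encodeInput t adj)[1]? = some t := rfl

lemma encodeInput_position {v : ℕ} (hv : v ≤ n) :
    (encodeInput t adj)[v + 2]? = some (n + 3 + offset adj v) := by
  rw [encodeInput, List.append_assoc, List.getElem?_append_right (by simp),
    List.getElem?_append_left (by simp; omega)]
  simp [hv, offset]

lemma encodeInput_entry (e : ℕ) :
    (encodeInput t adj)[n + 3 + e]? = (List.ofFn adj).flatten[e]?.map Fin.val := by
  rw [encodeInput, List.getElem?_append_right (by simp), List.getElem?_map]
  congr 2
  simp

/-- Only the entry `t` is not bounded by the length of the input. -/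
lemma le_of_mem_encodeInput {x : ℕ} (hx : x ∈ encodeInput t adj) :
    x ≤ (encodeInput t adj).length ∨ x = t := by
  rw [length_encodeInput]
  simp only [encodeInput, List.mem_append, List.mem_cons, List.not_mem_nil, or_false, List.mem_map,
    List.mem_range] at hx
  rcases hx with ((rfl | rfl) | ⟨v, hv, rfl⟩) | ⟨v, -, rfl⟩
  · left; omega
  · right; rfl
  · left
    have h : offset adj v ≤ offset adj n := offset_mono adj (by omega)
    rw [offset_last] at h
    exact Nat.add_le_add_left h _
  · left
    have := v.2
    omega

variable {adj} {G : SimpleGraph (Fin n)}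

lemma describes_encodeInput (h : IsAdjacencyList G adj) :
    Describes (encodeInput t adj) (G.map Fin.valEmbedding) n (total adj) (offset adj) where
  zero := by simp [offset]
  last := offset_last adj
  mono := offset_mono adj
  position v hv := by
    rw [List.getD_eq_getElem?_getD, show v + 3 = (v + 1) + 2 from rfl,
      encodeInput_position adj t hv, Option.getD_some]
  adj v hv e h1 h2 := by
    obtain ⟨j, rfl⟩ := Nat.exists_eq_add_of_le h1
    rw [offset_succ adj hv] at h2
    have hj : j < (adj ⟨v, hv⟩).length := by omega
    rw [List.getD_eq_getElem?_getD, encodeInput_entry, flatten_getElem? adj hv hj, Option.map_some,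
      Option.getD_some]
    exact (SimpleGraph.map_adj _ _ _ _).2
      ⟨⟨v, hv⟩, _, ((h ⟨v, hv⟩).2 _).1 (List.getElem_mem hj), rfl, rfl⟩
  exists_of_adj u v huv := by
    obtain ⟨a, b, hab, rfl, rfl⟩ := (SimpleGraph.map_adj _ _ _ _).1 huv
    obtain ⟨j, hj, hjb⟩ := List.getElem_of_mem (((h a).2 b).2 hab)
    refine ⟨a.2, offset adj a + j, by simp, ?_, ?_⟩
    · rw [Fin.valEmbedding_apply, offset_succ adj a.2]
      simpa using hj
    · rw [List.getD_eq_getElem?_getD, encodeInput_entry, flatten_getElem? adj a.2 hj,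
        Option.map_some, Option.getD_some, hjb]
      rfl

/-- The entries of the lists correspond injectively to ordered adjacent pairs. This justifies
rejecting inputs with longer lists. -/
lemma total_le (h : IsAdjacencyList G adj) {t : ℕ}
    (htd : (G.map Fin.valEmbedding).TdLe t (Finset.range n)) : total adj ≤ 2 * t * n := by
  classical
  have h1 : total adj = (Finset.univ.sigma fun v : Fin n => (adj v).toFinset).card := by
    rw [total, List.length_flatten, List.map_ofFn, List.sum_ofFn, Finset.card_sigma]
    exact Finset.sum_congr rfl fun v _ => (List.toFinset_card_of_nodup (h v).1).symm
  have h2 := htd.card_adj_le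
  rw [Finset.card_range] at h2
  refine le_trans ?_ h2
  rw [h1]
  refine Finset.card_le_card_of_injOn (fun x => ((x.1 : ℕ), (x.2 : ℕ))) ?_ ?_
  · rintro ⟨v, u⟩ hx
    simp only [Finset.coe_sigma, Set.mem_sigma_iff, Finset.mem_coe, List.mem_toFinset] at hx
    simp only [Finset.coe_filter, Finset.mem_product, Finset.mem_range, Set.mem_ofPred_eq]
    exact ⟨⟨v.2, u.2⟩, (SimpleGraph.map_adj _ _ _ _).2 ⟨v, u, ((h v).2 u).1 hx.2, rfl, rfl⟩⟩
  · rintro ⟨v, u⟩ - ⟨v', u'⟩ - hx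
    simp only [Prod.mk.injEq, Fin.val_inj] at hx
    obtain ⟨rfl, rfl⟩ := hx
    rfl

end Input

end Search

namespace Search

open RAM SimpleGraph

/-! ### Computing the parameters -/

/-- Square the number in register `x`, as often as register `4` says. Register `5` holds `1`. -/
def squares (x : ℕ) : Prog := .whileNZ 4 (.seq (.instr (.mul x x x)) (.instr (.sub 4 4 5)))

/-- Double powers of two are obtained from `2` by `k` squarings, without any intermediate value
above the result. -/
lemma squares_runs {inp : List ℕ} {S W : ℕ} {s : State} {x k : ℕ} (hx4 : x ≠ 4) (hx5 : x ≠ 5)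
    (h5 : s.reg 5 = 1) (h4 : s.reg 4 = k) (hx : s.reg x = 2) (hk : k ≤ W) (hW : 2 ^ 2 ^ k ≤ W) :
    Runs inp S W (squares x) s (k * 3 + 1) fun s' =>
      s'.mem = s.mem ∧ s'.reg x = 2 ^ 2 ^ k ∧ ∀ r, r ≠ 4 → r ≠ x → s'.reg r = s.reg r := by
  have := Runs.whileNZ (inp := inp) (S := S) (W := W) (s := s) (x := 4)
    (P := .seq (.instr (.mul x x x)) (.instr (.sub 4 4 5))) (b := 2)
    (fun j s' => j ≤ k ∧ s'.reg 4 = j ∧ s'.mem = s.mem ∧ s'.reg x = 2 ^ 2 ^ (k - j) ∧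
      ∀ r, r ≠ 4 → r ≠ x → s'.reg r = s.reg r) (fun j s' h => by rw [h.2.1]) ?_ k
    ⟨le_rfl, h4, rfl, by simpa using hx, fun _ _ _ => rfl⟩
  · refine this.mono le_rfl ?_
    rintro s' ⟨-, -, h1, h2, h3⟩
    exact ⟨h1, h2, h3⟩
  · rintro j s' ⟨hj, h1, h2, h3, h4⟩
    have hsq : 2 ^ 2 ^ (k - (j + 1)) * 2 ^ 2 ^ (k - (j + 1)) = 2 ^ 2 ^ (k - j) := by
      rw [← pow_add, ← two_mul, ← pow_succ', show k - (j + 1) + 1 = k - j by omega]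
    have hle : 2 ^ 2 ^ (k - j) ≤ 2 ^ 2 ^ k :=
      Nat.pow_le_pow_right (by omega) (Nat.pow_le_pow_right (by omega) (by omega))
    have h5' : s'.reg 5 = 1 := by rw [h4 5 (by omega) (Ne.symm hx5), h5]
    refine Runs.seq (Runs.mul ?_ (Runs.sub ?_ ⟨by omega, ?_, ?_, ?_, ?_⟩))
    · rw [h3, hsq]; omega
    · simp [h1, Ne.symm hx4, Ne.symm hx5, h5']; omega
    · simp [h1, Ne.symm hx4, Ne.symm hx5, h5']
    · simpa using h2
    · simp [hx4, h3, hsq]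
    · intro r hr hr'
      simp [hr, hr', h4]

/-- Read the header of the input, and compare the number of edges with `2 * t * n`. -/
def readHeader : Prog :=
  .seq (.instr (.const 2 0)) <| .seq (.instr (.read 12 2)) <|
  .seq (.instr (.const 5 1)) <| .seq (.instr (.read 15 5)) <|
  .seq (.instr (.const 2 2)) <| .seq (.instr (.add 4 12 2)) <|
  .seq (.instr (.read 9 4)) <| .seq (.instr (.sub 18 9 4)) <|
  .seq (.instr (.sub 18 18 5)) <| .seq (.instr (.mul 1 2 15)) <|
  .seq (.instr (.mul 1 1 12)) (.instr (.sub 1 18 1))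

/-- The state after reading the header. -/
structure HeaderRead (n t m : ℕ) (s : State) : Prop where
  mem : s.mem = fun _ _ => 0
  one : s.reg 1 = m - 2 * t * n
  two : s.reg 2 = 2
  five : s.reg 5 = 1
  length : s.reg 9 = n + 3 + m
  vertices : s.reg 12 = n
  depth : s.reg 15 = t
  edges : s.reg 18 = m
  other : ∀ i, i < 3 ∨ 6 < i → s.reg (3 * i) = 0

/-- The last position `n + 3 + m` in the header is the length of the input and reveals `m` without
reading the lists. Before the rejection test it need not be bounded in terms of `n` and `t`, which
is why the word size includes the length of the input. -/
lemma readHeader_runs {inp : List ℕ} {S W n t m : ℕ} (h0 : inp[0]? = some n)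
    (h1 : inp[1]? = some t) (h2 : inp[n + 2]? = some (n + 3 + m)) (ht : 2 * t ≤ W)
    (htn : 2 * t * n ≤ W) (hW : n + 3 + m ≤ W) :
    Runs inp S W readHeader State.init 12 (HeaderRead n t m) := by
  refine Runs.seq (b := 1) (b' := 11) <| Runs.const (by omega) ?_
  refine Runs.seq (b := 1) (b' := 10) <| Runs.read (v := n) (by simpa using h0) (by omega) ?_
  refine Runs.seq (b := 1) (b' := 9) <| Runs.const (by omega) ?_
  refine Runs.seq (b := 1) (b' := 8) <| Runs.read (v := t) (by simpa using h1) (by omega) ?_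
  refine Runs.seq (b := 1) (b' := 7) <| Runs.const (by omega) ?_
  refine Runs.seq (b := 1) (b' := 6) <| Runs.add (by simp; omega) ?_
  refine Runs.seq (b := 1) (b' := 5) <| Runs.read (v := n + 3 + m) (by simpa using h2) hW ?_
  refine Runs.seq (b := 1) (b' := 4) <| Runs.sub (by simp; omega) ?_
  refine Runs.seq (b := 1) (b' := 3) <| Runs.sub (by simp; omega) ?_
  refine Runs.seq (b := 1) (b' := 2) <| Runs.mul (by simpa using ht) ?_
  refine Runs.seq (b := 1) (b' := 1) <| Runs.mul (by simpa using htn) ?_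
  refine Runs.sub (by simp; omega) ?_
  -- Register `9` holds `n + 3 + m`, register `4` holds `n + 2`, and register `5` holds `1`.
  have hm : n + 3 + m - (n + 2) - 1 = m := by omega
  refine ⟨rfl, ?_, ?_, ?_, ?_, ?_, ?_, ?_, fun i hi => ?_⟩
  all_goals simp [hm]
  simp only [State.put_reg]
  repeat rw [if_neg (by omega)]
  rfl

/-- The parameters. -/
def context (inp : List ℕ) (n t m : ℕ) : Ctx where
  inp := inp
  par i := [(t + 2) * (n + 3 + m) * 2 ^ 2 ^ (4 * t + 1), t + 2, n + 3 + m, n + 3 + m, n, t, m,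
    2 ^ 2 ^ (2 * t + 1), 2 ^ 2 ^ (4 * t + 1), n + m].getD i 0

/-- Compute the parameters. -/
def setParams : Prog :=
  .seq (.instr (.add 4 15 15)) <| .seq (.instr (.add 4 4 5)) <|
  .seq (.instr (.const 21 2)) <| .seq (squares 21) <|
  .seq (.instr (.add 4 15 15)) <| .seq (.instr (.add 4 4 4)) <|
  .seq (.instr (.add 4 4 5)) <| .seq (.instr (.const 24 2)) <|
  .seq (squares 24) <| .seq (.instr (.add 3 15 2)) <|
  .seq (.instr (.const 1 0)) <| .seq (.instr (.add 6 9 1)) <|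
  .seq (.instr (.mul 0 3 6)) <| .seq (.instr (.mul 0 0 24)) (.instr (.add 27 12 18))

lemma four_mul_add_one_le (t : ℕ) : 4 * t + 1 ≤ 2 ^ 2 ^ (4 * t + 1) :=
  (Nat.lt_two_pow_self).le.trans (Nat.lt_two_pow_self).le

lemma two_pow_two_pow_le (t : ℕ) : 2 ^ 2 ^ (2 * t + 1) ≤ 2 ^ 2 ^ (4 * t + 1) :=
  Nat.pow_le_pow_right (by omega) (Nat.pow_le_pow_right (by omega) (by omega))

/-- The registers chosen for the header are already those of the parameters; parameter `i` belongs
in register `3 * i`. The two runs of `squares` take `6 * t + 4` and `12 * t + 4` steps, and `13`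
single instructions complete the bound. -/
lemma setParams_runs {inp : List ℕ} {S W n t m : ℕ} {s : State} (hs : HeaderRead n t m s)
    (hW : (t + 2) * (n + 3 + m) * 2 ^ 2 ^ (4 * t + 1) ≤ W) (ρ : ℕ → ℕ) :
    Runs inp S W setParams s (18 * t + 21) fun s' =>
      Represents (context inp n t m) 0 ρ (fun _ _ _ => 0) s' := by
  have hY1 : 1 ≤ 2 ^ 2 ^ (4 * t + 1) := Nat.one_le_two_pow
  have h4 := four_mul_add_one_le t
  have h2 := two_pow_two_pow_le t
  generalize hX : 2 ^ 2 ^ (2 * t + 1) = X at *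
  generalize hY : 2 ^ 2 ^ (4 * t + 1) = Y at *
  have hrow : (t + 2) * (n + 3 + m) ≤ W := (Nat.le_mul_of_pos_right _ hY1).trans hW
  have ht : t + 2 ≤ W := (Nat.le_mul_of_pos_right _ (by omega)).trans hrow
  have hl : n + 3 + m ≤ W := (Nat.le_mul_of_pos_left _ (by omega)).trans hrow
  have hYW : Y ≤ W := (Nat.le_mul_of_pos_left _ (by positivity)).trans hW
  refine Runs.mono (b := 1 + (1 + (1 + (((2 * t + 1) * 3 + 1) + (1 + (1 + (1 + (1 +
    (((4 * t + 1) * 3 + 1) + (1 + (1 + (1 + (1 + (1 + 1)))))))))))))) ?_ (by omega) (fun _ h => h)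
  refine Runs.seq <| Runs.add (by simp [hs.depth]; omega) ?_
  refine Runs.seq <| Runs.add (by simp [hs.depth, hs.five]; omega) ?_
  refine Runs.seq <| Runs.const (by omega) ?_
  refine Runs.seq <| (squares_runs (k := 2 * t + 1) (by omega) (by omega) (by simp [hs.five])
    (by simp [hs.depth, hs.five]; omega) (by simp) (by omega) (by omega)).mono le_rfl ?_
  rintro s₁ ⟨a1, a2, a3⟩
  have b1 : s₁.mem = fun _ _ => 0 := a1.trans hs.mem
  have b2 : ∀ r, r ≠ 4 → r ≠ 21 → s₁.reg r = s.reg r := by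
    intro r hr hr'
    rw [a3 r hr hr']
    simp [hr, hr']
  rw [hX] at a2
  refine Runs.seq <| Runs.add (by simp [b2, hs.depth]; omega) ?_
  refine Runs.seq <| Runs.add (by simp [b2, hs.depth]; omega) ?_
  refine Runs.seq <| Runs.add (by simp [b2, hs.depth, hs.five]; omega) ?_
  refine Runs.seq <| Runs.const (by omega) ?_
  refine Runs.seq <| (squares_runs (k := 4 * t + 1) (by omega) (by omega) (by simp [b2, hs.five])
    (by simp [b2, hs.depth, hs.five]; omega) (by simp) (by omega) (by omega)).mono le_rfl ?_
  rintro s₂ ⟨c1, c2, c3⟩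
  have d1 : s₂.mem = fun _ _ => 0 := c1.trans b1
  have d2 : ∀ r, r ≠ 4 → r ≠ 21 → r ≠ 24 → s₂.reg r = s.reg r := by
    intro r hr hr' hr''
    rw [c3 r hr hr'']
    simp [hr, hr'', b2 r hr hr']
  have d3 : s₂.reg 21 = X := by
    rw [c3 21 (by omega) (by omega)]
    simpa using a2
  rw [hY] at c2
  clear c1 c3 a1 a2 a3 b1 b2
  refine Runs.seq <| Runs.add (by simp [d2, hs.depth, hs.two]; omega) ?_
  refine Runs.seq <| Runs.const (by omega) ?_
  refine Runs.seq <| Runs.add (by simp [d2, hs.length]; omega) ?_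
  refine Runs.seq <| Runs.mul (by simpa [d2, hs.depth, hs.two, hs.length] using hrow) ?_
  refine Runs.seq <| Runs.mul (by simpa [d2, hs.depth, hs.two, hs.length, c2] using hW) ?_
  refine Runs.add (by simp [d2, hs.vertices, hs.edges]; omega) ?_
  refine ⟨fun i => ?_, fun j hj => absurd hj (by omega), fun j hj => absurd hj (by omega), ?_,
    ⟨fun _ _ _ => Nat.zero_le _, fun _ _ _ _ => rfl⟩⟩
  · rcases lt_or_ge i 10 with hi | hi
    · interval_cases i <;>
        simp [context, d2, d3, c2, hs.depth, hs.two, hs.length, hs.vertices, hs.edges, hX, hY]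
    · rw [context]
      simp only [State.put_reg]
      repeat rw [if_neg (by omega)]
      rw [d2 _ (by omega) (by omega) (by omega), hs.other i (by omega), List.getD_eq_default]
      simpa using hi
  · intro a r c _ _
    simp [d1]

end Search

namespace Search

open RAM SimpleGraph

/-! ### The program and its bounds -/

/-- The program. The answer is in register `0`. -/
def program : Prog :=
  .seq readHeader (.ifNZ 1 .skip (.seq setParams (.seq (main.prog 0)
    (.seq (.instr (.const 2 0)) (.instr (.load 0 13 2))))))

/-! ### The parameters fit on the machine -/

section Context

variable {inp : List ℕ} {n t m : ℕ}

/-- The limit is the number of cells times a double power of two, so it dominates either factor as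
well as small multiples of them. -/
lemma context_mul_le {x y : ℕ} (hx : x ≤ (t + 2) * (n + 3 + m)) (hy : y ≤ 2 ^ 2 ^ (4 * t + 1)) :
    x * y ≤ (context inp n t m).lim :=
  Nat.mul_le_mul hx hy

lemma length_mul_two_le : 2 * (n + 3 + m) ≤ (context inp n t m).lim := by
  have h := context_mul_le (inp := inp) (n := n) (t := t) (m := m) (x := 2 * (n + 3 + m)) (y := 1)
    (Nat.mul_le_mul_right _ (by omega)) Nat.one_le_two_pow
  omega

lemma mul_six_le : 6 * 2 ^ 2 ^ (4 * t + 1) ≤ (context inp n t m).lim := by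
  refine context_mul_le ?_ le_rfl
  exact Nat.mul_le_mul (show 2 ≤ t + 2 by omega) (show 3 ≤ n + 3 + m by omega)

lemma params_context :
    Params (context inp n t m) n t m (2 ^ 2 ^ (2 * t + 1)) := by
  have h1 := length_mul_two_le (inp := inp) (n := n) (t := t) (m := m)
  have h2 := mul_six_le (inp := inp) (n := n) (t := t) (m := m)
  have h3 := four_mul_add_one_le t
  have h4 := two_pow_two_pow_le t
  refine ⟨rfl, rfl, rfl, rfl, rfl, ?_, by omega, by omega, by omega⟩
  change n < n + 3 + m
  omega

lemma fits_context {S W : ℕ} (hS : (context inp n t m).lim ≤ S)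
    (hW : 2 * (context inp n t m).lim ≤ W) (hl : inp.length = n + 3 + m)
    (hinp : ∀ x ∈ inp, x ≤ n + 3 + m ∨ x = t) : (context inp n t m).Fits S W := by
  have h1 := length_mul_two_le (inp := inp) (n := n) (t := t) (m := m)
  have h2 := mul_six_le (inp := inp) (n := n) (t := t) (m := m)
  have h3 := four_mul_add_one_le t
  have h4 := two_pow_two_pow_le t
  refine ⟨by omega, fun i => ?_, ?_, hS, hW, hl.symm, fun x hx => ?_⟩
  · rcases lt_or_ge i 10 with hi | hi
    · interval_cases i
      · exact le_rfl
      · change t + 2 ≤ _; omega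
      · change n + 3 + m ≤ _; omega
      · change n + 3 + m ≤ _; omega
      · change n ≤ _; omega
      · change t ≤ _; omega
      · change m ≤ _; omega
      · change 2 ^ 2 ^ (2 * t + 1) ≤ _; omega
      · change 2 ^ 2 ^ (4 * t + 1) ≤ _; omega
      · change n + m ≤ _; omega
    · rw [show (context inp n t m).par i = 0 from List.getD_eq_default _ _ (by simpa using hi)]
      exact Nat.zero_le _
  · have h5 := context_mul_le (inp := inp) (n := n) (t := t) (m := m) le_rfl Nat.one_le_two_pow
    rwa [Nat.mul_one] at h5
  · rcases hinp x hx with h | h <;> omega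

end Context

/-- A bound for all quantities that depend on `t` only. -/
def scale (t : ℕ) : ℕ := 2 ^ 2 ^ (5 * max t 1)

/-- An eighth power adds `3` to the upper exponent, and `5 * max t 1 + 3 ≤ 8 * max t 1`; this gives
the constant `8` of the theorem. -/
lemma scale_pow_eight_le (t : ℕ) : scale t ^ 8 ≤ 2 ^ 2 ^ (8 * max t 1) := by
  rw [scale, ← pow_mul]
  refine Nat.pow_le_pow_right (by omega) ?_
  rw [show (8 : ℕ) = 2 ^ 3 by norm_num, ← pow_add]
  exact Nat.pow_le_pow_right (by omega) (by omega)

lemma two_pow_le_scale {t k : ℕ} (hk : k ≤ 5 * max t 1) : 2 ^ 2 ^ k ≤ scale t :=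
  Nat.pow_le_pow_right (by omega) (Nat.pow_le_pow_right (by omega) hk)

/-- Every numerical constant or factor linear in `t` can thus be traded for one factor `scale t`. -/
lemma linear_le_scale (t : ℕ) : 9000 * (t + 2) ≤ scale t := by
  have h1 : 2 ^ (5 * 1) ≤ 2 ^ (5 * max t 1) := Nat.pow_le_pow_right (by omega) (by omega)
  have h2 : t + 1 ≤ 2 ^ (2 * max t 1) := by
    refine Nat.lt_two_pow_self.trans_le (Nat.pow_le_pow_right (by omega) (by omega))
  have h3 : 2 ^ (2 * max t 1) * 8 ≤ 2 ^ (5 * max t 1) := by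
    rw [show (8 : ℕ) = 2 ^ 3 by norm_num, ← pow_add]
    exact Nat.pow_le_pow_right (by omega) (by omega)
  have h4 : 15 + (t + 2) ≤ 2 ^ (5 * max t 1) := by omega
  calc 9000 * (t + 2) ≤ 2 ^ 15 * 2 ^ (t + 2) :=
        Nat.mul_le_mul (by norm_num) Nat.lt_two_pow_self.le
    _ = 2 ^ (15 + (t + 2)) := (pow_add 2 15 (t + 2)).symm
    _ ≤ scale t := Nat.pow_le_pow_right (by omega) h4

/-- If the input is not rejected, then `m ≤ 2 * t * n`, so the number of cells and all costs are
linear in `max n 1` with coefficients that are products of few factors `scale t`. -/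
lemma program_runs {n t B : ℕ} {G : SimpleGraph (Fin n)} {adj : Fin n → List (Fin n)}
    (h : IsAdjacencyList G adj) (hB : scale t ^ 8 * max n 1 ≤ B) :
    Runs (encodeInput t adj) B (B + (encodeInput t adj).length) program State.init B fun s =>
      (s.reg 0 = 1 ∧ IsDecomp (G.map Fin.valEmbedding) (s.mem 0) t (Finset.range n)) ∨
      (s.reg 0 = 0 ∧ ¬(G.map Fin.valEmbedding).TdLe t (Finset.range n)) := by
  have hlen := length_encodeInput adj t
  set inp := encodeInput t adj with hinp
  set m := total adj with hm
  set N := max n 1 with hN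
  have hZ := linear_le_scale t
  have hX := two_pow_le_scale (t := t) (k := 2 * t + 1) (by omega)
  have hY := two_pow_le_scale (t := t) (k := 4 * t + 1) (by omega)
  set Z := scale t with hZdef
  have hN1 : 1 ≤ N := by omega
  have hpow : ∀ k ≤ 8, Z ^ k * N ≤ B := fun k hk =>
    (Nat.mul_le_mul_right _ (Nat.pow_le_pow_right (by omega) hk)).trans hB
  have hZB : Z ≤ B := by
    have := hpow 1 (by omega)
    rw [pow_one] at this
    exact (Nat.le_mul_of_pos_right _ hN1).trans this
  have htn : 2 * t * n ≤ B := by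
    have := hpow 1 (by omega)
    rw [pow_one] at this
    exact (Nat.mul_le_mul (by omega) (by omega)).trans this
  refine Runs.mono (b := 12 + (0 + (18 * t + 21 + (7000 * (2 ^ 2 ^ (4 * t + 1) *
    (2 ^ 2 ^ (2 * t + 1) * ((2 * t + 4) * N))) + (1 + 1))) + 1)) ?_ ?_ (fun _ h => h)
  · refine Runs.seq ((readHeader_runs (m := m) (encodeInput_zero adj t) (encodeInput_one adj t)
      ((encodeInput_position adj t le_rfl).trans (by rw [offset_last])) (by omega) (by omega)
      (by omega)).mono le_rfl fun s hs => ?_)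
    -- Rejection leaves register `0` at its initial value `0`, which is the negative answer; too
    -- many edges contradict the bound on the treedepth.
    refine Runs.ifNZ (fun hrej => Runs.skip (.inr ⟨hs.other 0 (by omega), fun htd => ?_⟩))
      fun hacc => ?_
    · have := total_le h htd
      rw [hs.one] at hrej
      omega
    rw [hs.one] at hacc
    have hmle : n + 3 + m ≤ (2 * t + 4) * N := by
      have h1 : 2 * t * n ≤ 2 * t * N := Nat.mul_le_mul_left _ (by omega)
      have h2 : (2 * t + 4) * N = 2 * t * N + 4 * N := by ring
      omega
    have hlim : 2 * (context inp n t m).lim ≤ B := by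
      refine le_trans ?_ (hpow 3 (by omega))
      calc 2 * ((t + 2) * (n + 3 + m) * 2 ^ 2 ^ (4 * t + 1))
          ≤ 2 * ((t + 2) * ((2 * t + 4) * N) * 2 ^ 2 ^ (4 * t + 1)) := by gcongr
        _ = (2 * (t + 2)) * (2 * t + 4) * 2 ^ 2 ^ (4 * t + 1) * N := by ring
        _ ≤ Z * Z * Z * N := by gcongr <;> omega
        _ = Z ^ 3 * N := by ring
    have hlim' : (context inp n t m).lim ≤ B := by omega
    have hfits : (context inp n t m).Fits B (B + inp.length) :=
      fits_context hlim' (by omega) hlen (by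
        rw [← hlen]
        exact fun x hx => le_of_mem_encodeInput adj t hx)
    have hpar : Params (context inp n t m) n t m _ := params_context
    have h3 := four_mul_add_one_le t
    refine Runs.seq ((setParams_runs hs (hlim'.trans (by omega)) fun _ => 0).mono le_rfl
      fun s₁ hs₁ => ?_)
    have hcost := main_cost_le (K := context inp n t m) (N := (2 * t + 4) * N)
      (X := 2 ^ 2 ^ (2 * t + 1)) (Y := 2 ^ 2 ^ (4 * t + 1)) (by omega) Nat.one_le_two_pow
      Nat.one_le_two_pow (show n ≤ _ by omega) (show t ≤ _ by omega) (show m ≤ _ by omega) rfl rfl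
      (show n + m ≤ _ by omega)
    refine Runs.seq ((Cmd.prog_runs hfits main 0 main_closed _ _ s₁ hs₁).mono hcost
      fun s₂ hs₂ => ?_)
    have hrows : 0 < (context inp n t m).rows := by rw [hpar.rows]; omega
    have hwd : 0 < (context inp n t m).wd := by have := hpar.n_lt; omega
    have hmem : s₂.mem 13 0 =
        main.run (context inp n t m) 0 (fun _ => 0) (fun _ _ _ => 0) 13 0 0 := by
      simpa using hs₂.mem 13 0 0 hrows hwd
    have hpare : ∀ v < n, s₂.mem 0 v =
        main.run (context inp n t m) 0 (fun _ => 0) (fun _ _ _ => 0) 0 0 v := by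
      intro v hv
      simpa using hs₂.mem 0 0 v hrows (hv.trans hpar.n_lt)
    have hspec := main_spec hpar rfl (show n + m + 3 ≤ n + 3 + m by omega)
      (by have := length_mul_two_le (inp := inp) (n := n) (t := t) (m := m); omega)
      (describes_encodeInput t h) (two_pow_le t) (fun k hk => markBound_add_one_le hk)
      (duration_le t) (fun _ => 0)
    rw [← hmem] at hspec
    refine Runs.seq (Runs.const (by omega) (Runs.load (by simp; omega) ?_ ?_))
    · simp
      rcases hspec with h | h <;> omega
    · rcases hspec with h4 | h4
      · refine .inl ⟨by simpa using h4.1, h4.2.congr fun v hv => ?_⟩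
        simpa using hpare v (Finset.mem_range.1 hv)
      · exact .inr ⟨by simpa using h4.1, h4.2⟩
  -- The main part takes at most `Z ^ 4 * N` steps; one more factor `Z` covers the header and the
  -- computation of the parameters.
  · refine le_trans ?_ (hpow 5 (by omega))
    have h1 : 7000 * (2 ^ 2 ^ (4 * t + 1) * (2 ^ 2 ^ (2 * t + 1) * ((2 * t + 4) * N))) ≤
        Z ^ 4 * N := by
      calc 7000 * (2 ^ 2 ^ (4 * t + 1) * (2 ^ 2 ^ (2 * t + 1) * ((2 * t + 4) * N)))
          ≤ Z * (Z * (Z * (Z * N))) := by gcongr <;> omega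
        _ = Z ^ 4 * N := by ring
    have h2 : Z ≤ Z ^ 4 * N := (Nat.le_self_pow (by omega) _).trans (Nat.le_mul_of_pos_right _ hN1)
    have h3 : 2 * (Z ^ 4 * N) ≤ Z ^ 5 * N := by
      calc 2 * (Z ^ 4 * N) ≤ Z * (Z ^ 4 * N) := Nat.mul_le_mul_right _ (by omega)
        _ = Z ^ 5 * N := by ring
    omega

end Search

theorem mainTheorem2 :
    ∃ (P : RAM.Prog) (c : ℕ),
      ∀ (n t : ℕ) (G : SimpleGraph (Fin n)) (adj : Fin n → List (Fin n)),
        IsAdjacencyList G adj →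
        ∀ B : ℕ, B = 2 ^ 2 ^ (c * max t 1) * max n 1 →
          ∃ (time : ℕ) (s : RAM.State),
            RAM.Exec (encodeInput t adj) B (B + (encodeInput t adj).length)
              P RAM.State.init time s ∧
            time ≤ B ∧
            s.reg 0 = (if treedepth G ≤ t then 1 else 0) ∧
            (treedepth G ≤ t →
              ∃ F : RootedForest (Fin n),
                HoldsForest s F ∧ IsTreedepthDecomposition G F id ∧ F.height ≤ t) := by
  refine ⟨Search.program, 8, fun n t G adj h B hB => ?_⟩
  obtain ⟨time, s, h1, h2, h3⟩ := Search.program_runs (t := t) (B := B) h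
    (hB ▸ Nat.mul_le_mul_right _ (Search.scale_pow_eight_le t))
  refine ⟨time, s, h1, h2, ?_⟩
  rcases h3 with ⟨h3, h4⟩ | ⟨h3, h4⟩
  · rw [if_pos (treedepth_le_of_isDecomp h4), h3]
    exact ⟨rfl, fun _ => h4.exists_forest⟩
  · have h5 : ¬treedepth G ≤ t := fun h5 => h4 (tdLe_of_treedepth_le h5)
    rw [if_neg h5, h3]
    exact ⟨rfl, fun h6 => absurd h6 h5⟩
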